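/- **Setting.** Let $n_c\ge 2$. A glued-trees graph $\mathcal G$ consists of two balanced binary trees with $n_c$ columns each ($N=2(2^{n_c}-1)$ vertices in total), where the leaves of the two trees are joined so that every leaf of one tree is adjacent to exactly two leaves of the other. The roots of the left and right tree are called ENTRANCE and EXIT; they are the only vertices of degree $2$. The vertices carry arbitrary distinct $(n_c+1)$-bit names, and $A$ is the adjacency matrix on $n=n_c+1$ qubits (unused names are isolated). Given the name of the ENTRANCE, oracle access to $A$ and to the degree function, the problem is to find the name of the EXIT. The oracle access to $A$ consists of unitaries $O_P:|u\rangle|0\rangle\mapsto 3^{-1/2}\sum_{v\in\tilde N[u]}|u\rangle|v\rangle$, where $\tilde N[u]$ has three elements and contains all neighbours of $u$, and $O_\vartheta:|u,v\rangle|0\rangle\mapsto|u,v\rangle|\vartheta_{uv}\rangle$ with $\vartheta_{uv}=\arccos\sqrt{A_{uv}}\in\{0,\pi/2\}$. Let $\Delta_\lambda$ be the minimum gap between distinct eigenvalues of $A$ projected onto the span of the $2n_c$ column states (the normalized sums of the vertices of each column). **Algorithm.** Let $U_A$ be a Hermitian unitary on $a+n$ qubits with $\langle 0|^{\otimes a}U_A|0\rangle^{\otimes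 a}=A/3$, and let $V=U_A(2\Pi-I)$ with $\Pi=|0\rangle\langle0|^{\otimes a}\otimes I$. One run applies quantum phase estimation of $V$ with an $m$-qubit phase register (Hadamard gates, controlled powers $V^z$, $0\le z<2^m$, inverse quantum Fourier transform) to $|0\rangle^{\otimes a}|\mathrm{ENTRANCE}\rangle$, measures the ancillas with post-selection on $|0\rangle^{\otimes a}$, and measures the state register in the computational basis. With $U_A=U_T^\dagger\,\mathrm{SWAP}\,U_T$ ($a=n+2$), where $U_T$ prepares $3^{-1/2}\sum_{v\in\tilde N[u]}(\cos\vartheta_{uv}|0\rangle+\sin\vartheta_{uv}|1\rangle)|v\rangle$ from $|u\rangle$ by one call each of $O_P$, $O_\vartheta$ and $O_\vartheta^\dagger$, the run is an explicit circuit of oracle calls and (multi-)controlled single-qubit gates. **Theorem.** For $n_c\ge2$, $\Delta_\lambda>0$ and $m_0=\lceil\log_2(3\pi/\Delta_\lambda)\rceil$ depend on $n_c$ only, and there is an absolute constant $C>0$ such that the following holds for all $n_c\ge 2$. 1. $m_0\le C\log n_c$. For every $m$, one run with an $m$-qubit phase register makes $6(2^m-1)$ calls of $O_P$, $O_\vartheta$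 and their inverses; for $m=m_0$ this is at most $C n_c^3$. 2. For every glued-trees graph with $n_c$ columns in each tree, every $m\ge m_0$ (in particular $m=\gamma m_0$ with any integer $\gamma\ge1$), and every $U_A$ as above, the probability $\mathrm{Prob}(\mathrm{EXIT})$ that a run finds the ancillas in $|0\rangle^{\otimes a}$ and outputs the EXIT satisfies $$\frac{3}{32\,n_c}-\frac{C}{n_c^2}\;\le\;\mathrm{Prob}(\mathrm{EXIT})\;\le\;\frac{C}{n_c},$$ and it is at most the probability of the EXIT conditioned on successful post-selection. The two displayed bounds hold for the explicit oracle circuit as well. 3. For every integer $\gamma\ge1$ there are $C'>0$ and $d$ such that, for all $n_c\ge2$ and $\zeta\in(0,1)$, some number $R\le C' n_c(1+\log(1/\zeta))$ of independent runs of the circuit with $m=\gamma m_0$, each followed by a query of the degree function (the answer is the first output of degree $2$ other than the ENTRANCE), finds the EXIT with probability at least $1-\zeta$ for every glued-trees graph with $n_c$ columns in each tree. The total time is at most $C' n_c^{d}(1+\log(1/\zeta))$ and at most $C'(\log_2N)^{d}(1+\log(1/\zeta))$. Here an oracle or degree query and the measurement of a qubit take one step each, and a single-qubit gate with $c$ controls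 takes $(c+1)^2$ steps. -/

import Mathlib

open Matrix

noncomputable section

/-! ### Glued-trees graphs -/

/-- Bit strings of length `k`; they label the computational basis of `k` qubits. -/
abbrev Bits (k : ℕ) : Type := Fin k → Fin 2

/-- Nodes of the balanced binary tree with `n` columns, in heap numbering: the root is `1` and the
children of `i` are `2 * i` and `2 * i + 1`. -/
abbrev TreeNode (n : ℕ) : Type := ↥(Finset.Ico 1 (2 ^ n))

/-- Vertices of two disjoint balanced binary trees with `n` columns each:
`(0, i)` lies in the left tree, `(1, i)` in the right tree. There are `2 * (2 ^ n - 1)` of them. -/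
abbrev Vertex (n : ℕ) : Type := Fin 2 × TreeNode n

/-- The nodes of the last (`n`-th) column of a tree. -/
def IsLeaf {n : ℕ} (i : TreeNode n) : Prop := 2 ^ (n - 1) ≤ (i : ℕ)

/-- An instance of the glued-trees problem with `n` columns in each tree: a way to glue the leaves
of the left tree to those of the right tree such that each leaf is joined to exactly two leaves of
the other tree, and an arbitrary assignment of distinct `(n + 1)`-bit names to the vertices. -/
structure GluedTrees (n : ℕ) where
  glue : TreeNode n → TreeNode n → Prop
  isLeaf_of_glue : ∀ i j, glue i j → IsLeaf i ∧ IsLeaf j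
  glue_left : ∀ i, IsLeaf i → {j | glue i j}.ncard = 2
  glue_right : ∀ j, IsLeaf j → {i | glue i j}.ncard = 2
  label : Vertex n ↪ Bits (n + 1)

namespace GluedTrees

variable {n : ℕ}

/-- The glued-trees graph. -/
def graph (G : GluedTrees n) : SimpleGraph (Vertex n) where
  Adj x y :=
    (x.1 = y.1 ∧ ((x.2 : ℕ) / 2 = y.2 ∨ (y.2 : ℕ) / 2 = x.2)) ∨
    (x.1 = 0 ∧ y.1 = 1 ∧ G.glue x.2 y.2) ∨
    (x.1 = 1 ∧ y.1 = 0 ∧ G.glue y.2 x.2)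
  symm := ⟨fun x y h => by
    rcases h with ⟨h, h' | h'⟩ | ⟨h1, h2, h3⟩ | ⟨h1, h2, h3⟩
    · exact Or.inl ⟨h.symm, Or.inr h'⟩
    · exact Or.inl ⟨h.symm, Or.inl h'⟩
    · exact Or.inr (Or.inr ⟨h2, h1, h3⟩)
    · exact Or.inr (Or.inl ⟨h2, h1, h3⟩)⟩
  loopless := ⟨fun x h => by
    have hx := (Finset.mem_Ico.mp x.2.2).1
    rcases h with ⟨_, h | h⟩ | ⟨h1, h2, _⟩ | ⟨h1, h2, _⟩
    · omega
    · omega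
    · rw [h1] at h2; exact absurd h2 (by decide)
    · rw [h1] at h2; exact absurd h2 (by decide)⟩

/-- The graph on the names. Names that are not in use are isolated vertices. -/
def labelled (G : GluedTrees n) : SimpleGraph (Bits (n + 1)) := G.graph.map G.label

open Classical in
/-- The adjacency matrix on the `n + 1` qubits of the state register. -/
def adj (G : GluedTrees n) : Matrix (Bits (n + 1)) (Bits (n + 1)) ℂ := G.labelled.adjMatrix ℂ

/-- The degree function of the problem. -/
def deg (G : GluedTrees n) (u : Bits (n + 1)) : ℕ := (G.labelled.neighborSet u).ncard

/-- The name of a root: `side = 0` is the ENTRANCE, `side = 1` is the EXIT. For `n = 0` there are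
no vertices, and the value is a default. -/
def rootLabel (G : GluedTrees n) (side : Fin 2) : Bits (n + 1) :=
  if h : 1 ∈ Finset.Ico 1 (2 ^ n) then G.label (side, ⟨1, h⟩) else 0

def entrance (G : GluedTrees n) : Bits (n + 1) := G.rootLabel 0

def exit (G : GluedTrees n) : Bits (n + 1) := G.rootLabel 1

/-- The column of a vertex, counted from the left and starting at `0`: columns `0, …, n - 1` form
the left tree and `n, …, 2 n - 1` the right tree. -/
def column (x : Vertex n) : ℕ :=
  if x.1 = 0 then Nat.log 2 (x.2 : ℕ) else 2 * n - 1 - Nat.log 2 (x.2 : ℕ)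

/-- The column state: the normalized sum of the vertices in column `j`. -/
def colState (j : Fin (2 * n)) (x : Vertex n) : ℝ :=
  if column x = j then
    1 / Real.sqrt (2 ^ (if (j : ℕ) < n then (j : ℕ) else 2 * n - 1 - j))
  else 0

open Classical in
/-- The adjacency matrix projected onto the column subspace, in the basis of the column states:
its entries are `⟨col i| A |col j⟩`. -/
def colMatrix (G : GluedTrees n) : Matrix (Fin (2 * n)) (Fin (2 * n)) ℝ :=
  Matrix.of fun i j => colState i ⬝ᵥ (G.graph.adjMatrix ℝ *ᵥ colState j)

/-- The minimum gap between distinct eigenvalues of the projected adjacency matrix. -/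
def colGap (G : GluedTrees n) : ℝ :=
  sInf {d | ∃ x ∈ spectrum ℝ G.colMatrix, ∃ y ∈ spectrum ℝ G.colMatrix, x ≠ y ∧ d = |x - y|}

end GluedTrees

/-! ### Quantum phase estimation of the walk operator of a block-encoding -/

/-- The basis vector `|i⟩`. -/
def ket {ι : Type*} [DecidableEq ι] (i : ι) : ι → ℂ := Pi.single i 1

/-- `U` is a Hermitian unitary on `a` ancilla qubits and `k` further qubits with
`⟨0|^a U |0⟩^a = α H`. -/
def IsHermitianBlockEncoding {a k : ℕ} (α : ℝ) (H : Matrix (Bits k) (Bits k) ℂ)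
    (U : Matrix (Bits a × Bits k) (Bits a × Bits k) ℂ) : Prop :=
  U ∈ Matrix.unitaryGroup (Bits a × Bits k) ℂ ∧ U.IsHermitian ∧
    ∀ u v, U (0, u) (0, v) = (α : ℂ) * H u v

/-- The walk operator `V = U (2 Π - I)`, with `Π` the projector onto the ancilla state `|0⟩^a`. -/
def walkOperator {a k : ℕ} (U : Matrix (Bits a × Bits k) (Bits a × Bits k) ℂ) :
    Matrix (Bits a × Bits k) (Bits a × Bits k) ℂ :=
  U * ((2 : ℂ) • Matrix.diagonal (fun x => if x.1 = 0 then 1 else 0) - 1)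

section QPE

variable {ι : Type*} [Fintype ι] [DecidableEq ι]

/-- The joint state of an `m`-qubit phase register and a system in state `ψ`, after Hadamard gates
on the phase register and the powers of `V` controlled by it: `M^{-1/2} ∑_z |z⟩ V^z ψ`. -/
def controlledPowers (m : ℕ) (V : Matrix ι ι ℂ) (ψ : ι → ℂ) (z : Fin (2 ^ m)) (i : ι) : ℂ :=
  (1 / Real.sqrt (2 ^ m) : ℝ) * ((V ^ (z : ℕ)) *ᵥ ψ) i

/-- The inverse quantum Fourier transform on the phase register. -/
def inverseQFT (m : ℕ) (φ : Fin (2 ^ m) → ι → ℂ) (x : Fin (2 ^ m)) (i : ι) : ℂ :=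
  (1 / Real.sqrt (2 ^ m) : ℝ) *
    ∑ z : Fin (2 ^ m), Complex.exp (-(2 * Real.pi * Complex.I * z * x / 2 ^ m)) * φ z i

/-- The final state of quantum phase estimation. -/
def qpeState (m : ℕ) (V : Matrix ι ι ℂ) (ψ : ι → ℂ) : Fin (2 ^ m) → ι → ℂ :=
  inverseQFT m (controlledPowers m V ψ)

end QPE

/-- The probability that, after phase estimation of the walk operator of `U` on `|0⟩^a |u⟩`, the
ancillas are found in `|0⟩^a` and the state register in `|v⟩` (with any value of the phase). -/
def jointProb {a k : ℕ} (m : ℕ) (U : Matrix (Bits a × Bits k) (Bits a × Bits k) ℂ)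
    (u v : Bits k) : ℝ :=
  ∑ x, ‖qpeState m (walkOperator U) (ket (0, u)) x (0, v)‖ ^ 2

/-- The probability that `v` is found in the state register, conditioned on the ancillas being
found in `|0⟩^a`. -/
def postselectedProb {a k : ℕ} (m : ℕ) (U : Matrix (Bits a × Bits k) (Bits a × Bits k) ℂ)
    (u v : Bits k) : ℝ :=
  jointProb m U u v / ∑ w, jointProb m U u w

/-! ### Oracles for the adjacency matrix -/

/-- The angle `arccos √(|A_uv| / ‖A‖_max)`, where `‖A‖_max = 1`. -/
def GluedTrees.angle {n : ℕ} (G : GluedTrees n) (u v : Bits (n + 1)) : ℝ :=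
  Real.arccos (Real.sqrt ‖G.adj u v‖)

open Classical in
/-- The single bit `b` that represents the angle, which is `b * π / 2`. -/
def GluedTrees.angleBit {n : ℕ} (G : GluedTrees n) (u v : Bits (n + 1)) : Fin 2 :=
  if G.labelled.Adj u v then 0 else 1

theorem GluedTrees.angle_eq {n : ℕ} (G : GluedTrees n) (u v : Bits (n + 1)) :
    G.angle u v = ((G.angleBit u v : ℕ) : ℝ) * (Real.pi / 2) := by
  classical
  by_cases h : G.labelled.Adj u v <;>
    simp [GluedTrees.angle, GluedTrees.angleBit, GluedTrees.adj, SimpleGraph.adjMatrix_apply, h]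

/-- Oracle access to the `3`-sparse adjacency matrix: unitaries with the actions
`|u⟩|0⟩ ↦ 3^{-1/2} ∑_{v ∈ nbhd u} |u⟩|v⟩` and `|u⟩|v⟩|0⟩ ↦ |u⟩|v⟩|angle u v⟩`, where `nbhd u` has
three elements and contains all neighbours of `u`. (The entries of the adjacency matrix are
non-negative, so that no sign has to be recorded.) -/
structure MatrixOracles {n : ℕ} (G : GluedTrees n) where
  nbhd : Bits (n + 1) → Finset (Bits (n + 1))
  card_nbhd : ∀ u, (nbhd u).card = 3
  mem_nbhd : ∀ u v, G.labelled.Adj u v → v ∈ nbhd u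
  position : Matrix.unitaryGroup (Fin (n + 1) ⊕ Fin (n + 1) → Fin 2) ℂ
  position_spec : ∀ u : Bits (n + 1),
    position.1 *ᵥ ket (Sum.elim u 0) =
      ∑ v ∈ nbhd u, ((1 / Real.sqrt 3 : ℝ) : ℂ) • ket (Sum.elim u v)
  angle : Matrix.unitaryGroup ((Fin (n + 1) ⊕ Fin (n + 1)) ⊕ Unit → Fin 2) ℂ
  angle_spec : ∀ u v : Bits (n + 1),
    angle.1 *ᵥ ket (Sum.elim (Sum.elim u v) 0) =
      ket (Sum.elim (Sum.elim u v) (fun _ => G.angleBit u v))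

/-! ### Quantum circuits with oracle gates -/

/-- The gates of a circuit on the qubits `W`, for an input size `k`. -/
inductive Gate (W : Type) (k : ℕ) where
  /-- The single-qubit unitary `U` on the qubit `t`, controlled by the qubits in `pos` being `1` and
  those in `neg` being `0` (`t` itself is never a control). -/
  | ctrl (pos neg : Finset W) (t : W) (U : Matrix.unitaryGroup (Fin 2) ℂ)
  /-- A call of the position oracle, or of its inverse if `inv`, on the qubits given by `e`. -/
  | position (inv : Bool) (e : Fin k ⊕ Fin k ↪ W)
  /-- A call of the angle oracle, or of its inverse if `inv`, on the qubits given by `e`. -/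
  | angle (inv : Bool) (e : (Fin k ⊕ Fin k) ⊕ Unit ↪ W)

section Circuits

variable {W : Type} [Fintype W] [DecidableEq W]

/-- Apply the matrix `M` to the qubits selected by `e`. -/
def applyOn {K : Type} [Fintype K] [DecidableEq K] (M : Matrix (K → Fin 2) (K → Fin 2) ℂ)
    (e : K ↪ W) (ψ : (W → Fin 2) → ℂ) (x : W → Fin 2) : ℂ :=
  ∑ y : K → Fin 2, M (x ∘ e) y * ψ (Function.extend e y x)

/-- The action of a gate on a state vector. -/
def Gate.apply {n : ℕ} {G : GluedTrees n} (O : MatrixOracles G) :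
    Gate W (n + 1) → ((W → Fin 2) → ℂ) → ((W → Fin 2) → ℂ)
  | .ctrl pos neg t U, ψ => fun x =>
      if (∀ w ∈ pos, w ≠ t → x w = 1) ∧ (∀ w ∈ neg, w ≠ t → x w = 0) then
        ∑ b : Fin 2, U.1 (x t) b * ψ (Function.update x t b)
      else ψ x
  | .position inv e, ψ => applyOn (if inv then (O.position.1)ᴴ else O.position.1) e ψ
  | .angle inv e, ψ => applyOn (if inv then (O.angle.1)ᴴ else O.angle.1) e ψ

/-- Run a circuit, the head of the list first. -/
def runCircuit {n : ℕ} {G : GluedTrees n} (O : MatrixOracles G) (c : List (Gate W (n + 1)))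
    (ψ : (W → Fin 2) → ℂ) : (W → Fin 2) → ℂ :=
  c.foldl (fun φ g => g.apply O φ) ψ

/-- Whether a gate is an oracle query. -/
def Gate.isQuery {k : ℕ} : Gate W k → Bool
  | .ctrl _ _ _ _ => false
  | .position _ _ => true
  | .angle _ _ => true

/-- The time of a gate: a query takes one step; a single-qubit gate with `c` controls is counted with
`(c + 1) ^ 2` steps, which is, up to a constant factor, the number of one- and two-qubit gates needed
to implement it without further qubits. -/
def Gate.time {k : ℕ} : Gate W k → ℕ
  | .ctrl pos neg _ _ => (pos.card + neg.card + 1) ^ 2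
  | .position _ _ => 1
  | .angle _ _ => 1

def queryCount {k : ℕ} (c : List (Gate W k)) : ℕ := c.countP Gate.isQuery

def circuitTime {k : ℕ} (c : List (Gate W k)) : ℕ := (c.map Gate.time).sum

end Circuits

/-! ### Elementary single-qubit unitaries -/

def hadamard : Matrix.unitaryGroup (Fin 2) ℂ :=
  ⟨((1 / Real.sqrt 2 : ℝ) : ℂ) • !![1, 1; 1, -1], by
    have h : ((Real.sqrt 2 : ℝ) : ℂ)⁻¹ * ((Real.sqrt 2 : ℝ) : ℂ)⁻¹ = 1 / 2 := by
      rw [← mul_inv, ← Complex.ofReal_mul, Real.mul_self_sqrt (by norm_num)]; norm_num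
    rw [Matrix.mem_unitaryGroup_iff]
    ext i j
    fin_cases i <;> fin_cases j <;>
      simp [Matrix.mul_apply, Fin.sum_univ_two, Matrix.star_apply, h] <;> norm_num⟩

def pauliX : Matrix.unitaryGroup (Fin 2) ℂ :=
  ⟨!![0, 1; 1, 0], by
    rw [Matrix.mem_unitaryGroup_iff]
    ext i j
    fin_cases i <;> fin_cases j <;>
      simp [Matrix.mul_apply, Fin.sum_univ_two, Matrix.star_apply]⟩

/-- The phase gate `diag(1, exp(i t))`; `t = π` gives the Pauli `Z` gate. -/
def phaseGate (t : ℝ) : Matrix.unitaryGroup (Fin 2) ℂ :=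
  ⟨!![1, 0; 0, Complex.exp (t * Complex.I)], by
    have h : Complex.exp (t * Complex.I) * (starRingEnd ℂ) (Complex.exp (t * Complex.I)) = 1 := by
      rw [← Complex.exp_conj, ← Complex.exp_add]; simp
    rw [Matrix.mem_unitaryGroup_iff]
    ext i j
    fin_cases i <;> fin_cases j <;>
      simp [Matrix.mul_apply, Fin.sum_univ_two, Matrix.star_apply, h]⟩

/-- The rotation `R_y(t) = exp(-i t σ_y / 2)`. -/
def rotationY (t : ℝ) : Matrix.unitaryGroup (Fin 2) ℂ :=
  ⟨!![(Real.cos (t / 2) : ℂ), -(Real.sin (t / 2) : ℂ);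
      (Real.sin (t / 2) : ℂ), (Real.cos (t / 2) : ℂ)], by
    have h : ((Real.cos (t / 2) : ℝ) : ℂ) * ((Real.cos (t / 2) : ℝ) : ℂ) +
        ((Real.sin (t / 2) : ℝ) : ℂ) * ((Real.sin (t / 2) : ℝ) : ℂ) = 1 := by
      have := Real.cos_sq_add_sin_sq (t / 2)
      rw [← Complex.ofReal_mul, ← Complex.ofReal_mul, ← Complex.ofReal_add]
      norm_cast
      nlinarith
    rw [Matrix.mem_unitaryGroup_iff]
    ext i j
    fin_cases i <;> fin_cases j <;>
      simp only [Matrix.mul_apply, Fin.sum_univ_two, Matrix.star_apply] <;>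
      simp [-Complex.ofReal_cos, -Complex.ofReal_sin, -Complex.ofReal_div] <;>
      first
        | linear_combination h
        | ring⟩

/-! ### The phase estimation circuit -/

/-- The qubits: the phase register, the first register of the block-encoding (a flag and `k` qubits
for a neighbour), its second register (one ancilla and the `k` qubits of the state register), and the
qubit in which the angle oracle writes. -/
inductive Wire (k m : ℕ) : Type where
  | phase (i : Fin m)
  | flag
  | neighbour (i : Fin k)
  | ancilla
  | state (i : Fin k)
  | angle
  deriving DecidableEq, Fintype

namespace Wire

variable {k m : ℕ}

/-- The `k + 2` ancilla qubits of the block-encoding. -/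
def isAncilla : Wire k m → Bool
  | flag => true
  | neighbour _ => true
  | ancilla => true
  | _ => false

/-- The qubits on which the position oracle acts. -/
def positionWires : Fin k ⊕ Fin k ↪ Wire k m where
  toFun := Sum.elim state neighbour
  inj' := by rintro (i | i) (j | j) h <;> simp_all

/-- The qubits on which the angle oracle acts. -/
def angleWires : (Fin k ⊕ Fin k) ⊕ Unit ↪ Wire k m where
  toFun := Sum.elim positionWires (fun _ => angle)
  inj' := by rintro ((i | i) | i) ((j | j) | j) h <;>
    simp_all [positionWires, DFunLike.coe]

end Wire

section QPECircuit

open Wire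

variable {k m : ℕ}

/-- `U_T`: prepares `3^{-1/2} ∑_v (√A_uv |0⟩ + √(1 - A_uv) |1⟩) |v⟩` in the first register, where
`u` is the content of the state register. -/
def stateTransformation : List (Gate (Wire k m) k) :=
  [.position false positionWires, .angle false angleWires,
    .ctrl {angle} ∅ flag (rotationY Real.pi), .angle true angleWires]

/-- The inverse of `U_T`. -/
def stateTransformationInv : List (Gate (Wire k m) k) :=
  [.angle false angleWires, .ctrl {angle} ∅ flag (rotationY (-Real.pi)),
    .angle true angleWires, .position true positionWires]

/-- The swap of the qubits `x` and `y`, controlled by the qubits in `c`. -/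
def swapGates (c : Finset (Wire k m)) (x y : Wire k m) : List (Gate (Wire k m) k) :=
  [.ctrl (insert x c) ∅ y pauliX, .ctrl (insert y c) ∅ x pauliX, .ctrl (insert x c) ∅ y pauliX]

/-- The walk operator controlled by the phase qubit `q`: the controlled reflection about the zero
state of the ancillas, followed by `U_T`, the controlled swap of the two registers, and the inverse
of `U_T`. -/
def controlledWalk (q : Fin m) : List (Gate (Wire k m) k) :=
  [.ctrl ∅ (Finset.univ.filter fun w => w.isAncilla) (phase q) (phaseGate Real.pi),
    .ctrl ∅ ∅ (phase q) (phaseGate Real.pi)] ++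
  stateTransformation ++
  (List.finRange k).flatMap (fun i => swapGates {phase q} (neighbour i) (state i)) ++
  swapGates {phase q} flag ancilla ++
  stateTransformationInv

/-- The inverse quantum Fourier transform on the phase register (the phase qubit `i` has the weight
`2 ^ i`). -/
def inverseQFTCircuit : List (Gate (Wire k m) k) :=
  ((List.finRange m).filter (fun i => i < i.rev)).flatMap
    (fun i => swapGates ∅ (phase i) (phase i.rev)) ++
  (List.finRange m).flatMap (fun i =>
    ((List.finRange m).filter (fun j => j < i)).map
      (fun j => .ctrl {phase j} ∅ (phase i) (phaseGate (-(Real.pi / 2 ^ ((i : ℕ) - (j : ℕ)))))) ++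
    [.ctrl ∅ ∅ (phase i) hadamard])

/-- The phase estimation circuit, for the start vertex `u`; it starts in the zero state. -/
def qpeCircuit (k m : ℕ) (u : Bits k) : List (Gate (Wire k m) k) :=
  (List.finRange m).map (fun i => .ctrl ∅ ∅ (phase i) hadamard) ++
  ((List.finRange k).filter (fun i => u i = 1)).map (fun i => .ctrl ∅ ∅ (state i) pauliX) ++
  (List.finRange m).flatMap (fun i : Fin m =>
    (List.replicate (2 ^ (i : ℕ)) (controlledWalk i)).flatten) ++
  inverseQFTCircuit

end QPECircuit

/-! ### The algorithm for the glued-trees problem -/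

section Algorithm

variable {n : ℕ} {G : GluedTrees n} (O : MatrixOracles G) (m : ℕ)

/-- The state at the end of the phase estimation circuit started at the ENTRANCE. -/
def finalState : (Wire (n + 1) m → Fin 2) → ℂ :=
  runCircuit O (qpeCircuit (n + 1) m G.entrance) (ket 0)

/-- What one run returns when the measurement in the computational basis gives `x`: nothing if the
post-selection of the ancillas fails, and otherwise the content of the state register. -/
def runOutput {k m : ℕ} (x : Wire k m → Fin 2) : Option (Bits k) :=
  if ∀ w : Wire k m, w.isAncilla → x w = 0 then some (fun i => x (.state i)) else none

/-- The probability that one run returns the vertex `v`. -/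
def runProb (v : Bits (n + 1)) : ℝ :=
  ∑ x, if runOutput x = some v then ‖finalState O m x‖ ^ 2 else 0

/-- The answer found in the measurement results `ω` of `R` runs: the first vertex returned that is
not the ENTRANCE and for which the degree function gives `2`. -/
def answer (G : GluedTrees n) {m R : ℕ} (ω : Fin R → Wire (n + 1) m → Fin 2) :
    Option (Bits (n + 1)) :=
  (List.ofFn ω).findSome? fun x =>
    (runOutput x).filter fun v => G.deg v = 2 ∧ v ≠ G.entrance

/-- The probability that the answer after `R` independent runs is the EXIT. -/
def successProb (R : ℕ) : ℝ :=
  ∑ ω : Fin R → Wire (n + 1) m → Fin 2,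
    if answer G ω = some G.exit then ∏ i, ‖finalState O m (ω i)‖ ^ 2 else 0

/-- The time of `R` runs with the start vertex `u`: each consists of the circuit, the measurement of
all qubits and one query of the degree function. -/
def totalTime (k m : ℕ) (u : Bits k) (R : ℕ) : ℕ :=
  R * (circuitTime (qpeCircuit k m u) + Fintype.card (Wire k m) + 1)

end Algorithm

end

noncomputable section

/-! ### Chebyshev values -/

/-! The phase register is measured without regard to its value, so by Parseval the inverse Fourier
transform drops out. The probability of the EXIT is the average over z < M = 2^m of |⟨0,EXIT| V^z
|0,ENTRANCE⟩|². Since V is a product of two reflections, qubitization gives ⟨0|V^z|0⟩ = T_z(A/3),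
with T_z the Chebyshev polynomial of the first kind (`functional_pow_walk`). Only the column
subspace matters. There A is the same tridiagonal matrix for every gluing, with entries √2 and a
single 2 in the middle (`GluedTrees.sum_neighbours_colNorm`), so everything is expressed by `colAmp`
and `walkAverage`.

This matrix is diagonalized explicitly. Its eigenvalues are ±2√2 x_k, where the x_k are the n
solutions of U_n(x) = √2 U_{n-1}(x). One of them is the edge root k = 0, which may leave the band
[-1, 1]. The others are cosines of angles (kπ + d)/n with 0 < d ≤ π/4. The eigenvectors are mirrored
sequences U_c(x_k), up to an alternating sign that exchanges x and -x. With p_k = `rootWeight` the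
squared overlap with the ENTRANCE, and y_k = 2√2 x_k / 3, the amplitude at time z is Σ_k p_k
(T_z(y_k) - T_z(-y_k)).

Squaring and summing over z < M leaves a diagonal part Σ_k p_k² `modeNorm` and cross terms. For k ≥
1 the norm is M up to a constant, and Σ_k p_k = 1/2 forces Σ_k p_k² ≥ 1/(4n). This is the source of
the order 1/n. A Christoffel–Darboux formula bounds each cross term by a constant over the distance
of the two eigenvalues, independently of M (`abs_modeCorrelation_le`). For most pairs these
distances grow quadratically in the index difference, so the reciprocals are summable. The dangerous
pairs are x_k and -x_l with k + l = n, whose distance is of order sin²φ_k / n, hence only n⁻³ at the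
ends of the band. There the weight p_k ≤ 3 sin²φ_k / (2n) carries the same factor sin²φ_k and
cancels it (`weight_div_gap_le`). Altogether the cross terms are O(n), while the same pairs show
that the gap is O(n⁻³), so M ≥ n³/100 and the error in the average is O(n⁻²)
(`exists_walkAverage_bounds`). The matching lower bound n⁻³/5 for the gap gives 2^m₀ = O(n³).

For the oracle circuit it suffices to verify the algebraic hypotheses of qubitization on the start
states (`encodingLin_add_reflLin`). The angle qubit and the behaviour of the oracles on unspecified
inputs never matter. The inverse Fourier circuit acts on phase qubits only, so it cannot change the
output distribution. Finally, repetition needs a lower bound c/n for all n ≥ 2. It comes from the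
asymptotic bound for large n, and from a light-cone argument, which shows positivity, for the
finitely many others (`exists_le_walkAverage`). -/

/-- The value at `x` of the Chebyshev polynomial of the second kind of degree `j`. -/
def chebU (x : ℝ) : ℕ → ℝ
  | 0 => 1
  | 1 => 2 * x
  | j + 2 => 2 * x * chebU x (j + 1) - chebU x j

theorem chebU_succ_succ (x : ℝ) (j : ℕ) :
    chebU x (j + 2) = 2 * x * chebU x (j + 1) - chebU x j := rfl

theorem chebU_cos_mul_sin (φ : ℝ) (j : ℕ) :
    chebU (Real.cos φ) j * Real.sin φ = Real.sin ((j + 1) * φ) := by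
  induction j using Nat.twoStepInduction with
  | zero => simp [chebU]
  | one =>
    have : ((1 : ℕ) + 1 : ℝ) * φ = 2 * φ := by norm_num
    rw [this, Real.sin_two_mul]; simp [chebU]; ring
  | more j h1 h2 =>
    rw [chebU_succ_succ]
    have e1 : ((j + 2 : ℕ) + 1 : ℝ) * φ = ((j + 1 : ℕ) + 1 : ℝ) * φ + φ := by push_cast; ring
    have e2 : ((j : ℕ) + 1 : ℝ) * φ = ((j + 1 : ℕ) + 1 : ℝ) * φ - φ := by push_cast; ring
    rw [e2, Real.sin_sub] at h1
    rw [e1, Real.sin_add]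
    linear_combination 2 * Real.cos φ * h2 - h1

theorem continuous_chebU (j : ℕ) : Continuous fun x => chebU x j := by
  induction j using Nat.twoStepInduction with
  | zero => simpa [chebU] using continuous_const
  | one => simp only [chebU]; fun_prop
  | more j h1 h2 => simp only [chebU_succ_succ]; fun_prop

/-- Serves the edge root when it lies outside the band, where no trigonometric parametrization is
available. -/
theorem one_le_chebU_of_one_le {x : ℝ} (hx : 1 ≤ x) (j : ℕ) :
    1 ≤ chebU x j ∧ chebU x j ≤ chebU x (j + 1) := by
  induction j with
  | zero => simp [chebU]; linarith
  | succ j ih =>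
    refine ⟨ih.1.trans ih.2, ?_⟩
    rw [chebU_succ_succ]
    nlinarith [ih.1, ih.2]

/-- The quantity `cos (z arccos y)`: for `|y| ≤ 1`, the value at `y` of the Chebyshev polynomial of
the first kind of degree `z`. -/
def chebT (z : ℕ) (y : ℝ) : ℝ := Real.cos (z * Real.arccos y)

theorem chebT_zero (y : ℝ) : chebT 0 y = 1 := by simp [chebT]

theorem chebT_one {y : ℝ} (hy : |y| ≤ 1) : chebT 1 y = y := by
  simp [chebT, Real.cos_arccos (abs_le.1 hy).1 (abs_le.1 hy).2]

theorem chebT_succ_succ {y : ℝ} (hy : |y| ≤ 1) (z : ℕ) :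
    chebT (z + 2) y = 2 * y * chebT (z + 1) y - chebT z y := by
  have hc := Real.cos_arccos (abs_le.1 hy).1 (abs_le.1 hy).2
  unfold chebT
  have e1 : ((z + 2 : ℕ) : ℝ) * Real.arccos y = (z + 1 : ℕ) * Real.arccos y + Real.arccos y := by
    push_cast; ring
  have e2 : (z : ℝ) * Real.arccos y = (z + 1 : ℕ) * Real.arccos y - Real.arccos y := by
    push_cast; ring
  rw [e1, e2, Real.cos_add, Real.cos_sub, hc]; ring

theorem abs_chebT_le (z : ℕ) (y : ℝ) : |chebT z y| ≤ 1 := Real.abs_cos_le_one _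

/-- A Christoffel–Darboux bound. -/
theorem abs_sum_chebT_mul_le {a b : ℝ} (ha : |a| ≤ 1) (hb : |b| ≤ 1) (hab : a ≠ b) (M : ℕ) :
    |∑ z ∈ Finset.range M, chebT z a * chebT z b| ≤ 2 / |a - b| := by
  -- The Christoffel–Darboux identity. The extra `a - b` appears because the term z = 0 is counted
  -- fully, whereas the clean formula gives it weight one half.
  have key : ∀ M : ℕ, 2 * (a - b) * ∑ z ∈ Finset.range (M + 1), chebT z a * chebT z b =
      chebT (M + 1) a * chebT M b - chebT M a * chebT (M + 1) b + (a - b) := by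
    intro M
    induction M with
    | zero => simp [chebT_zero, chebT_one ha, chebT_one hb]; ring
    | succ M ih =>
      rw [Finset.sum_range_succ, mul_add, ih, chebT_succ_succ ha, chebT_succ_succ hb]; ring
  have hpos : 0 < |a - b| := abs_pos.2 (sub_ne_zero.2 hab)
  rcases M with _ | M
  · simpa using div_nonneg zero_le_two hpos.le
  rw [le_div_iff₀ hpos]
  have h1 : |2 * (a - b) * ∑ z ∈ Finset.range (M + 1), chebT z a * chebT z b| ≤ 4 := by
    rw [key]
    have h2 : |a - b| ≤ 2 := by
      have := abs_sub a b; linarith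
    have h3 : ∀ z w, |chebT z a * chebT w b| ≤ 1 := fun z w => by
      rw [abs_mul]; exact mul_le_one₀ (abs_chebT_le _ _) (abs_nonneg _) (abs_chebT_le _ _)
    have := abs_le.1 (h3 (M + 1) M)
    have := abs_le.1 (h3 M (M + 1))
    have := abs_le.1 h2
    rw [abs_le]; constructor <;> linarith
  rw [abs_mul, abs_mul, abs_of_pos (two_pos : (0 : ℝ) < 2)] at h1
  linarith

theorem sum_chebT_sq_ge {y : ℝ} (hy : y ^ 2 ≤ 8 / 9) (M : ℕ) :
    ((M : ℝ) - 1) / 2 ≤ ∑ z ∈ Finset.range M, chebT z y ^ 2 := by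
  set θ := Real.arccos y with hθ
  -- The value 1/3 is exactly what is needed below: the oscillating boundary term costs at most 1,
  -- to be paid by 3 sin θ.
  have hs : 1 / 3 ≤ Real.sin θ := by
    rw [hθ, Real.sin_arccos]
    apply Real.le_sqrt_of_sq_le; linarith
  have key : ∀ M : ℕ, 4 * Real.sin θ * ∑ z ∈ Finset.range M, chebT z y ^ 2 =
      2 * M * Real.sin θ + Real.sin ((2 * M - 1) * θ) + Real.sin θ := by
    intro M
    induction M with
    | zero => simp
    | succ M ih =>
      have e1 : (2 * ((M + 1 : ℕ) : ℝ) - 1) * θ = 2 * (M * θ) + θ := by push_cast; ring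
      have e2 : (2 * (M : ℝ) - 1) * θ = 2 * (M * θ) - θ := by ring
      rw [Finset.sum_range_succ, mul_add, ih, e1, e2, Real.sin_add, Real.sin_sub, Real.cos_two_mul,
        chebT]
      push_cast; ring
  have h1 := key M
  have h2 := Real.neg_one_le_sin ((2 * M - 1) * θ)
  have h3 : 4 * Real.sin θ * (((M : ℝ) - 1) / 2) ≤
      4 * Real.sin θ * ∑ z ∈ Finset.range M, chebT z y ^ 2 := by
    rw [h1]; nlinarith
  exact le_of_mul_le_mul_left h3 (by linarith)

/-! ### Elementary trigonometric bounds -/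

/-- In the product formula for a difference of cosines, the sine of the mean angle is at least the
sine of half the difference, and Jordan's inequality bounds the latter. A quadratic bound is the
best uniform one, since the cosine is flat at the ends of the band. -/
theorem two_mul_sq_le_cos_sub_cos {α β : ℝ} (h0 : 0 ≤ α) (h : α ≤ β) (hβ : β ≤ Real.pi) :
    2 * ((β - α) / Real.pi) ^ 2 ≤ Real.cos α - Real.cos β := by
  have hpi := Real.pi_pos
  rw [Real.cos_sub_cos]
  have e : Real.sin ((α - β) / 2) = - Real.sin ((β - α) / 2) := by
    rw [← Real.sin_neg]; congr 1; ring
  rw [e]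
  have h1 : (β - α) / Real.pi ≤ Real.sin ((β - α) / 2) := by
    have := Real.mul_le_sin (x := (β - α) / 2) (by linarith) (by linarith)
    calc (β - α) / Real.pi = 2 / Real.pi * ((β - α) / 2) := by ring
      _ ≤ _ := this
  have h2 : Real.sin ((β - α) / 2) ≤ Real.sin ((α + β) / 2) := by
    by_cases hc : (α + β) / 2 ≤ Real.pi / 2
    · exact Real.sin_le_sin_of_le_of_le_pi_div_two (by linarith) hc (by linarith)
    · rw [← Real.sin_pi_sub ((α + β) / 2)]
      exact Real.sin_le_sin_of_le_of_le_pi_div_two (by linarith) (by linarith) (by linarith)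
  have h3 : 0 ≤ (β - α) / Real.pi := div_nonneg (by linarith) hpi.le
  nlinarith

theorem sin_add_cos_le (φ : ℝ) : Real.sin φ + Real.cos φ ≤ √2 := by
  apply Real.le_sqrt_of_sq_le
  nlinarith [Real.sin_sq_add_cos_sq φ, sq_nonneg (Real.sin φ - Real.cos φ)]

/-! ### The roots of the characteristic equation -/

/-- With x = cos φ and φ = (kπ + d)/n, the equation U_n = √2 U_{n-1} multiplied by sin φ reads sin(d
+ φ) = √2 sin d. The intermediate value theorem on [0, π/4] applies: at π/4 the sign is that of √2 -
(sin φ + cos φ). -/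
theorem exists_phaseShift {n k : ℕ} (hk : 1 ≤ k) (hkn : k < n) :
    ∃ d : ℝ, 0 < d ∧ d ≤ Real.pi / 4 ∧
      Real.sin d * (√2 - Real.cos ((k * Real.pi + d) / n)) =
        Real.cos d * Real.sin ((k * Real.pi + d) / n) := by
  have hpi := Real.pi_pos
  have hn0 : (0 : ℝ) < n := by exact_mod_cast (by omega : 0 < n)
  have hk' : (1 : ℝ) ≤ k := by exact_mod_cast hk
  have hkn' : (k : ℝ) < n := by exact_mod_cast hkn
  set h : ℝ → ℝ := fun d => Real.sin d * (√2 - Real.cos ((k * Real.pi + d) / n)) -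
    Real.cos d * Real.sin ((k * Real.pi + d) / n) with hh
  have hc : ContinuousOn h (Set.Icc 0 (Real.pi / 4)) := by
    apply Continuous.continuousOn
    simp only [hh]; fun_prop
  have h0 : h 0 < 0 := by
    simp only [hh, Real.sin_zero, Real.cos_zero, add_zero]
    have : 0 < Real.sin (k * Real.pi / n) := by
      apply Real.sin_pos_of_pos_of_lt_pi (by positivity)
      rw [div_lt_iff₀ hn0]; nlinarith
    linarith
  have h1 : 0 ≤ h (Real.pi / 4) := by
    simp only [hh, Real.sin_pi_div_four, Real.cos_pi_div_four]
    have := sin_add_cos_le ((k * Real.pi + Real.pi / 4) / n)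
    have h2 : 0 < √2 := by positivity
    nlinarith
  obtain ⟨d, hd, hd0⟩ := intermediate_value_Icc (by positivity) hc ⟨h0.le, h1⟩
  refine ⟨d, lt_of_le_of_ne hd.1 ?_, hd.2, by simp only [hh] at hd0; linarith⟩
  rintro rfl
  exact h0.ne hd0

/-- The remaining solution lies between cos(π/(2n)) and 3/(2√2). The upper end corresponds to the
eigenvalue 3 of the adjacency matrix, its maximal degree. -/
theorem exists_edgeRoot {n : ℕ} (hn : 1 ≤ n) :
    ∃ x : ℝ, Real.cos (Real.pi / (2 * n)) < x ∧ x < 3 / (2 * √2) ∧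
      chebU x n = √2 * chebU x (n - 1) := by
  obtain ⟨n, rfl⟩ : ∃ k, n = k + 1 := ⟨n - 1, by omega⟩
  simp only [Nat.add_sub_cancel]
  have hpi := Real.pi_pos
  have hs2 : √2 * √2 = 2 := Real.mul_self_sqrt (by norm_num)
  have hs0 : 0 < √2 := by positivity
  have hx1 : 2 * (3 / (2 * √2)) = √2 + 1 / √2 := by
    field_simp; nlinarith
  have hone : 1 < 3 / (2 * √2) := by
    rw [lt_div_iff₀ (by positivity)]; nlinarith
  -- At this x the characteristic roots of the recursion are √2 and 1/√2, because 2x is their sum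
  -- and 1 their product. Subtracting √2 times the previous term isolates the decaying mode.
  have hup : ∀ j, chebU (3 / (2 * √2)) (j + 1) - √2 * chebU (3 / (2 * √2)) j =
      (1 / √2) ^ (j + 1) := by
    intro j
    induction j with
    | zero => simp only [chebU, hx1]; ring
    | succ j ih =>
      rw [chebU_succ_succ, hx1, pow_succ, ← ih]
      have : 1 / √2 * √2 = 1 := by field_simp
      linear_combination chebU (3 / (2 * √2)) j * this
  set F : ℝ → ℝ := fun x => chebU x (n + 1) - √2 * chebU x n with hF
  have hFc : Continuous F := by
    have := continuous_chebU (n + 1)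
    have := continuous_chebU n
    simp only [hF]; fun_prop
  set φ := Real.pi / (2 * ((n + 1 : ℕ) : ℝ)) with hφ
  have hφ0 : 0 < φ := by positivity
  have hφn : ((n : ℝ) + 1) * φ = Real.pi / 2 := by rw [hφ]; push_cast; field_simp
  have hφ2 : φ ≤ Real.pi / 2 := by nlinarith
  have hsin : 0 < Real.sin φ := Real.sin_pos_of_pos_of_lt_pi hφ0 (by linarith)
  have hcos1 : Real.cos φ ≤ 1 := Real.cos_le_one _
  have hlo : F (Real.cos φ) < 0 := by
    have h1 := chebU_cos_mul_sin φ (n + 1)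
    have h2 := chebU_cos_mul_sin φ n
    rw [hφn, Real.sin_pi_div_two] at h2
    have e : ((n + 1 : ℕ) + 1 : ℝ) * φ = φ + Real.pi / 2 := by rw [← hφn]; push_cast; ring
    rw [e, Real.sin_add_pi_div_two] at h1
    have : F (Real.cos φ) * Real.sin φ < 0 := by
      simp only [hF, sub_mul, mul_assoc, h1, h2]
      nlinarith
    by_contra hcon
    push Not at hcon
    nlinarith
  have hhi : 0 < F (3 / (2 * √2)) := by
    simp only [hF, hup]; positivity
  obtain ⟨x, hx, hx0⟩ := intermediate_value_Ioo (by linarith) hFc.continuousOn ⟨hlo, hhi⟩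
  exact ⟨x, hx.1, hx.2, by simp only [hF] at hx0; linarith⟩

open Classical in
/-- The shift `d` for which `cos ((k π + d) / n)` is the `k`-th root, for `1 ≤ k < n`. -/
def phaseShift (n k : ℕ) : ℝ :=
  if h : 1 ≤ k ∧ k < n then (exists_phaseShift h.1 h.2).choose else 0

/-- The angle of the `k`-th root, for `1 ≤ k < n`. -/
def rootAngle (n k : ℕ) : ℝ := (k * Real.pi + phaseShift n k) / n

open Classical in
/-- The `n` solutions of `U_n(x) = √2 U_{n-1}(x)`, in decreasing order. -/
def root (n k : ℕ) : ℝ :=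
  if k = 0 then if h : 1 ≤ n then (exists_edgeRoot h).choose else 0 else Real.cos (rootAngle n k)

section Roots

variable {n k l : ℕ}

theorem phaseShift_spec (hk : 1 ≤ k) (hkn : k < n) :
    0 < phaseShift n k ∧ phaseShift n k ≤ Real.pi / 4 ∧
      Real.sin (phaseShift n k) * (√2 - Real.cos (rootAngle n k)) =
        Real.cos (phaseShift n k) * Real.sin (rootAngle n k) := by
  have h := (exists_phaseShift hk hkn).choose_spec
  unfold rootAngle
  rw [phaseShift, dif_pos ⟨hk, hkn⟩]
  exact h

theorem edgeRoot_spec (hn : 1 ≤ n) :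
    Real.cos (Real.pi / (2 * n)) < root n 0 ∧ root n 0 < 3 / (2 * √2) ∧
      chebU (root n 0) n = √2 * chebU (root n 0) (n - 1) := by
  have h := (exists_edgeRoot hn).choose_spec
  rw [root, if_pos rfl, dif_pos hn]
  exact h

theorem root_eq_cos (hk : 1 ≤ k) : root n k = Real.cos (rootAngle n k) := by
  rw [root, if_neg (by omega)]

theorem rootAngle_gt (hk : 1 ≤ k) (hkn : k < n) : k * Real.pi / n < rootAngle n k := by
  have hn0 : (0 : ℝ) < n := by exact_mod_cast (by omega : 0 < n)
  unfold rootAngle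
  have := (phaseShift_spec hk hkn).1
  gcongr; linarith

theorem rootAngle_le (hk : 1 ≤ k) (hkn : k < n) :
    rootAngle n k ≤ (k + 1 / 4) * Real.pi / n := by
  have hn0 : (0 : ℝ) < n := by exact_mod_cast (by omega : 0 < n)
  unfold rootAngle
  have := (phaseShift_spec hk hkn).2.1
  gcongr; linarith

theorem rootAngle_pos (hk : 1 ≤ k) (hkn : k < n) : 0 < rootAngle n k :=
  lt_of_le_of_lt (by positivity) (rootAngle_gt hk hkn)

theorem rootAngle_le_pi_sub (hk : 1 ≤ k) (hkn : k < n) :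
    rootAngle n k ≤ Real.pi - 3 / 4 * Real.pi / n := by
  have hn0 : (0 : ℝ) < n := by exact_mod_cast (by omega : 0 < n)
  refine (rootAngle_le hk hkn).trans ?_
  have h : (k : ℝ) + 1 ≤ n := by exact_mod_cast hkn
  rw [le_sub_iff_add_le, ← add_div, div_le_iff₀ hn0]
  nlinarith [Real.pi_pos]

theorem rootAngle_lt_pi (hk : 1 ≤ k) (hkn : k < n) : rootAngle n k < Real.pi := by
  have hn0 : (0 : ℝ) < n := by exact_mod_cast (by omega : 0 < n)
  have := rootAngle_le_pi_sub hk hkn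
  have : 0 < 3 / 4 * Real.pi / n := by positivity
  linarith

theorem sin_rootAngle_ge (hk : 1 ≤ k) (hkn : k < n) : 3 / (2 * n) ≤ Real.sin (rootAngle n k) := by
  have hn0 : (0 : ℝ) < n := by exact_mod_cast (by omega : 0 < n)
  have hpi := Real.pi_pos
  have h1 : 3 / 4 * Real.pi / n ≤ rootAngle n k := by
    refine le_trans ?_ (rootAngle_gt hk hkn).le
    have : (1 : ℝ) ≤ k := by exact_mod_cast hk
    gcongr; nlinarith
  have h2 := rootAngle_le_pi_sub hk hkn
  have e : (3 : ℝ) / (2 * n) = 2 / Real.pi * (3 / 4 * Real.pi / n) := by field_simp; norm_num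
  rw [e]
  by_cases hc : rootAngle n k ≤ Real.pi / 2
  · refine le_trans ?_ (Real.mul_le_sin (by linarith [rootAngle_pos hk hkn]) hc)
    gcongr
  · rw [← Real.sin_pi_sub]
    push Not at hc
    refine le_trans ?_ (Real.mul_le_sin (by linarith [rootAngle_lt_pi hk hkn]) (by linarith))
    gcongr; linarith

theorem sin_rootAngle_pos (hk : 1 ≤ k) (hkn : k < n) : 0 < Real.sin (rootAngle n k) :=
  Real.sin_pos_of_pos_of_lt_pi (rootAngle_pos hk hkn) (rootAngle_lt_pi hk hkn)

theorem chebU_root (hkn : k < n) :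
    chebU (root n k) n = √2 * chebU (root n k) (n - 1) := by
  rcases Nat.eq_zero_or_pos k with rfl | hk
  · exact (edgeRoot_spec hkn).2.2
  have hn0 : (n : ℝ) ≠ 0 := by exact_mod_cast (by omega : n ≠ 0)
  have hs := sin_rootAngle_pos hk hkn
  rw [root_eq_cos hk]
  apply mul_right_cancel₀ hs.ne'
  have h2 := chebU_cos_mul_sin (rootAngle n k) (n - 1)
  rw [mul_assoc, h2, chebU_cos_mul_sin]
  have e1 : ((n - 1 : ℕ) + 1 : ℝ) * rootAngle n k = phaseShift n k + k * Real.pi := by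
    rw [Nat.cast_sub (by omega)]; unfold rootAngle; field_simp; push_cast; ring
  have e2 : ((n : ℝ) + 1) * rootAngle n k =
      (phaseShift n k + rootAngle n k) + k * Real.pi := by
    rw [add_mul, one_mul]
    have : (n : ℝ) * rootAngle n k = phaseShift n k + k * Real.pi := by
      unfold rootAngle; field_simp; ring
    rw [this]; ring
  rw [e1, e2, Real.sin_add_nat_mul_pi, Real.sin_add_nat_mul_pi, Real.sin_add]
  linear_combination (-(-1) ^ k) * (phaseShift_spec hk hkn).2.2

theorem sqrt_two_bounds : 1.414 < √2 ∧ √2 < 1.415 := by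
  constructor
  · apply Real.lt_sqrt_of_sq_lt; norm_num
  · rw [Real.sqrt_lt' (by norm_num)]; norm_num

/-- Puts the spectrum of A/3 into [-1, 1], where `chebT` satisfies the Chebyshev recursion. For the
edge root this is the bound 3/(2√2). -/
theorem abs_mul_root_le (hkn : k < n) : |2 * √2 / 3 * root n k| ≤ 1 := by
  have hs2 := sqrt_two_bounds
  rcases Nat.eq_zero_or_pos k with rfl | hk
  · obtain ⟨h1, h2, -⟩ := edgeRoot_spec hkn
    have h3 : 0 ≤ Real.cos (Real.pi / (2 * n)) := by
      have hn1 : (1 : ℝ) ≤ n := by exact_mod_cast hkn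
      apply Real.cos_nonneg_of_neg_pi_div_two_le_of_le
      · have : 0 ≤ Real.pi / (2 * n) := by positivity
        linarith [Real.pi_pos]
      · gcongr; linarith
    rw [lt_div_iff₀ (by positivity)] at h2
    rw [abs_of_nonneg (mul_nonneg (by positivity) (by linarith))]
    linarith
  · rw [root_eq_cos hk, abs_mul, abs_of_pos (by positivity)]
    have := Real.abs_cos_le_one (rootAngle n k)
    nlinarith

/-- Roots with k ≥ 1 are cosines, and (2√2/3)² = 8/9. The edge root may exceed 1, which is why it
gets no lower bound on its time average. -/
theorem mul_root_sq_le (hk : 1 ≤ k) : (2 * √2 / 3 * root n k) ^ 2 ≤ 8 / 9 := by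
  have hs2 : √2 ^ 2 = 2 := Real.sq_sqrt (by norm_num)
  rw [root_eq_cos hk]
  have : (2 * √2 / 3 * Real.cos (rootAngle n k)) ^ 2 = 8 / 9 * Real.cos (rootAngle n k) ^ 2 := by
    linear_combination (4 / 9 * Real.cos (rootAngle n k) ^ 2) * hs2
  rw [this]
  nlinarith [Real.sin_sq_add_cos_sq (rootAngle n k), sq_nonneg (Real.sin (rootAngle n k))]

/-! ### Separation of the roots -/

/-- In units of π/n, the angle exceeds k by at most 1/4 (the phase shift is at most π/4), or by 1/2
for the edge root, read as a cosine lower bound since that root may have no real angle. -/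
theorem le_root (hn : 2 ≤ n) (hkn : k < n) :
    Real.cos ((k + if k = 0 then 1 / 2 else 1 / 4) * Real.pi / n) ≤ root n k := by
  rcases Nat.eq_zero_or_pos k with rfl | hk
  · refine le_trans (le_of_eq ?_) (edgeRoot_spec hkn).1.le
    congr 1; simp; ring
  · rw [root_eq_cos hk, if_neg (by omega)]
    have hn0 : (0 : ℝ) < n := by exact_mod_cast (by omega : 0 < n)
    apply Real.cos_le_cos_of_nonneg_of_le_pi (rootAngle_pos hk hkn).le
    · have h : (k : ℝ) + 1 ≤ n := by exact_mod_cast hkn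
      rw [div_le_iff₀ hn0]; nlinarith [Real.pi_pos]
    · exact rootAngle_le hk hkn

theorem root_le (hk : 1 ≤ k) (hkn : k < n) : root n k ≤ Real.cos (k * Real.pi / n) := by
  rw [root_eq_cos hk]
  exact Real.cos_le_cos_of_nonneg_of_le_pi (by positivity) (rootAngle_lt_pi hk hkn).le
    (rootAngle_gt hk hkn).le

theorem root_sub_root_ge (hn : 2 ≤ n) (hkl : k < l) (hln : l < n) :
    ((l : ℝ) - k) ^ 2 / (2 * n ^ 2) ≤ root n k - root n l := by
  have hn0 : (0 : ℝ) < n := by exact_mod_cast (by omega : 0 < n)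
  have hpi := Real.pi_pos
  have hkl' : (k : ℝ) + 1 ≤ l := by exact_mod_cast hkl
  have hln' : (l : ℝ) + 1 ≤ n := by exact_mod_cast hln
  have hk0 : (0 : ℝ) ≤ k := Nat.cast_nonneg k
  have h1 := le_root hn (hkl.trans hln)
  have h2 := root_le (by omega) hln
  set t : ℝ := if k = 0 then 1 / 2 else 1 / 4 with ht
  have ht0 : 0 ≤ t ∧ t ≤ 1 / 2 := by rw [ht]; split_ifs <;> norm_num
  have h3 := two_mul_sq_le_cos_sub_cos (α := (k + t) * Real.pi / n) (β := l * Real.pi / n)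
    (by have := ht0.1; positivity) (by gcongr; linarith)
    (by rw [div_le_iff₀ hn0]; nlinarith)
  have e : (l * Real.pi / n - (k + t) * Real.pi / n) / Real.pi = (l - k - t) / n := by
    field_simp; ring
  rw [e] at h3
  have h4 : ((l : ℝ) - k) ^ 2 / (2 * n ^ 2) ≤ 2 * (((l : ℝ) - k - t) / n) ^ 2 := by
    rw [div_pow, ← mul_div_assoc, div_le_div_iff₀ (by positivity) (by positivity)]
    -- The shift t is at most 1/2 and l - k is at least 1, so at most half of the distance is lost.
    have : ((l : ℝ) - k) / 2 ≤ l - k - t := by linarith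
    have h5 : (((l : ℝ) - k) / 2) ^ 2 ≤ (l - k - t) ^ 2 :=
      pow_le_pow_left₀ (by linarith) this 2
    nlinarith [sq_nonneg (n : ℝ)]
  linarith

theorem root_add_root_ge (hn : 2 ≤ n) (hkl : k + l < n) :
    ((n : ℝ) - k - l) ^ 2 / (8 * n ^ 2) ≤ root n k + root n l := by
  have hn0 : (0 : ℝ) < n := by exact_mod_cast (by omega : 0 < n)
  have hpi := Real.pi_pos
  have hkl' : (k : ℝ) + l + 1 ≤ n := by exact_mod_cast hkl
  have hn' : (2 : ℝ) ≤ n := by exact_mod_cast hn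
  have hk0 : (0 : ℝ) ≤ k := Nat.cast_nonneg k
  have hl0 : (0 : ℝ) ≤ l := Nat.cast_nonneg l
  have h1 := le_root (k := k) hn (by omega)
  have h2 := le_root (k := l) hn (by omega)
  set t : ℝ := if k = 0 then 1 / 2 else 1 / 4 with ht
  set s : ℝ := if l = 0 then 1 / 2 else 1 / 4 with hs
  have ht0 : 0 ≤ t := by rw [ht]; split_ifs <;> norm_num
  have hs0 : 0 ≤ s := by rw [hs]; split_ifs <;> norm_num
  -- Two shifts act against the distance here. With one edge root and n - k - l = 1 the loss is
  -- exactly 3/4, so the factor 1/4 is sharp.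
  have hst : ((n : ℝ) - k - l) / 4 ≤ n - l - s - (k + t) := by
    rw [ht, hs]
    split_ifs with h h' h'
    · subst h h'; push_cast; linarith
    · linarith
    · linarith
    · linarith
  have h3 := two_mul_sq_le_cos_sub_cos (α := (k + t) * Real.pi / n)
    (β := Real.pi - (l + s) * Real.pi / n)
    (by positivity)
    (by rw [le_sub_iff_add_le, ← add_div, div_le_iff₀ hn0]; nlinarith)
    (by have : 0 ≤ (l + s) * Real.pi / n := by positivity
        linarith)
  have e : (Real.pi - (l + s) * Real.pi / n - (k + t) * Real.pi / n) / Real.pi =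
      (n - l - s - (k + t)) / n := by
    field_simp; ring
  rw [e, Real.cos_pi_sub] at h3
  have h4 : ((n : ℝ) - k - l) ^ 2 / (8 * n ^ 2) ≤ 2 * (((n : ℝ) - l - s - (k + t)) / n) ^ 2 := by
    rw [div_pow, ← mul_div_assoc, div_le_div_iff₀ (by positivity) (by positivity)]
    have h5 : (((n : ℝ) - k - l) / 4) ^ 2 ≤ (n - l - s - (k + t)) ^ 2 :=
      pow_le_pow_left₀ (by linarith) hst 2
    nlinarith [sq_nonneg (n : ℝ)]
  linarith

/-- Beyond k + l = n the phase shifts only increase the distance, so the unshifted angles suffice.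
-/
theorem root_add_root_le (hk : k < n) (hl : l < n) (hkl : n < k + l) :
    root n k + root n l ≤ -(((n : ℝ) - k - l) ^ 2 / (8 * n ^ 2)) := by
  have hn0 : (0 : ℝ) < n := by exact_mod_cast (by omega : 0 < n)
  have hpi := Real.pi_pos
  have hkl' : (n : ℝ) + 1 ≤ k + l := by exact_mod_cast hkl
  have hk' : (k : ℝ) + 1 ≤ n := by exact_mod_cast hk
  have hl' : (l : ℝ) + 1 ≤ n := by exact_mod_cast hl
  have h1 := root_le (k := k) (by omega) hk
  have h2 := root_le (k := l) (by omega) hl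
  have h3 := two_mul_sq_le_cos_sub_cos (α := Real.pi - l * Real.pi / n)
    (β := k * Real.pi / n)
    (by rw [sub_nonneg, div_le_iff₀ hn0]; nlinarith)
    (by rw [sub_le_iff_le_add, ← add_div, le_div_iff₀ hn0]; nlinarith)
    (by rw [div_le_iff₀ hn0]; nlinarith)
  have e : (k * Real.pi / n - (Real.pi - l * Real.pi / n)) / Real.pi = (k + l - n) / n := by
    field_simp; ring
  rw [e, Real.cos_pi_sub] at h3
  have h4 : ((n : ℝ) - k - l) ^ 2 / (8 * n ^ 2) ≤ 2 * (((k : ℝ) + l - n) / n) ^ 2 := by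
    rw [div_pow, ← mul_div_assoc, div_le_div_iff₀ (by positivity) (by positivity)]
    have e2 : ((k : ℝ) + l - n) ^ 2 = (n - k - l) ^ 2 := by ring
    rw [e2]
    nlinarith [sq_nonneg (n : ℝ), mul_nonneg (sq_nonneg ((n : ℝ) - k - l)) (sq_nonneg (n : ℝ))]
  linarith

/-! ### Nearly opposite roots -/

/-- Squaring the equation for d and eliminating cos d gives sin²d · (3 - 2√2 cos φ) = sin²φ. The
factor lies between 3 - 2√2 > 1/9 and 3 + 2√2 < 9, so sin d and sin φ are comparable. -/
theorem sin_phaseShift_bounds (hk : 1 ≤ k) (hkn : k < n) :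
    Real.sin (rootAngle n k) / 3 ≤ Real.sin (phaseShift n k) ∧
      Real.sin (phaseShift n k) ≤ 3 * Real.sin (rootAngle n k) := by
  obtain ⟨h0, h1, h2⟩ := phaseShift_spec hk hkn
  have hpi := Real.pi_pos
  have hs := sin_rootAngle_pos hk hkn
  have hd : 0 < Real.sin (phaseShift n k) := Real.sin_pos_of_pos_of_lt_pi h0 (by linarith)
  have hc := Real.abs_cos_le_one (rootAngle n k)
  have hcl := Real.neg_one_le_cos (rootAngle n k)
  have hcu := Real.cos_le_one (rootAngle n k)
  have h3 := Real.sin_sq_add_cos_sq (rootAngle n k)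
  have h4 := Real.sin_sq_add_cos_sq (phaseShift n k)
  have hs2 : √2 ^ 2 = 2 := Real.sq_sqrt (by norm_num)
  have hb := sqrt_two_bounds
  set s := Real.sin (rootAngle n k)
  set c := Real.cos (rootAngle n k)
  set d := Real.sin (phaseShift n k)
  set e := Real.cos (phaseShift n k)
  have key : d ^ 2 * (3 - 2 * √2 * c) = s ^ 2 := by
    have : (d * (√2 - c)) ^ 2 = (e * s) ^ 2 := by rw [h2]
    linear_combination this - d ^ 2 * hs2 - d ^ 2 * h3 + s ^ 2 * h4
  have hc1 : √2 * c ≤ 1.415 := by nlinarith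
  have hc2 : -1.415 ≤ √2 * c := by nlinarith
  have hd2 := sq_nonneg d
  constructor
  · refine abs_le_of_sq_le_sq' ?_ hd.le |>.2
    rw [div_pow, ← key]; nlinarith
  · refine abs_le_of_sq_le_sq' ?_ (by positivity) |>.2
    rw [mul_pow, ← key]; nlinarith

/-- When k + l = n, the angles kπ/n and π - lπ/n coincide. Only the two phase shifts then separate
x_k from -x_l. -/
theorem neg_root_add_root (hk : 1 ≤ k) (hl : 1 ≤ l) (hkl : k + l = n) :
    -(root n k + root n l) =
      2 * Real.sin (rootAngle n k - (phaseShift n k + phaseShift n l) / (2 * n)) *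
        Real.sin ((phaseShift n k + phaseShift n l) / (2 * n)) := by
  have hn0 : (n : ℝ) ≠ 0 := by exact_mod_cast (by omega : n ≠ 0)
  have hkl' : (l : ℝ) = n - k := by rw [← hkl]; push_cast; ring
  have e : Real.cos (rootAngle n l) =
      -Real.cos (rootAngle n k - (phaseShift n k + phaseShift n l) / n) := by
    rw [← Real.cos_pi_sub]; congr 1
    unfold rootAngle; rw [hkl']; field_simp; ring
  rw [root_eq_cos hk, root_eq_cos hl, e, neg_add, neg_neg, neg_add_eq_sub, Real.cos_sub_cos]
  have e1 : (rootAngle n k - (phaseShift n k + phaseShift n l) / n + rootAngle n k) / 2 =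
      rootAngle n k - (phaseShift n k + phaseShift n l) / (2 * n) := by field_simp; ring
  have e2 : (rootAngle n k - (phaseShift n k + phaseShift n l) / n - rootAngle n k) / 2 =
      -((phaseShift n k + phaseShift n l) / (2 * n)) := by field_simp; ring
  rw [e1, e2, Real.sin_neg]; ring

/-- Of the two sines in the product formula, one is at least half of sin φ, and the other is of
order (phase shift)/n, which is comparable to sin φ / n from below. The factor sin²φ is kept, not
replaced by its minimum, because it has to cancel against the weights. -/
theorem neg_root_add_root_ge (hk : 1 ≤ k) (hl : 1 ≤ l) (hkl : k + l = n) :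
    Real.sin (rootAngle n k) ^ 2 / (10 * n) ≤ -(root n k + root n l) := by
  have hpi := Real.pi_pos
  have hpi' := Real.pi_lt_d2
  have hn0 : (0 : ℝ) < n := by exact_mod_cast (by omega : 0 < n)
  have hn2 : (2 : ℝ) ≤ n := by exact_mod_cast (by omega : 2 ≤ n)
  have hkn : k < n := by omega
  obtain ⟨hd0, hd1, -⟩ := phaseShift_spec hk hkn
  obtain ⟨he0, he1, -⟩ := phaseShift_spec hl (by omega : l < n)
  have hφ0 := rootAngle_pos hk hkn
  have hφ1 := rootAngle_lt_pi hk hkn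
  have hφ2 := rootAngle_gt hk hkn
  have hs := sin_rootAngle_pos hk hkn
  rw [neg_root_add_root hk hl hkl]
  set φ := rootAngle n k
  set t := (phaseShift n k + phaseShift n l) / (2 * n) with ht
  have ht0 : 0 < t := by positivity
  have htn : t * (2 * n) = phaseShift n k + phaseShift n l := by rw [ht]; field_simp
  have ht1 : t ≤ φ / 2 := by
    have : t ≤ Real.pi / 2 / (2 * n) := by rw [ht]; gcongr; linarith
    have h2 : Real.pi / 2 / (2 * n) ≤ k * Real.pi / n / 2 := by
      rw [div_div, div_div, div_le_div_iff₀ (by positivity) (by positivity)]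
      have : (1 : ℝ) ≤ k := by exact_mod_cast hk
      nlinarith [mul_pos hn0 hpi]
    linarith
  have h1 : Real.sin φ / 2 ≤ Real.sin (φ - t) := by
    by_cases hc : φ - t ≤ Real.pi / 2
    · have h3 : Real.sin (φ / 2) ≤ Real.sin (φ - t) :=
        Real.sin_le_sin_of_le_of_le_pi_div_two (by linarith) hc (by linarith)
      have h4 : Real.sin φ = 2 * Real.sin (φ / 2) * Real.cos (φ / 2) := by
        rw [← Real.sin_two_mul]; congr 1; ring
      have h5 := Real.cos_le_one (φ / 2)
      have h6 : 0 ≤ Real.sin (φ / 2) := Real.sin_nonneg_of_nonneg_of_le_pi (by linarith) (by linarith)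
      nlinarith
    · push Not at hc
      have : Real.sin φ ≤ Real.sin (φ - t) := by
        rw [← Real.sin_pi_sub φ, ← Real.sin_pi_sub (φ - t)]
        exact Real.sin_le_sin_of_le_of_le_pi_div_two (by linarith) (by linarith) (by linarith)
      linarith
  have h2 : Real.sin φ / (3 * Real.pi * n) ≤ Real.sin t := by
    have h3 := Real.mul_le_sin ht0.le (by linarith)
    have h4 : Real.sin φ / 3 ≤ phaseShift n k :=
      (sin_phaseShift_bounds hk hkn).1.trans (Real.sin_lt hd0).le
    refine le_trans ?_ h3
    rw [div_le_iff₀ (by positivity)]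
    have : 2 / Real.pi * t * (3 * Real.pi * n) = 3 * (t * (2 * n)) := by field_simp
    rw [this, htn]; linarith
  calc Real.sin φ ^ 2 / (10 * n) ≤ 2 * (Real.sin φ / 2) * (Real.sin φ / (3 * Real.pi * n)) := by
        have : 2 * (Real.sin φ / 2) * (Real.sin φ / (3 * Real.pi * n)) =
          Real.sin φ ^ 2 / (3 * Real.pi * n) := by field_simp
        rw [this]; gcongr; linarith
    _ ≤ _ := by
        have : 0 ≤ Real.sin (φ - t) := by linarith
        gcongr

/-- The pair 1, n - 1 lies at the ends of the band. There the angle and the phase shifts are all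
O(1/n), and a further 1/n comes from the formula for the distance. The first bound forces the phase
register to resolve times of order n³. The second makes it long enough for the walk to reach the
EXIT at all. -/
theorem neg_root_add_root_le (hn : 2 ≤ n) :
    -(root n 1 + root n (n - 1)) ≤ 200 / (n : ℝ) ^ 3 ∧
      -(root n 1 + root n (n - 1)) ≤ Real.pi / (2 * n) := by
  have hpi := Real.pi_pos
  have hpi' := Real.pi_lt_d2
  have hn0 : (0 : ℝ) < n := by exact_mod_cast (by omega : 0 < n)
  have h1n : 1 < n := hn
  have hl1 : 1 ≤ n - 1 := by omega
  have hln : n - 1 < n := by omega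
  obtain ⟨hd0, hd1, -⟩ := phaseShift_spec le_rfl h1n
  obtain ⟨he0, he1, -⟩ := phaseShift_spec hl1 hln
  have hφ0 := rootAngle_pos le_rfl h1n
  have hφ1 := rootAngle_le le_rfl h1n
  have hs := sin_rootAngle_pos le_rfl h1n
  have hb1 := (sin_phaseShift_bounds le_rfl h1n).2
  have hb2 := (sin_phaseShift_bounds hl1 hln).2
  rw [neg_root_add_root le_rfl hl1 (by omega)]
  have hsl : Real.sin (rootAngle n (n - 1)) ≤ Real.pi / n := by
    rw [← Real.sin_pi_sub]
    have h1 := rootAngle_gt hl1 hln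
    have h2 := rootAngle_lt_pi hl1 hln
    refine (Real.sin_le (by linarith)).trans ?_
    rw [Nat.cast_sub (by omega)] at h1
    have : ((n : ℝ) - (1 : ℕ)) * Real.pi / n = Real.pi - Real.pi / n := by
      field_simp; push_cast; ring
    linarith
  have hs1 : Real.sin (rootAngle n 1) ≤ 5 / 4 * (Real.pi / n) := by
    refine (Real.sin_le hφ0.le).trans (hφ1.trans (le_of_eq ?_)); push_cast; ring
  have jordan : ∀ d, 0 < d → d ≤ Real.pi / 4 → d ≤ Real.pi / 2 * Real.sin d := by
    intro d h0 h1
    have := Real.mul_le_sin h0.le (by linarith)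
    calc d = Real.pi / 2 * (2 / Real.pi * d) := by field_simp
      _ ≤ _ := by gcongr
  have hd2 := jordan _ hd0 hd1
  have he2 := jordan _ he0 he1
  have hφ1' : rootAngle n 1 ≤ 5 / 4 * (Real.pi / n) := hφ1.trans (le_of_eq (by push_cast; ring))
  set φ := rootAngle n 1
  set t := (phaseShift n 1 + phaseShift n (n - 1)) / (2 * n) with ht
  have ht0 : 0 < t := by positivity
  have htn : t * (2 * n) = phaseShift n 1 + phaseShift n (n - 1) := by rw [ht]; field_simp
  have ht1 : t ≤ Real.pi / 4 / n := by
    rw [ht, div_le_div_iff₀ (by positivity) hn0]; nlinarith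
  have hst : Real.sin t ≤ t := Real.sin_le ht0.le
  have hst0 : 0 ≤ Real.sin t := Real.sin_nonneg_of_nonneg_of_le_pi ht0.le (by
    refine ht1.trans ?_
    rw [div_le_iff₀ hn0]
    have hn2 : (2 : ℝ) ≤ n := by exact_mod_cast hn
    nlinarith)
  constructor
  · have htφ : 0 ≤ φ - t := by
      have := rootAngle_gt le_rfl h1n
      have h3 : Real.pi / 4 / n ≤ (1 : ℕ) * Real.pi / n := by gcongr; push_cast; linarith
      linarith
    have h1 : Real.sin (φ - t) ≤ 5 / 4 * (Real.pi / n) :=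
      (Real.sin_le htφ).trans (by linarith)
    have h2 : t ≤ 27 / 16 * Real.pi ^ 2 / n ^ 2 := by
      rw [ht, div_le_div_iff₀ (by positivity) (by positivity)]
      have : phaseShift n 1 + phaseShift n (n - 1) ≤
          Real.pi / 2 * (3 * (5 / 4 * (Real.pi / n))) + Real.pi / 2 * (3 * (Real.pi / n)) := by
        refine add_le_add (hd2.trans ?_) (he2.trans ?_)
        · gcongr; linarith
        · gcongr; linarith
      calc (phaseShift n 1 + phaseShift n (n - 1)) * (n : ℝ) ^ 2 ≤
          (Real.pi / 2 * (3 * (5 / 4 * (Real.pi / n))) + Real.pi / 2 * (3 * (Real.pi / n))) * n ^ 2 := by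
            gcongr
        _ = _ := by field_simp; ring
    calc 2 * Real.sin (φ - t) * Real.sin t ≤
        2 * (5 / 4 * (Real.pi / n)) * (27 / 16 * Real.pi ^ 2 / n ^ 2) := by
          have := hst.trans h2
          gcongr
      _ = 135 / 32 * Real.pi ^ 3 / n ^ 3 := by field_simp; ring
      _ ≤ 200 / n ^ 3 := by
          have : Real.pi ^ 3 ≤ 3.15 ^ 3 := pow_le_pow_left₀ hpi.le hpi'.le 3
          gcongr; linarith
  · calc 2 * Real.sin (φ - t) * Real.sin t ≤ 2 * 1 * (Real.pi / 4 / n) := by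
          have := Real.sin_le_one (φ - t)
          have := hst.trans ht1
          gcongr
      _ = _ := by field_simp; ring

/-! ### Separation of all roots and their negatives -/

theorem abs_root_sub_root_ge (hn : 2 ≤ n) (hk : k < n) (hl : l < n) :
    ((k : ℝ) - l) ^ 2 / (2 * n ^ 2) ≤ |root n k - root n l| := by
  rcases lt_trichotomy k l with h | h | h
  · exact le_trans (le_of_eq (by ring)) ((root_sub_root_ge hn h hl).trans (le_abs_self _))
  · subst h; simp
  · rw [abs_sub_comm]
    exact (root_sub_root_ge hn h hk).trans (le_abs_self _)

theorem abs_root_add_root_ge (hn : 2 ≤ n) (hk : k < n) (hl : l < n) :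
    ((n : ℝ) - k - l) ^ 2 / (8 * n ^ 2) ≤ |root n k + root n l| := by
  rcases lt_trichotomy (k + l) n with h | h | h
  · exact (root_add_root_ge hn h).trans (le_abs_self _)
  · have : (n : ℝ) - k - l = 0 := by rw [← h]; push_cast; ring
    rw [this]; simp
  · have := root_add_root_le hk hl h
    exact (le_neg.1 this).trans (neg_le_abs _)

/-- A uniform lower bound for the distance of any two distinct elements among the roots and their
negatives. -/
theorem gap_ge (hn : 2 ≤ n) (hk : k < n) (hl : l < n) :
    (k ≠ l → 1 / (10 * (n : ℝ) ^ 3) ≤ |root n k - root n l|) ∧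
      1 / (10 * (n : ℝ) ^ 3) ≤ |root n k + root n l| := by
  have hn0 : (0 : ℝ) < n := by exact_mod_cast (by omega : 0 < n)
  have hn2 : (2 : ℝ) ≤ n := by exact_mod_cast hn
  have hsq : ∀ z : ℤ, z ≠ 0 → (1 : ℝ) ≤ (z : ℝ) ^ 2 := fun z hz => by
    have : 1 ≤ z ^ 2 := by nlinarith [Int.one_le_abs hz, sq_abs z]
    exact_mod_cast this
  have h8 : 1 / (10 * (n : ℝ) ^ 3) ≤ 1 / (8 * n ^ 2) := by
    apply one_div_le_one_div_of_le (by positivity); nlinarith [sq_nonneg (n : ℝ)]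
  constructor
  · intro hkl
    refine le_trans ?_ (abs_root_sub_root_ge hn hk hl)
    have h := hsq ((k : ℤ) - l) (by omega)
    push_cast at h
    refine h8.trans ?_
    rw [div_le_div_iff₀ (by positivity) (by positivity)]
    nlinarith [sq_nonneg (n : ℝ)]
  -- The resonant pairs are the only ones of order n⁻³, by sin φ ≥ 3/(2n). All other distances are
  -- at least of order n⁻².
  · by_cases hkl : k + l = n
    · have h1 := neg_root_add_root_ge (by omega : 1 ≤ k) (by omega : 1 ≤ l) hkl
      refine le_trans ?_ (h1.trans (neg_le_abs _))
      have h2 := sin_rootAngle_ge (by omega : 1 ≤ k) hk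
      have h3 : (3 / (2 * (n : ℝ))) ^ 2 ≤ Real.sin (rootAngle n k) ^ 2 :=
        pow_le_pow_left₀ (by positivity) h2 2
      refine le_trans ?_ (div_le_div_of_nonneg_right h3 (by positivity))
      rw [div_pow, div_div, div_le_div_iff₀ (by positivity) (by positivity)]
      nlinarith [pow_pos hn0 3]
    · refine le_trans ?_ (abs_root_add_root_ge hn hk hl)
      have h := hsq ((n : ℤ) - k - l) (by omega)
      push_cast at h
      refine h8.trans ?_
      gcongr

/-! ### Weights -/

/-- The squared overlap of the ENTRANCE with each of the two normalized eigenvectors that belong to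
the `k`-th root. -/
def rootWeight (n k : ℕ) : ℝ := 1 / (2 * ∑ j ∈ Finset.range n, chebU (root n k) j ^ 2)

theorem sum_chebU_sq_pos (hn : 0 < n) (x : ℝ) : 0 < ∑ j ∈ Finset.range n, chebU x j ^ 2 := by
  have h : chebU x 0 ^ 2 ≤ ∑ j ∈ Finset.range n, chebU x j ^ 2 :=
    Finset.single_le_sum (f := fun j => chebU x j ^ 2) (fun j _ => sq_nonneg _)
      (Finset.mem_range.2 hn)
  simp only [chebU] at h
  linarith

theorem rootWeight_pos (hn : 0 < n) : 0 < rootWeight n k := by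
  have := sum_chebU_sq_pos hn (root n k)
  unfold rootWeight; positivity

/-- Every U_j at the edge root with j < n is at least 1. If the root is cos φ with φ ≤ π/(2n), then
(j + 1)φ stays in [0, π/2] and sin((j + 1)φ) ≥ sin φ; otherwise the root is at least 1. -/
theorem rootWeight_zero_le (hn : 0 < n) : rootWeight n 0 ≤ 1 / (2 * n) := by
  have hn0 : (0 : ℝ) < n := by exact_mod_cast hn
  have hn1 : (1 : ℝ) ≤ n := by exact_mod_cast hn
  have hpi := Real.pi_pos
  unfold rootWeight
  apply one_div_le_one_div_of_le (by positivity)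
  gcongr
  have hone : ∀ j ∈ Finset.range n, (1 : ℝ) ≤ chebU (root n 0) j ^ 2 := by
    intro j hj
    suffices 1 ≤ chebU (root n 0) j from one_le_pow₀ this
    have h := (edgeRoot_spec hn).1
    by_cases hx : 1 ≤ root n 0
    · exact (one_le_chebU_of_one_le hx j).1
    push Not at hx
    have hle : Real.pi / (2 * n) ≤ Real.pi / 2 := by
      rw [div_le_div_iff₀ (by positivity) (by positivity)]; nlinarith
    have hc0 : 0 ≤ Real.cos (Real.pi / (2 * n)) :=
      Real.cos_nonneg_of_neg_pi_div_two_le_of_le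
        (by have : 0 ≤ Real.pi / (2 * n) := by positivity
            linarith) hle
    set φ := Real.arccos (root n 0) with hφ
    have hcos : Real.cos φ = root n 0 := Real.cos_arccos (by linarith) hx.le
    have hφ0 : 0 < φ := Real.arccos_pos.2 hx
    have hφ1 : φ ≤ Real.pi / (2 * n) := by
      have := Real.antitone_arccos h.le
      rwa [Real.arccos_cos (by positivity) (by linarith)] at this
    have hj' : (j : ℝ) + 1 ≤ n := by exact_mod_cast Finset.mem_range.1 hj
    have hjφ : ((j : ℝ) + 1) * φ ≤ Real.pi / 2 := by
      calc ((j : ℝ) + 1) * φ ≤ n * (Real.pi / (2 * n)) := by gcongr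
        _ = _ := by field_simp
    have hs : 0 < Real.sin φ := Real.sin_pos_of_pos_of_lt_pi hφ0 (by linarith)
    have h1 := chebU_cos_mul_sin φ j
    have h2 : Real.sin φ ≤ Real.sin ((j + 1) * φ) :=
      Real.sin_le_sin_of_le_of_le_pi_div_two (by linarith) hjφ (by nlinarith [Nat.cast_nonneg (α := ℝ) j])
    rw [hcos] at h1
    rw [← h1] at h2
    exact le_of_mul_le_mul_right (by linarith) hs
  calc (n : ℝ) = ∑ j ∈ Finset.range n, (1 : ℝ) := by simp
    _ ≤ _ := Finset.sum_le_sum hone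

/-- After multiplication by sin²φ the normalization becomes a sum of sin²((j + 1)φ), known in closed
form. Its boundary term is at most 1 and is absorbed by (2n/3) sin φ ≥ 1, leaving at least n/3. -/
theorem rootWeight_le_sin_sq (hk : 1 ≤ k) (hkn : k < n) :
    rootWeight n k ≤ 3 * Real.sin (rootAngle n k) ^ 2 / (2 * n) := by
  have hn0 : (0 : ℝ) < n := by exact_mod_cast (by omega : 0 < n)
  have hs := sin_rootAngle_pos hk hkn
  have hsge := sin_rootAngle_ge hk hkn
  unfold rootWeight
  rw [root_eq_cos hk]
  set φ := rootAngle n k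
  have key : ∀ N : ℕ, 4 * Real.sin φ * ∑ j ∈ Finset.range N, Real.sin ((j + 1) * φ) ^ 2 =
      (2 * N + 1) * Real.sin φ - Real.sin ((2 * N + 1) * φ) := by
    intro N
    induction N with
    | zero => simp
    | succ N ih =>
      have e1 : (2 * ((N + 1 : ℕ) : ℝ) + 1) * φ = 2 * ((N + 1) * φ) + φ := by push_cast; ring
      have e2 : (2 * (N : ℝ) + 1) * φ = 2 * ((N + 1) * φ) - φ := by ring
      rw [Finset.sum_range_succ, mul_add, ih, e1, e2, Real.sin_add, Real.sin_sub, Real.cos_two_mul,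
        Real.cos_sq']
      push_cast; ring
  have h1 := key n
  have h2 : Real.sin φ ^ 2 * ∑ j ∈ Finset.range n, chebU (Real.cos φ) j ^ 2 =
      ∑ j ∈ Finset.range n, Real.sin ((j + 1) * φ) ^ 2 := by
    rw [Finset.mul_sum]
    refine Finset.sum_congr rfl fun j _ => ?_
    rw [← chebU_cos_mul_sin]; ring
  have h3 : (n : ℝ) / 3 ≤ ∑ j ∈ Finset.range n, Real.sin ((j + 1) * φ) ^ 2 := by
    have h4 := Real.sin_le_one ((2 * n + 1) * φ)
    have h5 : 1 ≤ 2 * n / 3 * Real.sin φ := by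
      rw [div_le_iff₀ (by positivity)] at hsge; linarith
    have h6 : 4 * Real.sin φ * (n / 3) ≤
        4 * Real.sin φ * ∑ j ∈ Finset.range n, Real.sin ((j + 1) * φ) ^ 2 := by
      rw [h1]; nlinarith
    exact le_of_mul_le_mul_left h6 (by positivity)
  rw [← h2] at h3
  have hp := sum_chebU_sq_pos (n := n) (by omega) (Real.cos φ)
  rw [div_le_div_iff₀ (by positivity) (by positivity)]
  nlinarith

theorem rootWeight_le (hkn : k < n) : rootWeight n k ≤ 3 / (2 * n) := by
  have hn0 : (0 : ℝ) < n := by exact_mod_cast (by omega : 0 < n)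
  rcases Nat.eq_zero_or_pos k with rfl | hk
  · refine (rootWeight_zero_le (by omega)).trans ?_
    gcongr; norm_num
  · refine (rootWeight_le_sin_sq hk hkn).trans ?_
    gcongr
    nlinarith [Real.sin_sq_le_one (rootAngle n k)]

end Roots

/-! ### The tridiagonal matrix of the column subspace -/

/-- The matrix element between the columns `c` and `c + 1`. -/
def hop (n c : ℕ) : ℝ := if c + 1 = n then 2 else √2

/-- The adjacency matrix in the basis of the column states. -/
def colHop (n : ℕ) : Matrix (Fin (2 * n)) (Fin (2 * n)) ℝ :=
  Matrix.of fun i j => (if (j : ℕ) = i + 1 then hop n i else 0) +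
    (if (i : ℕ) = j + 1 then hop n j else 0)

theorem colHop_transpose (n : ℕ) : (colHop n)ᵀ = colHop n := by
  ext i j
  simp only [colHop, Matrix.transpose_apply, Matrix.of_apply]
  ring

theorem colHop_mulVec (n : ℕ) (g : ℕ → ℝ) (i : Fin (2 * n)) :
    (colHop n *ᵥ fun j => g j) i = (if (i : ℕ) + 1 < 2 * n then hop n i * g (i + 1) else 0) +
      (if 1 ≤ (i : ℕ) then hop n (i - 1) * g (i - 1) else 0) := by
  simp only [colHop, Matrix.mulVec, dotProduct, Matrix.of_apply, add_mul, Finset.sum_add_distrib,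
    ite_mul, zero_mul]
  rw [Fin.sum_univ_eq_sum_range (fun j => if j = (i : ℕ) + 1 then hop n i * g j else 0) (2 * n),
    Fin.sum_univ_eq_sum_range (fun j => if (i : ℕ) = j + 1 then hop n j * g j else 0) (2 * n)]
  congr 1
  · rw [Finset.sum_ite_eq']; simp
  · have hi := i.2
    rcases h : (i : ℕ) with _ | c
    · simp
    · simp only [Nat.add_right_cancel_iff]
      rw [Finset.sum_ite_eq]
      simp; omega

/-- The sign `(-1) ^ ε`. -/
def signOf (ε : Fin 2) : ℝ := if ε = 0 then 1 else -1

theorem signOf_mul_self (ε : Fin 2) : signOf ε * signOf ε = 1 := by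
  unfold signOf; split_ifs <;> norm_num

/-- The mirror-symmetric sequence built from the values `U_j(x)`. -/
def mirrorU (n : ℕ) (x : ℝ) (c : ℕ) : ℝ := if c < n then chebU x c else chebU x (2 * n - 1 - c)

/-- The eigenvectors of `colHop`, not normalized. -/
def eigVec (n : ℕ) (i : Fin 2 × Fin n) (c : ℕ) : ℝ :=
  signOf i.1 ^ c * mirrorU n (root n i.2) c

/-- The eigenvalues of `colHop` divided by `2 √2`. -/
def eigRoot (n : ℕ) (i : Fin 2 × Fin n) : ℝ := signOf i.1 * root n i.2

/-- Inside each tree this is the recursion of U scaled by √2. At the two middle columns the matrix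
element is 2, and the required identity is the root equation `hx`. -/
theorem mirrorU_rec {n : ℕ} (hn : 2 ≤ n) {x : ℝ} (hx : chebU x n = √2 * chebU x (n - 1))
    {c : ℕ} (hc : c < 2 * n) :
    (if c + 1 < 2 * n then hop n c * mirrorU n x (c + 1) else 0) +
      (if 1 ≤ c then hop n (c - 1) * mirrorU n x (c - 1) else 0) =
        2 * √2 * x * mirrorU n x c := by
  have hs2 : √2 * √2 = 2 := Real.mul_self_sqrt (by norm_num)
  obtain ⟨N, rfl⟩ : ∃ N, n = N + 2 := ⟨n - 2, by omega⟩
  have hx' : 2 * x * chebU x (N + 1) - chebU x N = √2 * chebU x (N + 1) := hx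
  unfold mirrorU hop
  by_cases h1 : c < N + 1
  · rw [if_pos (by omega), if_neg (by omega), if_pos (by omega), if_pos (show c < N + 2 by omega)]
    rcases c with _ | c
    · simp [chebU]; ring
    · rw [if_pos (by omega), if_neg (by omega), if_pos (by omega), chebU_succ_succ]
      simp only [Nat.add_sub_cancel]; ring
  by_cases h2 : c = N + 1
  · subst h2
    rw [if_pos (by omega), if_pos (by omega), if_neg (by omega), if_pos (by omega),
      if_neg (by omega), if_pos (by omega), if_pos (by omega)]
    have e : 2 * (N + 2) - 1 - (N + 1 + 1) = N + 1 := by omega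
    rw [e, Nat.add_sub_cancel]
    linear_combination (-√2) * hx' - chebU x (N + 1) * hs2
  by_cases h3 : c = N + 2
  · subst h3
    rw [if_pos (by omega), if_neg (by omega), if_neg (by omega), if_pos (by omega),
      if_pos (by omega), if_pos (by omega), if_neg (by omega)]
    have e : 2 * (N + 2) - 1 - (N + 2) = N + 1 := by omega
    have e' : 2 * (N + 2) - 1 - (N + 2 + 1) = N := by omega
    rw [e, e']
    have e'' : N + 2 - 1 = N + 1 := by omega
    rw [e'']
    linear_combination (-√2) * hx' - chebU x (N + 1) * hs2
  obtain ⟨e, he⟩ : ∃ e, c + e = 2 * (N + 2) - 1 := ⟨2 * (N + 2) - 1 - c, by omega⟩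
  have e1 : 2 * (N + 2) - 1 - c = e := by omega
  have e2 : 2 * (N + 2) - 1 - (c - 1) = e + 1 := by omega
  have e3 : 2 * (N + 2) - 1 - (c + 1) = e - 1 := by omega
  rw [e1, e2, e3, if_pos (by omega : 1 ≤ c), if_neg (by omega : ¬ c < N + 2),
    if_neg (by omega : ¬ c - 1 < N + 2), if_neg (by omega : ¬ c + 1 < N + 2),
    if_neg (by omega : ¬ c + 1 = N + 2), if_neg (by omega : ¬ c - 1 + 1 = N + 2)]
  rcases e with _ | e
  · rw [if_neg (by omega)]; simp [chebU]; ring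
  · rw [if_pos (by omega), chebU_succ_succ]
    simp only [Nat.add_sub_cancel]; ring

/-- The matrix only connects columns of opposite parity, so an alternating sign turns an eigenvector
into one for the negated eigenvalue. -/
theorem colHop_mulVec_eigVec {n : ℕ} (hn : 2 ≤ n) (i : Fin 2 × Fin n) :
    colHop n *ᵥ (fun c => eigVec n i c) = (2 * √2 * eigRoot n i) • fun c : Fin (2 * n) => eigVec n i c := by
  ext c
  have h := mirrorU_rec hn (chebU_root i.2.2) c.2
  have hs := signOf_mul_self i.1
  rw [colHop_mulVec, Pi.smul_apply, smul_eq_mul]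
  unfold eigVec eigRoot
  rw [show 2 * √2 * (signOf i.1 * root n i.2) * (signOf i.1 ^ (c : ℕ) * mirrorU n (root n i.2) c) =
    signOf i.1 * signOf i.1 ^ (c : ℕ) * (2 * √2 * root n i.2 * mirrorU n (root n i.2) c) by ring, ← h,
    mul_add]
  congr 1
  · split_ifs
    · ring
    · ring
  · split_ifs with hc
    · obtain ⟨d, hd⟩ : ∃ d, (c : ℕ) = d + 1 := ⟨c - 1, by omega⟩
      rw [hd, Nat.add_sub_cancel, pow_succ]
      linear_combination (-hop n d * signOf i.1 ^ d * mirrorU n (root n i.2) d) * hs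
    · ring

theorem eigRoot_sub_ge {n : ℕ} (hn : 2 ≤ n) {i j : Fin 2 × Fin n} (hij : i ≠ j) :
    1 / (10 * (n : ℝ) ^ 3) ≤ |eigRoot n i - eigRoot n j| := by
  obtain ⟨ε, k⟩ := i
  obtain ⟨δ, l⟩ := j
  obtain ⟨h1, h2⟩ := gap_ge hn k.2 l.2
  by_cases hεδ : ε = δ
  · subst hεδ
    have h := h1 (fun h => hij (by rw [Fin.ext h]))
    unfold eigRoot
    rw [← mul_sub, abs_mul]
    have : |signOf ε| = 1 := by unfold signOf; split_ifs <;> simp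
    rwa [this, one_mul]
  · have : eigRoot n (ε, k) - eigRoot n (δ, l) = signOf ε * (root n k + root n l) := by
      unfold eigRoot signOf
      fin_cases ε <;> fin_cases δ <;> simp_all [sub_eq_add_neg, add_comm]
    rw [this, abs_mul]
    have : |signOf ε| = 1 := by unfold signOf; split_ifs <;> simp
    rwa [this, one_mul]

theorem eigRoot_injective {n : ℕ} (hn : 2 ≤ n) : Function.Injective (eigRoot n) := by
  intro i j h
  by_contra hij
  have := eigRoot_sub_ge hn hij
  rw [h, sub_self, abs_zero] at this
  have hn0 : (0 : ℝ) < n := by exact_mod_cast (by omega : 0 < n)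
  have : (0 : ℝ) < 1 / (10 * (n : ℝ) ^ 3) := by positivity
  linarith

theorem sum_mirrorU_sq (n : ℕ) (x : ℝ) :
    ∑ c : Fin (2 * n), mirrorU n x c ^ 2 = 2 * ∑ j ∈ Finset.range n, chebU x j ^ 2 := by
  rw [Fin.sum_univ_eq_sum_range (fun c => mirrorU n x c ^ 2) (2 * n), two_mul n,
    Finset.sum_range_add, two_mul]
  congr 1
  · refine Finset.sum_congr rfl fun j hj => ?_
    rw [mirrorU, if_pos (Finset.mem_range.1 hj)]
  · rw [← Finset.sum_range_reflect]
    refine Finset.sum_congr rfl fun j hj => ?_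
    have := Finset.mem_range.1 hj
    rw [mirrorU, if_neg (by omega)]
    congr 2; omega

/-- Different indices give different eigenvalues of a symmetric matrix, hence orthogonality. The
diagonal case is the definition of the weight, since the mirrored sequence counts each U_j twice. -/
theorem eigVec_dotProduct {n : ℕ} (hn : 2 ≤ n) (i j : Fin 2 × Fin n) :
    rootWeight n i.2 * ∑ c : Fin (2 * n), eigVec n i c * eigVec n j c = if i = j then 1 else 0 := by
  split_ifs with hij
  · subst hij
    have e : ∀ c : Fin (2 * n), eigVec n i c * eigVec n i c = mirrorU n (root n i.2) c ^ 2 := by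
      intro c
      unfold eigVec
      have : signOf i.1 ^ (c : ℕ) * signOf i.1 ^ (c : ℕ) = 1 := by
        rw [← mul_pow, signOf_mul_self, one_pow]
      linear_combination (mirrorU n (root n i.2) c ^ 2) * this
    simp only [e]
    rw [sum_mirrorU_sq, rootWeight]
    have := sum_chebU_sq_pos (n := n) (by omega) (root n i.2)
    field_simp
  · have h1 := colHop_mulVec_eigVec hn i
    have h2 := colHop_mulVec_eigVec hn j
    set v : Fin (2 * n) → ℝ := fun c => eigVec n i c
    set w : Fin (2 * n) → ℝ := fun c => eigVec n j c
    have h3 : v ⬝ᵥ w = ∑ c : Fin (2 * n), eigVec n i c * eigVec n j c := rfl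
    rw [← h3]
    have h4 : (colHop n *ᵥ v) ⬝ᵥ w = v ⬝ᵥ (colHop n *ᵥ w) := by
      rw [Matrix.dotProduct_mulVec, ← Matrix.mulVec_transpose, colHop_transpose]
    rw [h1, h2, smul_dotProduct, dotProduct_smul, smul_eq_mul, smul_eq_mul] at h4
    have h5 : eigRoot n i - eigRoot n j ≠ 0 := sub_ne_zero.2 fun h => hij (eigRoot_injective hn h)
    have hs : (0 : ℝ) < √2 := by positivity
    have h6 : (2 * √2 * (eigRoot n i - eigRoot n j)) * (v ⬝ᵥ w) = 0 := by linear_combination h4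
    rcases mul_eq_zero.1 h6 with h | h
    · exact absurd h (mul_ne_zero (by positivity) h5)
    · rw [h, mul_zero]

/-- Completeness of the eigenvectors. -/
theorem sum_rootWeight_mul_eigVec {n : ℕ} (hn : 2 ≤ n) (a b : Fin (2 * n)) :
    ∑ i : Fin 2 × Fin n, rootWeight n i.2 * eigVec n i a * eigVec n i b =
      if a = b then 1 else 0 := by
  let P : Matrix (Fin 2 × Fin n) (Fin (2 * n)) ℝ := Matrix.of fun i c => rootWeight n i.2 * eigVec n i c
  let Q : Matrix (Fin (2 * n)) (Fin 2 × Fin n) ℝ := Matrix.of fun c i => eigVec n i c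
  have h : P * Q = 1 := by
    ext i j
    rw [Matrix.mul_apply, Matrix.one_apply, ← eigVec_dotProduct hn i j, Finset.mul_sum]
    simp [P, Q, mul_assoc]
  -- There are 2n eigenvectors in dimension 2n, so orthonormality, a one-sided inverse of a square
  -- matrix, already gives completeness.
  have h' : Q * P = 1 := (Matrix.mul_eq_one_comm_of_equiv finProdFinEquiv).1 h
  have := congrFun (congrFun h' a) b
  rw [Matrix.mul_apply, Matrix.one_apply] at this
  rw [← this]
  refine Finset.sum_congr rfl fun i _ => ?_
  simp only [P, Q, Matrix.of_apply]; ring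

theorem eigVec_zero {n : ℕ} (hn : 1 ≤ n) (i : Fin 2 × Fin n) : eigVec n i 0 = 1 := by
  simp [eigVec, mirrorU, chebU, show 0 < n by omega]

/-- The last index 2n - 1 is odd, so the alternating modes are antisymmetric. This is the relative
sign between T_z(y) and T_z(-y) in the transition amplitude. -/
theorem eigVec_last {n : ℕ} (hn : 1 ≤ n) (i : Fin 2 × Fin n) :
    eigVec n i (2 * n - 1) = signOf i.1 := by
  have e : 2 * n - 1 = 2 * (n - 1) + 1 := by omega
  rw [eigVec, mirrorU, if_neg (by omega), Nat.sub_self, e, pow_succ, pow_mul, pow_two,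
    signOf_mul_self]
  simp [chebU]

theorem sum_rootWeight {n : ℕ} (hn : 2 ≤ n) : ∑ k : Fin n, rootWeight n k = 1 / 2 := by
  have h := sum_rootWeight_mul_eigVec hn ⟨0, by omega⟩ ⟨0, by omega⟩
  simp only [eigVec_zero (by omega : 1 ≤ n), Fintype.sum_prod_type, Fin.sum_univ_two, mul_one,
    if_true] at h
  linarith

/-! ### The gap -/

theorem spectrum_colHop {n : ℕ} (hn : 2 ≤ n) :
    spectrum ℝ (colHop n) = Set.range fun i => 2 * √2 * eigRoot n i := by
  have mem : ∀ μ, μ ∈ spectrum ℝ (colHop n) ↔ ∃ v ≠ 0, colHop n *ᵥ v = μ • v := by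
    intro μ
    rw [spectrum.mem_iff, Matrix.isUnit_iff_isUnit_det, isUnit_iff_ne_zero, not_not,
      ← Matrix.exists_mulVec_eq_zero_iff]
    refine exists_congr fun v => and_congr_right fun _ => ?_
    rw [Matrix.sub_mulVec, Algebra.algebraMap_eq_smul_one, Matrix.smul_mulVec, Matrix.one_mulVec,
      sub_eq_zero, eq_comm]
  ext μ
  rw [mem, Set.mem_range]
  constructor
  · rintro ⟨v, hv0, hv⟩
    by_contra hcon
    push Not at hcon
    apply hv0
    -- An eigenvector for any other value would be orthogonal to the complete family, hence zero.
    have hz : ∀ i, (fun c : Fin (2 * n) => eigVec n i c) ⬝ᵥ v = 0 := by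
      intro i
      have h1 := colHop_mulVec_eigVec hn i
      set w : Fin (2 * n) → ℝ := fun c => eigVec n i c
      have h4 : (colHop n *ᵥ w) ⬝ᵥ v = w ⬝ᵥ (colHop n *ᵥ v) := by
        rw [Matrix.dotProduct_mulVec, ← Matrix.mulVec_transpose, colHop_transpose]
      rw [h1, hv, smul_dotProduct, dotProduct_smul, smul_eq_mul, smul_eq_mul] at h4
      have h6 : (2 * √2 * eigRoot n i - μ) * (w ⬝ᵥ v) = 0 := by linear_combination h4
      exact (mul_eq_zero.1 h6).resolve_left (sub_ne_zero.2 (hcon i))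
    ext a
    have h : v a = ∑ i : Fin 2 × Fin n, rootWeight n i.2 * eigVec n i a *
        ((fun c : Fin (2 * n) => eigVec n i c) ⬝ᵥ v) := by
      simp only [dotProduct, Finset.mul_sum]
      rw [Finset.sum_comm]
      have : ∀ b : Fin (2 * n), ∑ i : Fin 2 × Fin n,
          rootWeight n i.2 * eigVec n i a * (eigVec n i b * v b) = (if a = b then 1 else 0) * v b := by
        intro b
        rw [← sum_rootWeight_mul_eigVec hn a b, Finset.sum_mul]
        exact Finset.sum_congr rfl fun i _ => by ring
      simp only [this]; simp
    rw [h]; simp [hz]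
  · rintro ⟨i, rfl⟩
    refine ⟨fun c => eigVec n i c, fun h => ?_, colHop_mulVec_eigVec hn i⟩
    have := congrFun h ⟨0, by omega⟩
    simp [eigVec_zero (by omega : 1 ≤ n)] at this

/-- The minimum gap between distinct eigenvalues of `colHop n`. -/
def hopGap (n : ℕ) : ℝ :=
  sInf {d | ∃ x ∈ spectrum ℝ (colHop n), ∃ y ∈ spectrum ℝ (colHop n), x ≠ y ∧ d = |x - y|}

theorem hopGap_le_of {n : ℕ} (hn : 2 ≤ n) {i j : Fin 2 × Fin n} (hij : i ≠ j) :
    hopGap n ≤ 2 * √2 * |eigRoot n i - eigRoot n j| := by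
  apply csInf_le ⟨0, by rintro d ⟨x, _, y, _, _, rfl⟩; positivity⟩
  rw [spectrum_colHop hn]
  refine ⟨_, ⟨i, rfl⟩, _, ⟨j, rfl⟩, fun h => hij (eigRoot_injective hn ?_), ?_⟩
  · have hs : (0 : ℝ) < 2 * √2 := by positivity
    exact mul_left_cancel₀ hs.ne' h
  · rw [← mul_sub, abs_mul, abs_of_pos (by positivity : (0 : ℝ) < 2 * √2)]

theorem hopGap_ge {n : ℕ} (hn : 2 ≤ n) : 1 / (5 * (n : ℝ) ^ 3) ≤ hopGap n := by
  have hn0 : (0 : ℝ) < n := by exact_mod_cast (by omega : 0 < n)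
  have hs := sqrt_two_bounds
  have h0 : 0 < n := by omega
  apply le_csInf
  · rw [spectrum_colHop hn]
    refine ⟨_, _, ⟨((0 : Fin 2), ⟨0, h0⟩), rfl⟩, _, ⟨((1 : Fin 2), ⟨0, h0⟩), rfl⟩, fun h => ?_, rfl⟩
    have hs : (0 : ℝ) < 2 * √2 := by positivity
    have := eigRoot_injective hn (mul_left_cancel₀ hs.ne' h)
    simp at this
  · rintro d ⟨x, hx, y, hy, hxy, rfl⟩
    rw [spectrum_colHop hn] at hx hy
    obtain ⟨i, rfl⟩ := hx
    obtain ⟨j, rfl⟩ := hy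
    have hij : i ≠ j := fun h => hxy (by rw [h])
    have h := eigRoot_sub_ge hn hij
    simp only
    rw [← mul_sub, abs_mul, abs_of_pos (by positivity : (0 : ℝ) < 2 * √2)]
    have e : 1 / (5 * (n : ℝ) ^ 3) = 2 * (1 / (10 * (n : ℝ) ^ 3)) := by field_simp; norm_num
    rw [e]
    gcongr
    linarith

theorem hopGap_pos {n : ℕ} (hn : 2 ≤ n) : 0 < hopGap n := by
  have hn0 : (0 : ℝ) < n := by exact_mod_cast (by omega : 0 < n)
  exact lt_of_lt_of_le (by positivity) (hopGap_ge hn)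

theorem hopGap_le {n : ℕ} (hn : 2 ≤ n) :
    hopGap n ≤ 600 / (n : ℝ) ^ 3 ∧ hopGap n ≤ 3 * Real.pi / (2 * n) := by
  have hn0 : (0 : ℝ) < n := by exact_mod_cast (by omega : 0 < n)
  have hs := sqrt_two_bounds
  have hpi := Real.pi_pos
  obtain ⟨h1, h2⟩ := neg_root_add_root_le hn
  -- The resonant pair at the ends of the band: the root with index 1 and the negative of the root
  -- with index n - 1.
  have h := hopGap_le_of hn (i := (0, ⟨1, hn⟩)) (j := (1, ⟨n - 1, by omega⟩)) (by simp)
  have e : eigRoot n (0, ⟨1, hn⟩) - eigRoot n (1, ⟨n - 1, by omega⟩) =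
      root n 1 + root n (n - 1) := by
    simp [eigRoot, signOf]
  have hneg : 0 ≤ -(root n 1 + root n (n - 1)) := by
    refine le_trans ?_ (neg_root_add_root_ge le_rfl (by omega) (by omega))
    positivity
  rw [e, ← abs_neg, abs_of_nonneg hneg] at h
  constructor
  · refine h.trans ?_
    calc 2 * √2 * -(root n 1 + root n (n - 1)) ≤ 3 * (200 / (n : ℝ) ^ 3) := by gcongr; linarith
      _ = _ := by ring
  · refine h.trans ?_
    calc 2 * √2 * -(root n 1 + root n (n - 1)) ≤ 3 * (Real.pi / (2 * n)) := by gcongr; linarith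
      _ = _ := by ring

/-! ### The amplitudes of the walk on the columns -/

/-- The amplitude `⟨exit| T_z(A / 3) |col c⟩` in terms of the column `c`. -/
def colAmp (n z c : ℕ) : ℝ :=
  ∑ i : Fin 2 × Fin n, rootWeight n i.2 * eigVec n i (2 * n - 1) *
    (chebT z (2 * √2 / 3 * eigRoot n i) * eigVec n i c)

/-- The average over the times `z < M` of the transition probabilities from ENTRANCE to EXIT. -/
def walkAverage (n M : ℕ) : ℝ := (∑ z ∈ Finset.range M, colAmp n z 0 ^ 2) / M

theorem abs_mul_eigRoot_le {n : ℕ} (i : Fin 2 × Fin n) : |2 * √2 / 3 * eigRoot n i| ≤ 1 := by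
  have h := abs_mul_root_le i.2.2
  have : |signOf i.1| = 1 := by unfold signOf; split_ifs <;> simp
  unfold eigRoot
  rw [mul_left_comm, abs_mul, this, one_mul]
  exact h

theorem colAmp_zero {n : ℕ} (hn : 2 ≤ n) {c : ℕ} (hc : c < 2 * n) :
    colAmp n 0 c = if c = 2 * n - 1 then 1 else 0 := by
  have h := sum_rootWeight_mul_eigVec hn ⟨2 * n - 1, by omega⟩ ⟨c, hc⟩
  simp only [colAmp, chebT_zero, one_mul]
  rw [h]
  simp [Fin.ext_iff, eq_comm]

theorem colHop_mulVec_sum {n : ℕ} (hn : 2 ≤ n) (a : Fin 2 × Fin n → ℝ) (c : Fin (2 * n)) :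
    (colHop n *ᵥ fun d => ∑ i, a i * eigVec n i d) c =
      ∑ i, a i * (2 * √2 * eigRoot n i * eigVec n i c) := by
  have e : (fun d : Fin (2 * n) => ∑ i, a i * eigVec n i d) =
      ∑ i, a i • fun d : Fin (2 * n) => eigVec n i d := by
    ext d; simp
  rw [e, Matrix.mulVec_sum, Finset.sum_apply]
  refine Finset.sum_congr rfl fun i _ => ?_
  rw [Matrix.mulVec_smul, colHop_mulVec_eigVec hn]
  simp

theorem colAmp_one {n : ℕ} (hn : 2 ≤ n) (c : Fin (2 * n)) :
    colAmp n 1 c = 1 / 3 * (colHop n *ᵥ fun d => colAmp n 0 d) c := by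
  simp only [colAmp, ← mul_assoc]
  rw [colHop_mulVec_sum hn, Finset.mul_sum]
  refine Finset.sum_congr rfl fun i _ => ?_
  rw [chebT_one (abs_mul_eigRoot_le i), chebT_zero]; ring

theorem colAmp_succ_succ {n : ℕ} (hn : 2 ≤ n) (z : ℕ) (c : Fin (2 * n)) :
    colAmp n (z + 2) c =
      2 / 3 * (colHop n *ᵥ fun d => colAmp n (z + 1) d) c - colAmp n z c := by
  simp only [colAmp, ← mul_assoc]
  rw [colHop_mulVec_sum hn, Finset.mul_sum, ← Finset.sum_sub_distrib]
  refine Finset.sum_congr rfl fun i _ => ?_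
  rw [chebT_succ_succ (abs_mul_eigRoot_le i)]; ring

theorem hop_pos (n c : ℕ) : 0 < hop n c := by
  unfold hop; split_ifs <;> positivity

/-- Light cone: one time step moves the amplitude by at most one column. At the front the only
contribution is a product of positive matrix elements, and the subtracted term of the Chebyshev
recursion is still zero there. -/
theorem colAmp_support {n : ℕ} (hn : 2 ≤ n) (z : ℕ) :
    ∀ c, c < 2 * n → (c + z < 2 * n - 1 → colAmp n z c = 0) ∧
      (c + z = 2 * n - 1 → 0 < colAmp n z c) := by
  induction z using Nat.strong_induction_on with
  | _ z ih =>
    intro c hc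
    have step : ∀ z', (∀ d, d < 2 * n → (d + z' < 2 * n - 1 → colAmp n z' d = 0) ∧
        (d + z' = 2 * n - 1 → 0 < colAmp n z' d)) →
        (c + (z' + 1) < 2 * n - 1 → (colHop n *ᵥ fun d => colAmp n z' d) ⟨c, hc⟩ = 0) ∧
        (c + (z' + 1) = 2 * n - 1 → 0 < (colHop n *ᵥ fun d => colAmp n z' d) ⟨c, hc⟩) := by
      intro z' h
      rw [colHop_mulVec n (fun d => colAmp n z' d) ⟨c, hc⟩]
      simp only
      constructor
      · intro hlt
        rw [if_pos (by omega), (h (c + 1) (by omega)).1 (by omega)]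
        split_ifs
        · rw [(h (c - 1) (by omega)).1 (by omega)]; ring
        · ring
      · intro heq
        rw [if_pos (by omega)]
        have := mul_pos (hop_pos n c) ((h (c + 1) (by omega)).2 (by omega))
        split_ifs
        · rw [(h (c - 1) (by omega)).1 (by omega)]; linarith
        · linarith
    match z with
    | 0 =>
      rw [colAmp_zero hn hc]
      constructor
      · intro h; rw [if_neg (by omega)]
      · intro h; rw [if_pos (by omega)]; norm_num
    | 1 =>
      obtain ⟨h1, h2⟩ := step 0 (ih 0 (by omega))
      have e := colAmp_one hn ⟨c, hc⟩
      simp only at e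
      rw [e]
      exact ⟨fun h => by rw [h1 h, mul_zero], fun h => by have := h2 h; positivity⟩
    | z + 2 =>
      obtain ⟨h1, h2⟩ := step (z + 1) (ih (z + 1) (by omega))
      have e := colAmp_succ_succ hn z ⟨c, hc⟩
      simp only at e
      rw [e]
      constructor
      · intro h
        rw [h1 (by omega), (ih z (by omega) c hc).1 (by omega)]; ring
      · intro h
        rw [(ih z (by omega) c hc).1 (by omega)]
        have := h2 (by omega)
        linarith

/-- Covers the small n for which the asymptotic lower bound is vacuous. The time 2n - 1, at which
the front arrives, must be among the z < M. -/
theorem walkAverage_pos {n M : ℕ} (hn : 2 ≤ n) (hM : 2 * n ≤ M) : 0 < walkAverage n M := by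
  have h := (colAmp_support hn (2 * n - 1) 0 (by omega)).2 (by omega)
  have hM0 : (0 : ℝ) < M := by exact_mod_cast (by omega : 0 < M)
  unfold walkAverage
  refine div_pos (lt_of_lt_of_le (pow_pos h 2) ?_) hM0
  exact Finset.single_le_sum (f := fun z => colAmp n z 0 ^ 2) (fun z _ => sq_nonneg _)
    (Finset.mem_range.2 (by omega))

theorem colAmp_entrance {n : ℕ} (hn : 2 ≤ n) (z : ℕ) :
    colAmp n z 0 = ∑ k : Fin n, rootWeight n k *
      (chebT z (2 * √2 / 3 * root n k) - chebT z (-(2 * √2 / 3 * root n k))) := by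
  simp only [colAmp, eigVec_zero (by omega : 1 ≤ n), eigVec_last (by omega : 1 ≤ n),
    Fintype.sum_prod_type, Fin.sum_univ_two, eigRoot, signOf, ← Finset.sum_add_distrib]
  refine Finset.sum_congr rfl fun k _ => ?_
  simp; ring

/-! ### Bounds for the average -/

/-- The differences a - l are distinct integers, so a convergent series bounds the sum uniformly in
n and a. A possible term l = a is 1/0 = 0 and drops out. -/
theorem sum_one_div_sq_le : ∃ B : ℝ, 0 < B ∧ ∀ (n : ℕ) (a : ℤ),
    ∑ l : Fin n, 1 / ((a : ℝ) - (l : ℕ)) ^ 2 ≤ B := by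
  have hs : Summable fun z : ℤ => 1 / (z : ℝ) ^ 2 := Real.summable_one_div_int_pow.2 (by norm_num)
  refine ⟨(∑' z : ℤ, 1 / (z : ℝ) ^ 2) + 1, ?_, fun n a => ?_⟩
  · have : 0 ≤ ∑' z : ℤ, 1 / (z : ℝ) ^ 2 := tsum_nonneg fun z => by positivity
    linarith
  · let e : Fin n ↪ ℤ := ⟨fun l => a - (l : ℕ), fun x y h => by
      apply Fin.ext
      have : a - ((x : ℕ) : ℤ) = a - ((y : ℕ) : ℤ) := h
      omega⟩
    have h := hs.sum_le_tsum (Finset.univ.map e) (fun z _ => by positivity)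
    rw [Finset.sum_map] at h
    have e' : ∑ l : Fin n, 1 / ((a : ℝ) - (l : ℕ)) ^ 2 = ∑ l : Fin n, 1 / ((e l : ℤ) : ℝ) ^ 2 := by
      refine Finset.sum_congr rfl fun l _ => ?_
      change _ = 1 / ((a - ((l : ℕ) : ℤ) : ℤ) : ℝ) ^ 2
      push_cast; rfl
    rw [e']
    linarith

/-- The time correlation of the modes that belong to the roots `k` and `l`. -/
def modeCorrelation (n M k l : ℕ) : ℝ := ∑ z ∈ Finset.range M,
  (chebT z (2 * √2 / 3 * root n k) - chebT z (-(2 * √2 / 3 * root n k))) *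
    (chebT z (2 * √2 / 3 * root n l) - chebT z (-(2 * √2 / 3 * root n l)))

theorem sum_colAmp_sq {n : ℕ} (hn : 2 ≤ n) (M : ℕ) :
    ∑ z ∈ Finset.range M, colAmp n z 0 ^ 2 =
      ∑ k : Fin n, ∑ l : Fin n, rootWeight n k * rootWeight n l * modeCorrelation n M k l := by
  simp only [colAmp_entrance hn, sq, Finset.sum_mul_sum, modeCorrelation]
  simp only [Finset.mul_sum]
  rw [Finset.sum_comm]
  refine Finset.sum_congr rfl fun k _ => ?_
  rw [Finset.sum_comm]
  refine Finset.sum_congr rfl fun l _ => Finset.sum_congr rfl fun z _ => by ring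

/-- The product expands into four sums, two with equal and two with opposite signs of the arguments,
and Christoffel–Darboux applies to each with distinct arguments. For k = l the two equal-sign sums
are the subtracted diagonal, and the corresponding reciprocal on the right is 1/0 = 0. -/
theorem abs_modeCorrelation_le {n k l : ℕ} (hn : 2 ≤ n) (hk : k < n) (hl : l < n) (M : ℕ) :
    |modeCorrelation n M k l - (if k = l then
      ∑ z ∈ Finset.range M, (chebT z (2 * √2 / 3 * root n k) ^ 2 +
        chebT z (-(2 * √2 / 3 * root n k)) ^ 2) else 0)| ≤
      8 * (1 / |root n k - root n l| + 1 / |root n k + root n l|) := by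
  have hn0 : (0 : ℝ) < n := by exact_mod_cast (by omega : 0 < n)
  have hs := sqrt_two_bounds
  have hy := abs_mul_root_le hk
  have hw := abs_mul_root_le hl
  have hc : (0 : ℝ) < 2 * √2 / 3 := by positivity
  obtain ⟨g1, g2⟩ := gap_ge hn hk hl
  have hpos : (0 : ℝ) < 1 / (10 * (n : ℝ) ^ 3) := by positivity
  have hadd : 0 < |root n k + root n l| := lt_of_lt_of_le hpos g2
  have scale : ∀ t : ℝ, 0 < |t| → 2 / |2 * √2 / 3 * t| ≤ 4 * (1 / |t|) := by
    intro t ht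
    rw [abs_mul, abs_of_pos hc, mul_one_div, div_le_div_iff₀ (by positivity) ht]
    nlinarith
  set y := 2 * √2 / 3 * root n k with hyd
  set w := 2 * √2 / 3 * root n l with hwd
  have hy' : |-y| ≤ 1 := by rwa [abs_neg]
  have hw' : |-w| ≤ 1 := by rwa [abs_neg]
  have h0 := scale _ hadd
  have eadd : 2 * √2 / 3 * (root n k + root n l) = y + w := by rw [hyd, hwd]; ring
  rw [eadd] at h0
  have hyw : y + w ≠ 0 := by
    rw [← eadd]; exact mul_ne_zero hc.ne' (abs_pos.1 hadd)
  have h1 : |∑ z ∈ Finset.range M, chebT z y * chebT z (-w)| ≤ 2 / |y + w| := by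
    have := abs_sum_chebT_mul_le hy hw' (fun h => hyw (by rw [h]; ring)) M
    rwa [sub_neg_eq_add] at this
  have h2 : |∑ z ∈ Finset.range M, chebT z (-y) * chebT z w| ≤ 2 / |y + w| := by
    have := abs_sum_chebT_mul_le hy' hw (fun h => hyw (by rw [← h]; ring)) M
    rwa [← neg_add', abs_neg] at this
  have expand : modeCorrelation n M k l = ∑ z ∈ Finset.range M, chebT z y * chebT z w +
      ∑ z ∈ Finset.range M, chebT z (-y) * chebT z (-w) -
      ∑ z ∈ Finset.range M, chebT z y * chebT z (-w) -
      ∑ z ∈ Finset.range M, chebT z (-y) * chebT z w := by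
    rw [modeCorrelation, ← Finset.sum_add_distrib, ← Finset.sum_sub_distrib,
      ← Finset.sum_sub_distrib]
    exact Finset.sum_congr rfl fun z _ => by ring
  have b1 := abs_le.1 h1
  have b2 := abs_le.1 h2
  rw [expand]
  split_ifs with hkl
  · have hwy : w = y := by rw [hwd, hyd, hkl]
    rw [hkl, sub_self, abs_zero, div_zero, zero_add, ← hkl]
    rw [hwy] at b1 b2 h0 ⊢
    simp only [Finset.sum_add_distrib, sq]
    rw [hkl] at h0
    rw [abs_le]
    rw [hkl]
    constructor <;> linarith
  · have hsub : 0 < |root n k - root n l| := lt_of_lt_of_le hpos (g1 hkl)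
    have h3 := scale _ hsub
    have esub : 2 * √2 / 3 * (root n k - root n l) = y - w := by rw [hyd, hwd]; ring
    rw [esub] at h3
    have hne : y - w ≠ 0 := by
      rw [← esub]; exact mul_ne_zero hc.ne' (abs_pos.1 hsub)
    have h4 := abs_le.1 (abs_sum_chebT_mul_le hy hw (sub_ne_zero.1 hne) M)
    have h5 : |∑ z ∈ Finset.range M, chebT z (-y) * chebT z (-w)| ≤ 2 / |y - w| := by
      have := abs_sum_chebT_mul_le hy' hw' (fun h => hne (by linarith)) M
      rwa [neg_sub_neg, abs_sub_comm] at this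
    have h5 := abs_le.1 h5
    rw [sub_zero, abs_le]
    constructor <;> linarith

/-- Away from resonance both weights are O(1/n), and the quadratic separation gives the two summable
terms. For k + l = n the small distance sin²φ/(10n) is compensated by the sin²φ in one weight,
leaving O(1/n). Terms with vanishing denominators count as zero. -/
theorem weight_div_gap_le {n k l : ℕ} (hn : 2 ≤ n) (hk : k < n) (hl : l < n) :
    rootWeight n k * rootWeight n l * (1 / |root n k - root n l| + 1 / |root n k + root n l|) ≤
      9 / 2 * (1 / ((k : ℝ) - l) ^ 2) + 18 * (1 / ((n : ℝ) - k - l) ^ 2) + 23 / n := by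
  have hn0 : (0 : ℝ) < n := by exact_mod_cast (by omega : 0 < n)
  have hp := rootWeight_pos (n := n) (k := k) (by omega)
  have hq := rootWeight_pos (n := n) (k := l) (by omega)
  have hp1 := rootWeight_le hk
  have hq1 := rootWeight_le hl
  have hpq : rootWeight n k * rootWeight n l ≤ 9 / (4 * (n : ℝ) ^ 2) := by
    calc _ ≤ 3 / (2 * (n : ℝ)) * (3 / (2 * n)) := by gcongr
      _ = _ := by field_simp; norm_num
  rw [mul_add, add_assoc]
  apply add_le_add
  · by_cases hkl : k = l
    · subst hkl; simp
    have hd : (0 : ℝ) < ((k : ℝ) - l) ^ 2 := by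
      apply sq_pos_of_ne_zero
      exact sub_ne_zero.2 (by exact_mod_cast hkl)
    have h := abs_root_sub_root_ge hn hk hl
    calc _ ≤ 9 / (4 * (n : ℝ) ^ 2) * (1 / (((k : ℝ) - l) ^ 2 / (2 * n ^ 2))) := by gcongr
      _ = _ := by field_simp; norm_num
  · by_cases hkl : k + l = n
    · have hk1 : 1 ≤ k := by omega
      have hs := sin_rootAngle_pos hk1 hk
      have h := (neg_root_add_root_ge hk1 (by omega) hkl).trans (neg_le_abs _)
      have e : (n : ℝ) - k - l = 0 := by rw [← hkl]; push_cast; ring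
      rw [e]
      have h2 := rootWeight_le_sin_sq hk1 hk
      calc _ ≤ 3 * Real.sin (rootAngle n k) ^ 2 / (2 * n) * (3 / (2 * n)) *
            (1 / (Real.sin (rootAngle n k) ^ 2 / (10 * n))) := by gcongr
        _ = 45 / 2 / n := by field_simp; norm_num
        _ ≤ 23 / n := by gcongr; norm_num
        _ = _ := by simp
    · have hd : (0 : ℝ) < ((n : ℝ) - k - l) ^ 2 := by
        apply sq_pos_of_ne_zero
        intro h
        apply hkl
        have : (n : ℝ) = ((k + l : ℕ) : ℝ) := by push_cast; linarith
        exact_mod_cast this.symm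
      have h := abs_root_add_root_ge hn hk hl
      have : (0 : ℝ) ≤ 23 / n := by positivity
      calc _ ≤ 9 / (4 * (n : ℝ) ^ 2) * (1 / (((n : ℝ) - k - l) ^ 2 / (8 * n ^ 2))) := by gcongr
        _ = 18 * (1 / ((n : ℝ) - k - l) ^ 2) := by field_simp; norm_num
        _ ≤ _ := by linarith

/-- The diagonal part of the time correlation. -/
def modeNorm (n M k : ℕ) : ℝ := ∑ z ∈ Finset.range M, (chebT z (2 * √2 / 3 * root n k) ^ 2 +
        chebT z (-(2 * √2 / 3 * root n k)) ^ 2)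

theorem modeNorm_nonneg (n M k : ℕ) : 0 ≤ modeNorm n M k :=
  Finset.sum_nonneg fun z _ => by positivity

theorem modeNorm_le (n M k : ℕ) : modeNorm n M k ≤ 2 * M := by
  have : ∀ z ∈ Finset.range M, (chebT z (2 * √2 / 3 * root n k) ^ 2 +
        chebT z (-(2 * √2 / 3 * root n k)) ^ 2) ≤ 2 := fun z _ => by
    have h1 := (sq_le_one_iff_abs_le_one _).2 (abs_chebT_le z (2 * √2 / 3 * root n k))
    have h2 := (sq_le_one_iff_abs_le_one _).2 (abs_chebT_le z (-(2 * √2 / 3 * root n k)))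
    linarith
  refine (Finset.sum_le_sum this).trans (le_of_eq ?_)
  simp [mul_comm]

theorem modeNorm_ge {n k : ℕ} (hk : 1 ≤ k) (M : ℕ) : (M : ℝ) - 1 ≤ modeNorm n M k := by
  have h1 := sum_chebT_sq_ge (mul_root_sq_le (n := n) hk) M
  have h2 := sum_chebT_sq_ge (y := -(2 * √2 / 3 * root n k))
    (by rw [neg_sq]; exact mul_root_sq_le hk) M
  rw [modeNorm, Finset.sum_add_distrib]; linarith

/-- For fixed k the cross terms summed over l are bounded by a constant: two convergent series and
one resonance term 23/n added n times. Summation over k then gives O(n), whatever the length M of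
the time window. -/
theorem exists_abs_sum_colAmp_sq_sub_le : ∃ B : ℝ, 0 < B ∧ ∀ n : ℕ, 2 ≤ n → ∀ M : ℕ,
    |∑ z ∈ Finset.range M, colAmp n z 0 ^ 2 -
      ∑ k : Fin n, rootWeight n k ^ 2 * modeNorm n M k| ≤ B * n := by
  obtain ⟨B, hB, hsum⟩ := sum_one_div_sq_le
  refine ⟨8 * (9 / 2 * B + 18 * B + 23), by positivity, fun n hn M => ?_⟩
  have hn0 : (0 : ℝ) < n := by exact_mod_cast (by omega : 0 < n)
  have e : ∑ z ∈ Finset.range M, colAmp n z 0 ^ 2 -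
      ∑ k : Fin n, rootWeight n k ^ 2 * modeNorm n M k =
      ∑ k : Fin n, ∑ l : Fin n, rootWeight n k * rootWeight n l *
        (modeCorrelation n M k l - if (k : ℕ) = l then modeNorm n M k else 0) := by
    simp only [mul_sub, Finset.sum_sub_distrib, ← sum_colAmp_sq hn]
    congr 1
    refine Finset.sum_congr rfl fun k _ => ?_
    rw [Finset.sum_eq_single k]
    · simp [sq]
    · intro l _ hl
      rw [if_neg (fun h => hl (Fin.ext h).symm), mul_zero]
    · simp
  rw [e]
  have hterm : ∀ k l : Fin n, |rootWeight n k * rootWeight n l *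
        (modeCorrelation n M k l - if (k : ℕ) = l then modeNorm n M k else 0)| ≤
      8 * (9 / 2 * (1 / ((k : ℕ) - (l : ℕ) : ℝ) ^ 2) +
        18 * (1 / ((n : ℝ) - (k : ℕ) - (l : ℕ)) ^ 2) + 23 / n) := by
    intro k l
    have hp := rootWeight_pos (n := n) (k := k) (by omega)
    have hq := rootWeight_pos (n := n) (k := l) (by omega)
    rw [abs_mul, abs_of_pos (mul_pos hp hq)]
    have h1 := abs_modeCorrelation_le hn k.2 l.2 M
    have h2 := weight_div_gap_le hn k.2 l.2
    calc _ ≤ rootWeight n k * rootWeight n l * _ := mul_le_mul_of_nonneg_left h1 (by positivity)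
      _ ≤ _ := by linarith
  calc _ ≤ ∑ k : Fin n, ∑ l : Fin n, 8 * (9 / 2 * (1 / ((k : ℕ) - (l : ℕ) : ℝ) ^ 2) +
        18 * (1 / ((n : ℝ) - (k : ℕ) - (l : ℕ)) ^ 2) + 23 / n) :=
        (Finset.abs_sum_le_sum_abs _ _).trans (Finset.sum_le_sum fun k _ =>
          (Finset.abs_sum_le_sum_abs _ _).trans (Finset.sum_le_sum fun l _ => hterm k l))
    _ ≤ ∑ k : Fin n, 8 * (9 / 2 * B + 18 * B + 23) := by
        refine Finset.sum_le_sum fun k _ => ?_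
        rw [← Finset.mul_sum, Finset.sum_add_distrib, Finset.sum_add_distrib, ← Finset.mul_sum,
          ← Finset.mul_sum]
        have h1 := hsum n ((k : ℕ) : ℤ)
        have h2 := hsum n ((n : ℤ) - ((k : ℕ) : ℤ))
        push_cast at h1 h2
        have h3 : ∑ _l : Fin n, 23 / (n : ℝ) = 23 := by
          simp; field_simp
        rw [h3]
        linarith
    _ = _ := by simp; ring

theorem exists_walkAverage_bounds : ∃ C : ℝ, 0 < C ∧ ∀ n : ℕ, 2 ≤ n → ∀ M : ℕ,
    3 * Real.pi / hopGap n ≤ M →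
      3 / (32 * (n : ℝ)) - C / (n : ℝ) ^ 2 ≤ walkAverage n M ∧ walkAverage n M ≤ C / n := by
  obtain ⟨B, hB, hdiff⟩ := exists_abs_sum_colAmp_sq_sub_le
  refine ⟨100 * B + 100, by positivity, fun n hn M hM => ?_⟩
  have hn0 : (0 : ℝ) < n := by exact_mod_cast (by omega : 0 < n)
  have hn1 : (1 : ℝ) ≤ n := by exact_mod_cast (by omega : 1 ≤ n)
  -- The only use of the size of the register: it makes the error B n / M of order n⁻².
  have hMn : (n : ℝ) ^ 3 / 100 ≤ M := by
    refine le_trans ?_ hM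
    have h1 := (hopGap_le hn).1
    have h0 := hopGap_pos hn
    rw [le_div_iff₀ h0]
    have : (n : ℝ) ^ 3 / 100 * (600 / (n : ℝ) ^ 3) = 6 := by field_simp; norm_num
    nlinarith [Real.pi_gt_three, mul_le_mul_of_nonneg_left h1 (by positivity : 0 ≤ (n : ℝ) ^ 3 / 100)]
  have hM0 : (0 : ℝ) < M := lt_of_lt_of_le (by positivity) hMn
  have hM1 : (1 : ℝ) ≤ M := by
    have : 0 < M := by exact_mod_cast hM0
    exact_mod_cast this
  have hd := abs_le.1 (hdiff n hn M)
  have hsumw := sum_rootWeight hn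
  have hinv : (n : ℝ) / M ≤ 100 / n ^ 2 := by
    rw [div_le_div_iff₀ hM0 (by positivity)]; nlinarith
  have hB2 : B * n / M ≤ 100 * B / n ^ 2 := by
    calc B * n / M = B * (n / M) := by ring
      _ ≤ B * (100 / n ^ 2) := by gcongr
      _ = _ := by ring
  constructor
  · have hlow : ((M : ℝ) - 1) * (1 / (4 * n) - 1 / (4 * n ^ 2)) ≤
        ∑ k : Fin n, rootWeight n k ^ 2 * modeNorm n M k := by
      have h1 : ∀ k : Fin n, ((M : ℝ) - 1) * (rootWeight n k / n - 1 / (4 * n ^ 2)) -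
          (if (k : ℕ) = 0 then ((M : ℝ) - 1) * (1 / (4 * n ^ 2)) else 0) ≤
          rootWeight n k ^ 2 * modeNorm n M k := by
        intro k
        -- The square lies above its tangent at 1/(2n). Summed with total weight 1/2, this is the
        -- Cauchy–Schwarz bound Σ p_k² ≥ 1/(4n).
        have hsq : rootWeight n k / n - 1 / (4 * n ^ 2) ≤ rootWeight n k ^ 2 := by
          have := sq_nonneg (rootWeight n k - 1 / (2 * n))
          have e : (rootWeight n k - 1 / (2 * n)) ^ 2 =
            rootWeight n k ^ 2 - (rootWeight n k / n - 1 / (4 * n ^ 2)) := by field_simp; ring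
          linarith
        -- The edge mode has no lower bound on its norm and is discarded. Its tangent value is at
        -- most 1/(4n²) because p_0 ≤ 1/(2n).
        split_ifs with hk
        · have h2 := modeNorm_nonneg n M k
          have h3 : rootWeight n k / n - 1 / (4 * n ^ 2) - 1 / (4 * n ^ 2) ≤ 0 := by
            have := rootWeight_zero_le (n := n) (by omega)
            rw [hk]
            have e : 1 / (2 * (n : ℝ)) / n = 1 / (4 * n ^ 2) + 1 / (4 * n ^ 2) := by
              field_simp; norm_num
            have := div_le_div_of_nonneg_right this hn0.le
            linarith
          have h4 : 0 ≤ rootWeight n k ^ 2 * modeNorm n M k := mul_nonneg (sq_nonneg _) h2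
          nlinarith
        · have h2 := modeNorm_ge (n := n) (k := k) (by omega) M
          rw [sub_zero]
          calc ((M : ℝ) - 1) * (rootWeight n k / n - 1 / (4 * n ^ 2)) ≤
              ((M : ℝ) - 1) * rootWeight n k ^ 2 := by gcongr
            _ ≤ _ := by rw [mul_comm]; gcongr
      refine le_trans (le_of_eq ?_) (Finset.sum_le_sum fun k _ => h1 k)
      rw [Finset.sum_sub_distrib, ← Finset.mul_sum, Finset.sum_sub_distrib, ← Finset.sum_div, hsumw]
      have : ∑ k : Fin n, (if (k : ℕ) = 0 then ((M : ℝ) - 1) * (1 / (4 * (n : ℝ) ^ 2)) else 0) =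
          ((M : ℝ) - 1) * (1 / (4 * (n : ℝ) ^ 2)) := by
        rw [Finset.sum_eq_single ⟨0, by omega⟩]
        · simp
        · intro k _ hk
          rw [if_neg (fun h => hk (Fin.ext h))]
        · simp
      rw [this]
      simp only [Finset.sum_const, Finset.card_univ, Fintype.card_fin, nsmul_eq_mul]
      field_simp; ring
    have h2 : ((M : ℝ) - 1) * (1 / (4 * n) - 1 / (4 * n ^ 2)) - B * n ≤
        ∑ z ∈ Finset.range M, colAmp n z 0 ^ 2 := by linarith
    have h3 := div_le_div_of_nonneg_right h2 hM0.le
    refine le_trans ?_ h3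
    have e : (((M : ℝ) - 1) * (1 / (4 * n) - 1 / (4 * n ^ 2)) - B * n) / M =
        1 / (4 * n) - 1 / (4 * n ^ 2) - (1 / (4 * n) - 1 / (4 * n ^ 2)) / M - B * n / M := by
      field_simp
    rw [e]
    have h4 : (1 / (4 * (n : ℝ)) - 1 / (4 * n ^ 2)) / M ≤ 25 / n ^ 2 := by
      calc (1 / (4 * (n : ℝ)) - 1 / (4 * n ^ 2)) / M ≤ (n / 4) / M := by
            gcongr
            have : 0 ≤ 1 / (4 * (n : ℝ) ^ 2) := by positivity
            have : 1 / (4 * (n : ℝ)) ≤ n / 4 := by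
              rw [div_le_div_iff₀ (by positivity) (by norm_num)]; nlinarith
            linarith
        _ = (n / M) / 4 := by ring
        _ ≤ (100 / n ^ 2) / 4 := by gcongr
        _ = _ := by ring
    have h5 : 3 / (32 * (n : ℝ)) ≤ 1 / (4 * n) := by
      rw [div_le_div_iff₀ (by positivity) (by positivity)]; nlinarith
    have h6 : (100 * B + 100) / (n : ℝ) ^ 2 = 100 * B / n ^ 2 + 25 / n ^ 2 + 1 / (4 * n ^ 2) +
        (75 - 1 / 4) / n ^ 2 := by field_simp; ring
    have h7 : (0 : ℝ) ≤ (75 - 1 / 4) / n ^ 2 := by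
      apply div_nonneg _ (by positivity); norm_num
    linarith
  · have hup : ∑ k : Fin n, rootWeight n k ^ 2 * modeNorm n M k ≤ 3 / (2 * n) * M := by
      calc _ ≤ ∑ k : Fin n, rootWeight n k * (3 / (2 * n) * (2 * M)) := by
            refine Finset.sum_le_sum fun k _ => ?_
            have hp := rootWeight_pos (n := n) (k := k) (by omega)
            rw [sq, mul_assoc]
            have := rootWeight_le k.2
            have := modeNorm_le n M k
            have := modeNorm_nonneg n M k
            gcongr
        _ = _ := by rw [← Finset.sum_mul, hsumw]; ring
    have h2 : ∑ z ∈ Finset.range M, colAmp n z 0 ^ 2 ≤ 3 / (2 * n) * M + B * n := by linarith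
    have h3 := div_le_div_of_nonneg_right h2 hM0.le
    refine le_trans h3 ?_
    rw [add_div, mul_div_cancel_right₀ _ hM0.ne']
    have h4 : 100 * B / (n : ℝ) ^ 2 ≤ 100 * B / n := by
      gcongr; nlinarith
    have h5 : (100 * B + 100) / (n : ℝ) = 100 * B / n + 3 / (2 * n) + 98.5 / n := by
      field_simp; ring
    have h6 : (0 : ℝ) ≤ 98.5 / n := by positivity
    linarith

/-! ### Neighbours and columns -/

namespace GluedTrees

variable {n : ℕ}

theorem log_lt (i : TreeNode n) : Nat.log 2 (i : ℕ) < n := by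
  have h := Finset.mem_Ico.1 i.2
  exact Nat.log_lt_of_lt_pow (by omega) h.2

theorem isLeaf_iff (i : TreeNode n) : IsLeaf i ↔ Nat.log 2 (i : ℕ) + 1 = n := by
  have h := Finset.mem_Ico.1 i.2
  have hl := log_lt i
  unfold IsLeaf
  rw [← Nat.le_log_iff_pow_le (by norm_num) (by omega)]
  omega

/-- In heap numbering the neighbours of a are a/2, 2a and 2a + 1. The range starting at 1 removes
the parent 0 of the root, and the bound 2^n removes the children of leaves, always both at once. -/
theorem sum_treeNeighbours (i : TreeNode n) (f : ℕ → ℝ) :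
    (∑ j : TreeNode n, if (i : ℕ) / 2 = j ∨ (j : ℕ) / 2 = i then f (Nat.log 2 j) else 0) =
      (if 1 ≤ Nat.log 2 (i : ℕ) then f (Nat.log 2 i - 1) else 0) +
        (if Nat.log 2 (i : ℕ) + 1 < n then 2 * f (Nat.log 2 i + 1) else 0) := by
  obtain ⟨h1, h2⟩ := Finset.mem_Ico.1 i.2
  rw [Finset.sum_coe_sort (Finset.Ico 1 (2 ^ n))
    (fun j => if (i : ℕ) / 2 = j ∨ j / 2 = (i : ℕ) then f (Nat.log 2 j) else 0)]
  set a := (i : ℕ)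
  have e : ∀ j ∈ Finset.Ico 1 (2 ^ n), (if a / 2 = j ∨ j / 2 = a then f (Nat.log 2 j) else 0) =
      (if a / 2 = j then f (Nat.log 2 j) else 0) +
        ((if j = 2 * a then f (Nat.log 2 j) else 0) +
          (if j = 2 * a + 1 then f (Nat.log 2 j) else 0)) := by
    intro j _
    by_cases c1 : a / 2 = j
    · rw [if_pos (Or.inl c1), if_pos c1, if_neg (by omega), if_neg (by omega)]; ring
    · by_cases c2 : j = 2 * a
      · rw [if_pos (by omega), if_neg c1, if_pos c2, if_neg (by omega)]; ring
      · by_cases c3 : j = 2 * a + 1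
        · rw [if_pos (by omega), if_neg c1, if_neg c2, if_pos c3]; ring
        · rw [if_neg (by omega), if_neg c1, if_neg c2, if_neg c3]; ring
  rw [Finset.sum_congr rfl e, Finset.sum_add_distrib, Finset.sum_add_distrib, Finset.sum_ite_eq,
    Finset.sum_ite_eq', Finset.sum_ite_eq']
  simp only [Finset.mem_Ico]
  congr 1
  · rw [Nat.log_div_base]
    have : 1 ≤ Nat.log 2 a ↔ 2 ≤ a := by
      rw [Nat.le_log_iff_pow_le (by norm_num) (by omega), pow_one]
    by_cases h : 2 ≤ a
    · rw [if_pos (by omega), if_pos (this.2 h)]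
    · rw [if_neg (by omega), if_neg (fun h' => h (this.1 h'))]
  · have l1 : Nat.log 2 (2 * a) = Nat.log 2 a + 1 := by
      rw [mul_comm]; exact Nat.log_mul_base (by norm_num) (by omega)
    have l2 : Nat.log 2 (2 * a + 1) = Nat.log 2 a + 1 := by
      have := Nat.log_div_base 2 (2 * a + 1)
      rw [show (2 * a + 1) / 2 = a by omega] at this
      have h3 : 1 ≤ Nat.log 2 (2 * a + 1) := by
        rw [Nat.le_log_iff_pow_le (by norm_num) (by omega)]; omega
      omega
    rw [l1, l2]
    have : Nat.log 2 a + 1 < n ↔ 2 * a + 1 < 2 ^ n := by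
      obtain ⟨N, rfl⟩ : ∃ N, n = N + 1 := ⟨n - 1, by have := log_lt i; omega⟩
      rw [Nat.add_lt_add_iff_right, Nat.log_lt_iff_lt_pow (by norm_num) (by omega), pow_succ]
      omega
    by_cases h : 2 * a + 1 < 2 ^ n
    · rw [if_pos (by omega), if_pos (by omega), if_pos (this.2 h)]; ring
    · have h' : ¬ 2 * a < 2 ^ n := by
        obtain ⟨N, rfl⟩ : ∃ N, n = N + 1 := ⟨n - 1, by have := log_lt i; omega⟩
        rw [pow_succ] at h ⊢; omega
      rw [if_neg (by omega), if_neg (by omega), if_neg (fun h'' => h (this.1 h''))]; ring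

open Classical in
theorem sum_glued {i : TreeNode n} {R : TreeNode n → Prop} (hR : ∀ j, R j → IsLeaf i ∧ IsLeaf j)
    (hcard : IsLeaf i → {j | R j}.ncard = 2) (f : ℕ → ℝ) :
    (∑ j : TreeNode n, if R j then f (Nat.log 2 j) else 0) =
      if Nat.log 2 (i : ℕ) + 1 = n then 2 * f (n - 1) else 0 := by
  have e : ∀ j : TreeNode n, (if R j then f (Nat.log 2 j) else 0) = if R j then f (n - 1) else 0 := by
    intro j
    split_ifs with h
    · have := (isLeaf_iff j).1 (hR j h).2
      congr 1; omega
    · rfl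
  simp only [e]
  split_ifs with h
  · have h2 := hcard ((isLeaf_iff i).2 h)
    rw [← Finset.sum_filter, Finset.sum_const, nsmul_eq_mul]
    rw [Set.ncard_eq_toFinset_card'] at h2
    have : (Finset.univ.filter fun j => R j).card = 2 := by
      refine Eq.trans ?_ h2
      congr 1; ext j; simp
    rw [this]; norm_num
  · refine Finset.sum_eq_zero fun j _ => ?_
    rw [if_neg]
    intro hj
    exact h ((isLeaf_iff i).1 (hR j hj).1)

open Classical in
-- The columns form an equitable partition: every vertex has two neighbours in the adjacent column
-- on the side away from its own root, and one on the root's side unless it is the root. The gluing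
-- only enters through its degree, so all later quantities depend on n alone.
theorem sum_neighbours (G : GluedTrees n) (x : Vertex n) (g : ℕ → ℝ) :
    (∑ y : Vertex n, if G.graph.Adj x y then g (column y) else 0) =
      if column x < n then 2 * g (column x + 1) + (if 1 ≤ column x then g (column x - 1) else 0)
      else 2 * g (column x - 1) + (if column x + 1 < 2 * n then g (column x + 1) else 0) := by
  obtain ⟨s, i⟩ := x
  have hl := log_lt i
  have hadj : ∀ t j, G.graph.Adj (s, i) (t, j) ↔
      (s = t ∧ ((i : ℕ) / 2 = j ∨ (j : ℕ) / 2 = i)) ∨ (s = 0 ∧ t = 1 ∧ G.glue i j) ∨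
        (s = 1 ∧ t = 0 ∧ G.glue j i) := fun t j => Iff.rfl
  simp only [hadj, Fintype.sum_prod_type, Fin.sum_univ_two, column]
  fin_cases s
  · have ht := sum_treeNeighbours i g
    have hg := sum_glued (R := fun j => G.glue i j) (fun j hj => G.isLeaf_of_glue i j hj)
      (G.glue_left i) (fun d => g (2 * n - 1 - d))
    simp at ht hg ⊢
    rw [ht, hg, if_pos hl]
    by_cases h : Nat.log 2 (i : ℕ) + 1 = n
    · have h' : ¬ Nat.log 2 (i : ℕ) + 1 < n := by omega
      have e : 2 * n - 1 - (n - 1) = Nat.log 2 (i : ℕ) + 1 := by omega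
      rw [if_pos h, if_neg h', e]; ring
    · have h' : Nat.log 2 (i : ℕ) + 1 < n := by omega
      rw [if_neg h, if_pos h']; ring
  · have ht := sum_treeNeighbours i (fun d => g (2 * n - 1 - d))
    have hg := sum_glued (i := i) (R := fun j => G.glue j i)
      (fun j hj => (G.isLeaf_of_glue j i hj).symm) (G.glue_right i) g
    simp at ht hg ⊢
    have h0 : ¬ 2 * n - 1 - Nat.log 2 (i : ℕ) < n := by omega
    rw [ht, hg, if_neg h0]
    have e1 : 2 * n - 1 - (Nat.log 2 (i : ℕ) + 1) = 2 * n - 1 - Nat.log 2 (i : ℕ) - 1 := by omega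
    have e2 : (if 1 ≤ Nat.log 2 (i : ℕ) then g (2 * n - 1 - (Nat.log 2 (i : ℕ) - 1)) else 0) =
        if 2 * n - 1 - Nat.log 2 (i : ℕ) + 1 < 2 * n then g (2 * n - 1 - Nat.log 2 (i : ℕ) + 1)
        else 0 := by
      by_cases h : 1 ≤ Nat.log 2 (i : ℕ)
      · have h' : 2 * n - 1 - Nat.log 2 (i : ℕ) + 1 < 2 * n := by omega
        rw [if_pos h, if_pos h']; congr 1; omega
      · have h' : ¬ 2 * n - 1 - Nat.log 2 (i : ℕ) + 1 < 2 * n := by omega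
        rw [if_neg h, if_neg h']
    rw [e1, e2]
    by_cases h : Nat.log 2 (i : ℕ) + 1 = n
    · have h' : ¬ Nat.log 2 (i : ℕ) + 1 < n := by omega
      have e : n - 1 = 2 * n - 1 - Nat.log 2 (i : ℕ) - 1 := by omega
      rw [if_pos h, if_neg h', e]; ring
    · have h' : Nat.log 2 (i : ℕ) + 1 < n := by omega
      rw [if_neg h, if_pos h']; ring

/-- The binary logarithm of the number of vertices in column `c`. -/
def colDepth (n c : ℕ) : ℕ := if c < n then c else 2 * n - 1 - c

/-- The amplitude of the column state at each vertex of column `c`. -/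
def colNorm (n c : ℕ) : ℝ := 1 / √(2 ^ colDepth n c)

theorem column_lt (x : Vertex n) : column x < 2 * n := by
  have := log_lt x.2
  unfold column; split_ifs <;> omega

theorem colNorm_succ_left {c : ℕ} (hc : c + 1 < n) : colNorm n c = √2 * colNorm n (c + 1) := by
  unfold colNorm colDepth
  rw [if_pos (by omega), if_pos hc, pow_succ, Real.sqrt_mul (by positivity)]
  field_simp

theorem colNorm_middle (hn : 1 ≤ n) : colNorm n (n - 1) = colNorm n n := by
  unfold colNorm colDepth
  rw [if_pos (by omega), if_neg (by omega), show 2 * n - 1 - n = n - 1 by omega]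

theorem colNorm_succ_right {c : ℕ} (hc : n ≤ c) (hc' : c + 1 < 2 * n) :
    colNorm n (c + 1) = √2 * colNorm n c := by
  unfold colNorm colDepth
  rw [if_neg (by omega), if_neg (by omega),
    show 2 * n - 1 - c = 2 * n - 1 - (c + 1) + 1 by omega, pow_succ, Real.sqrt_mul (by positivity)]
  field_simp

open Classical in
/-- The adjacency matrix acts on the column subspace by `colHop`. -/
theorem sum_neighbours_colNorm (G : GluedTrees n) (x : Vertex n) (v : ℕ → ℝ) :
    (∑ y : Vertex n, if G.graph.Adj x y then colNorm n (column y) * v (column y) else 0) =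
      colNorm n (column x) * (colHop n *ᵥ fun c => v c) ⟨column x, column_lt x⟩ := by
  have hc := column_lt x
  have hs2 : √2 * √2 = 2 := Real.mul_self_sqrt (by norm_num)
  rw [sum_neighbours G x (fun c => colNorm n c * v c), colHop_mulVec]
  simp only
  set c := column x
  by_cases h : c < n
  · rw [if_pos h, if_pos (show c + 1 < 2 * n by omega), mul_add]
    congr 1
    · by_cases h1 : c + 1 = n
      · have := colNorm_middle (n := n) (by omega)
        rw [show n - 1 = c by omega] at this
        rw [hop, if_pos h1, h1, ← this]; ring
      · rw [hop, if_neg h1, colNorm_succ_left (by omega : c + 1 < n)]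
        linear_combination (-colNorm n (c + 1) * v (c + 1)) * hs2
    · split_ifs with h1
      · have := colNorm_succ_left (n := n) (c := c - 1) (by omega)
        rw [show c - 1 + 1 = c by omega] at this
        rw [hop, if_neg (by omega), this]; ring
      · ring
  · rw [if_neg h, mul_add, add_comm]
    congr 1
    · split_ifs with h1
      · rw [hop, if_neg (by omega), colNorm_succ_right (by omega) h1]; ring
      · ring
    · rw [if_pos (show 1 ≤ c by omega)]
      by_cases h1 : c = n
      · have := colNorm_middle (n := n) (by omega)
        rw [hop, h1, if_pos (by omega), this]; ring
      · have := colNorm_succ_right (n := n) (c := c - 1) (by omega) (by omega)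
        rw [show c - 1 + 1 = c by omega] at this
        rw [hop, if_neg (by omega), this]
        linear_combination (-colNorm n (c - 1) * v (c - 1)) * hs2

theorem card_log_eq {L : ℕ} (hL : L < n) :
    ∑ i : TreeNode n, (if Nat.log 2 (i : ℕ) = L then (1 : ℝ) else 0) = 2 ^ L := by
  rw [Finset.sum_coe_sort (Finset.Ico 1 (2 ^ n)) (fun j => if Nat.log 2 j = L then (1 : ℝ) else 0),
    Finset.sum_boole]
  have : (Finset.Ico 1 (2 ^ n)).filter (fun j => Nat.log 2 j = L) = Finset.Ico (2 ^ L) (2 ^ (L + 1)) := by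
    ext j
    simp only [Finset.mem_filter, Finset.mem_Ico]
    constructor
    · rintro ⟨⟨h1, h2⟩, h3⟩
      exact (Nat.log_eq_iff (Or.inr ⟨by norm_num, by omega⟩)).1 h3
    · rintro ⟨h1, h2⟩
      have h3 := Nat.one_le_two_pow (n := L)
      have h4 : 2 ^ (L + 1) ≤ 2 ^ n := Nat.pow_le_pow_right (by norm_num) hL
      exact ⟨⟨by omega, by omega⟩, (Nat.log_eq_iff (Or.inr ⟨by norm_num, by omega⟩)).2 ⟨h1, h2⟩⟩
  rw [this, Nat.card_Ico, pow_succ, mul_two, Nat.add_sub_cancel]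
  push_cast; rfl

theorem sum_column_eq {c : ℕ} (hc : c < 2 * n) :
    ∑ x : Vertex n, (if column x = c then (1 : ℝ) else 0) = 2 ^ colDepth n c := by
  simp only [Fintype.sum_prod_type, Fin.sum_univ_two, column, colDepth]
  have zero : ∀ p : TreeNode n → Prop, (∀ i, ¬ p i) → ∀ _ : DecidablePred p,
      ∑ i : TreeNode n, (if p i then (1 : ℝ) else 0) = 0 := fun p hp _ =>
    Finset.sum_eq_zero fun i _ => if_neg (hp i)
  by_cases h : c < n
  · rw [if_pos h, ← card_log_eq h]
    simp only [if_true, one_ne_zero, if_false]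
    rw [zero (fun i => 2 * n - 1 - Nat.log 2 (i : ℕ) = c)
      (fun i hi => by have := log_lt i; omega), add_zero]
  · rw [if_neg h, ← card_log_eq (by omega : 2 * n - 1 - c < n)]
    simp only [if_true, one_ne_zero, if_false]
    rw [zero (fun i => Nat.log 2 (i : ℕ) = c) (fun i hi => by have := log_lt i; omega), zero_add]
    refine Finset.sum_congr rfl fun i _ => ?_
    have := log_lt i
    congr 1
    apply propext
    omega

theorem colState_eq (j : Fin (2 * n)) (x : Vertex n) :
    colState j x = colNorm n (column x) * if column x = j then 1 else 0 := by
  unfold colState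
  split_ifs with h h' <;> simp [colNorm, colDepth, *]

theorem colMatrix_eq (G : GluedTrees n) : G.colMatrix = colHop n := by
  classical
  ext i j
  have key : ∀ x, (G.graph.adjMatrix ℝ *ᵥ colState j) x =
      colNorm n (column x) * colHop n ⟨column x, column_lt x⟩ j := by
    intro x
    have h := sum_neighbours_colNorm G x (fun c => if c = j then 1 else 0)
    simp only [Matrix.mulVec, dotProduct, SimpleGraph.adjMatrix_apply, colState_eq, ite_mul, one_mul,
      zero_mul]
    simp only [Matrix.mulVec, dotProduct] at h
    rw [h]
    congr 1
    rw [Finset.sum_eq_single j]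
    · simp
    · intro k _ hk
      rw [if_neg (fun h => hk (Fin.ext h)), mul_zero]
    · simp
  have hcm : G.colMatrix i j = ∑ x, colState i x * (G.graph.adjMatrix ℝ *ᵥ colState j) x := by
    unfold colMatrix
    simp only [Matrix.of_apply, dotProduct]
  rw [hcm]
  have : ∀ x : Vertex n, colState i x * (G.graph.adjMatrix ℝ *ᵥ colState j) x =
      (if column x = i then 1 else 0) * (colNorm n i ^ 2 * colHop n i j) := by
    intro x
    rw [key, colState_eq]
    split_ifs with h
    · have e : (⟨column x, column_lt x⟩ : Fin (2 * n)) = i := Fin.ext h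
      rw [e, h]; ring
    · ring
  simp only [this]
  rw [← Finset.sum_mul, sum_column_eq i.2, ← mul_assoc, colNorm, div_pow, one_pow,
    Real.sq_sqrt (by positivity), mul_one_div_cancel (by positivity), one_mul]

theorem colGap_eq (G : GluedTrees n) : G.colGap = hopGap n := by
  rw [colGap, hopGap, colMatrix_eq]

/-! ### Roots and degrees -/

theorem one_mem (hn : 1 ≤ n) : 1 ∈ Finset.Ico 1 (2 ^ n) := by
  have := Nat.pow_le_pow_right (by norm_num : 0 < 2) hn
  simp only [Finset.mem_Ico]; omega

theorem rootLabel_eq (G : GluedTrees n) (hn : 1 ≤ n) (s : Fin 2) :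
    G.rootLabel s = G.label (s, ⟨1, one_mem hn⟩) := by
  rw [rootLabel, dif_pos (one_mem hn)]

theorem log_eq_zero_iff (hn : 1 ≤ n) (i : TreeNode n) :
    Nat.log 2 (i : ℕ) = 0 ↔ i = ⟨1, one_mem hn⟩ := by
  have := Finset.mem_Ico.1 i.2
  rw [Nat.log_eq_zero_iff, Subtype.ext_iff]
  simp only
  omega

theorem column_eq_last_iff (hn : 1 ≤ n) (x : Vertex n) :
    column x = 2 * n - 1 ↔ x = (1, ⟨1, one_mem hn⟩) := by
  obtain ⟨s, i⟩ := x
  have := log_lt i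
  have h := log_eq_zero_iff hn i
  rw [Prod.ext_iff]
  simp only [← h, column]
  by_cases hs : s = 0
  · subst hs
    rw [if_pos rfl]
    refine ⟨fun h => by omega, fun h => absurd h.1 (by decide)⟩
  · have hs1 : s = 1 := by omega
    rw [if_neg hs]
    simp only [hs1, true_and]
    omega

theorem column_eq_zero_iff (hn : 1 ≤ n) (x : Vertex n) :
    column x = 0 ↔ x = (0, ⟨1, one_mem hn⟩) := by
  obtain ⟨s, i⟩ := x
  have := log_lt i
  have h := log_eq_zero_iff hn i
  rw [Prod.ext_iff]
  simp only [← h, column]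
  fin_cases s
  · simp
  · simp; omega

theorem labelled_adj (G : GluedTrees n) (x y : Vertex n) :
    G.labelled.Adj (G.label x) (G.label y) ↔ G.graph.Adj x y :=
  SimpleGraph.map_adj_apply

theorem exists_of_labelled_adj (G : GluedTrees n) {u v : Bits (n + 1)} (h : G.labelled.Adj u v) :
    ∃ x, G.label x = u := by
  rw [labelled, SimpleGraph.map_adj] at h
  obtain ⟨x, y, _, h, _⟩ := h
  exact ⟨x, h⟩

theorem deg_label (G : GluedTrees n) (x : Vertex n) :
    G.deg (G.label x) = if column x = 0 ∨ column x + 1 = 2 * n then 2 else 3 := by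
  classical
  have h := sum_neighbours G x (fun _ => 1)
  have e : G.labelled.neighborSet (G.label x) = G.label '' (G.graph.neighborSet x) := by
    ext u
    simp only [SimpleGraph.mem_neighborSet, Set.mem_image]
    constructor
    · intro h
      obtain ⟨y, rfl⟩ := G.exists_of_labelled_adj h.symm
      exact ⟨y, (G.labelled_adj x y).1 h, rfl⟩
    · rintro ⟨y, hy, rfl⟩
      exact (G.labelled_adj x y).2 hy
  have h2 : ((G.deg (G.label x) : ℕ) : ℝ) = ∑ y : Vertex n, if G.graph.Adj x y then 1 else 0 := by
    rw [deg, e, Set.ncard_image_of_injective _ G.label.injective, Finset.sum_boole,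
      Set.ncard_eq_toFinset_card']
    congr 2
    ext y; simp
  have hc := column_lt x
  have h3 : ((G.deg (G.label x) : ℕ) : ℝ) =
      ((if column x = 0 ∨ column x + 1 = 2 * n then 2 else 3 : ℕ) : ℝ) := by
    rw [h2, h]
    by_cases c1 : column x < n
    · rw [if_pos c1]
      by_cases c2 : 1 ≤ column x
      · rw [if_pos c2, if_neg (by omega)]; norm_num
      · rw [if_neg c2, if_pos (by omega)]; norm_num
    · rw [if_neg c1]
      by_cases c2 : column x + 1 < 2 * n
      · rw [if_pos c2, if_neg (by omega)]; norm_num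
      · rw [if_neg c2, if_pos (by omega)]; norm_num
  exact_mod_cast h3

/-- Names in use have degree 2 or 3, unused names have degree 0. The degree test therefore
recognizes the EXIT without any knowledge of its name. -/
theorem deg_eq_two_iff (G : GluedTrees n) (hn : 1 ≤ n) (u : Bits (n + 1)) :
    G.deg u = 2 ↔ u = G.entrance ∨ u = G.exit := by
  rw [entrance, exit, rootLabel_eq G hn, rootLabel_eq G hn]
  by_cases hu : ∃ x, G.label x = u
  · obtain ⟨x, rfl⟩ := hu
    rw [deg_label, G.label.injective.eq_iff, G.label.injective.eq_iff, ← column_eq_zero_iff hn,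
      ← column_eq_last_iff hn]
    have := column_lt x
    split_ifs with h
    · simp; omega
    · simp; omega
  · have h0 : G.deg u = 0 := by
      rw [deg, Set.ncard_eq_zero]
      ext v
      simp only [SimpleGraph.mem_neighborSet, Set.mem_empty_iff_false, iff_false]
      exact fun h => hu (G.exists_of_labelled_adj h)
    rw [h0]
    constructor
    · intro h; omega
    · rintro (rfl | rfl) <;> exact absurd ⟨_, rfl⟩ hu

theorem exit_ne_entrance (G : GluedTrees n) (hn : 1 ≤ n) : G.exit ≠ G.entrance := by
  rw [entrance, exit, rootLabel_eq G hn, rootLabel_eq G hn]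
  intro h
  have := G.label.injective h
  simp at this

/-! ### The Chebyshev recursion on the graph -/

theorem sum_adj_mul (G : GluedTrees n) (x : Vertex n) (r : Bits (n + 1) → ℂ) (v : ℕ → ℝ)
    (hr : ∀ y, r (G.label y) = ((colNorm n (column y) * v (column y) : ℝ) : ℂ)) :
    ∑ w, G.adj w (G.label x) * r w =
      ((colNorm n (column x) * (colHop n *ᵥ fun c => v c) ⟨column x, column_lt x⟩ : ℝ) : ℂ) := by
  classical
  rw [← sum_neighbours_colNorm G x v, Complex.ofReal_sum]
  symm
  refine Fintype.sum_of_injective G.label G.label.injective _ _ (fun w hw => ?_) (fun y => ?_)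
  · rw [adj, SimpleGraph.adjMatrix_apply, if_neg, zero_mul]
    intro h
    exact hw (G.exists_of_labelled_adj h)
  · rw [adj, SimpleGraph.adjMatrix_apply, hr, G.graph.adj_comm]
    by_cases h : G.graph.Adj y x
    · rw [if_pos h, if_pos ((G.labelled_adj y x).2 h), one_mul]
    · rw [if_neg h, if_neg (fun h' => h ((G.labelled_adj y x).1 h')), zero_mul, Complex.ofReal_zero]

/-- A sequence of rows that satisfies the Chebyshev recursion for `A / 3` and starts at the EXIT is
given by `colAmp`. -/
theorem chebyshevRow_label (G : GluedTrees n) (hn : 2 ≤ n) (r : ℕ → Bits (n + 1) → ℂ)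
    (h0 : ∀ u, r 0 u = if u = G.exit then 1 else 0)
    (h1 : ∀ u, r 1 u = ∑ w, ((1 / 3 : ℝ) : ℂ) * G.adj w u * r 0 w)
    (h2 : ∀ z u, r (z + 2) u = 2 * ∑ w, ((1 / 3 : ℝ) : ℂ) * G.adj w u * r (z + 1) w - r z u)
    (z : ℕ) : ∀ x, r z (G.label x) = ((colNorm n (column x) * colAmp n z (column x) : ℝ) : ℂ) := by
  have hsum : ∀ z x, ∑ w, ((1 / 3 : ℝ) : ℂ) * G.adj w (G.label x) * r z w =
      ((1 / 3 : ℝ) : ℂ) * ∑ w, G.adj w (G.label x) * r z w := fun z x => by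
    rw [Finset.mul_sum]; exact Finset.sum_congr rfl fun w _ => by ring
  have base : ∀ x, r 0 (G.label x) = ((colNorm n (column x) * colAmp n 0 (column x) : ℝ) : ℂ) := by
    intro x
    rw [h0, colAmp_zero hn (column_lt x), exit, rootLabel_eq G (by omega)]
    have hiff := column_eq_last_iff (by omega) x
    by_cases h : column x = 2 * n - 1
    · rw [if_pos (by rw [hiff.1 h]), if_pos h, h]
      simp [colNorm, colDepth, show ¬ 2 * n - 1 < n by omega]
    · rw [if_neg (fun h' => h (hiff.2 (G.label.injective h'))), if_neg h]
      simp
  induction z using Nat.twoStepInduction with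
  | zero => exact base
  | one =>
    intro x
    rw [h1, hsum, sum_adj_mul G x (r 0) (fun c => colAmp n 0 c) base]
    have := colAmp_one hn ⟨column x, column_lt x⟩
    simp only at this
    rw [this, ← Complex.ofReal_mul]
    congr 1; ring
  | more z ih1 ih2 =>
    intro x
    rw [h2, hsum, sum_adj_mul G x (r (z + 1)) (fun c => colAmp n (z + 1) c) ih2, ih1]
    have := colAmp_succ_succ hn z ⟨column x, column_lt x⟩
    simp only at this
    rw [this, ← Complex.ofReal_mul, show (2 : ℂ) = ((2 : ℝ) : ℂ) by norm_num, ← Complex.ofReal_mul,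
      ← Complex.ofReal_sub]
    congr 1; ring

theorem chebyshevRow_entrance (G : GluedTrees n) (hn : 2 ≤ n) (r : ℕ → Bits (n + 1) → ℂ)
    (h0 : ∀ u, r 0 u = if u = G.exit then 1 else 0)
    (h1 : ∀ u, r 1 u = ∑ w, ((1 / 3 : ℝ) : ℂ) * G.adj w u * r 0 w)
    (h2 : ∀ z u, r (z + 2) u = 2 * ∑ w, ((1 / 3 : ℝ) : ℂ) * G.adj w u * r (z + 1) w - r z u)
    (z : ℕ) : r z G.entrance = ((colAmp n z 0 : ℝ) : ℂ) := by
  rw [entrance, rootLabel_eq G (by omega), chebyshevRow_label G hn r h0 h1 h2,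
    (column_eq_zero_iff (by omega) _).2 rfl]
  simp [colNorm, colDepth, show 0 < n by omega]

end GluedTrees

/-! ### Powers of a product of two reflections -/

section Qubitization

variable {E κ : Type*} [AddCommGroup E] [Module ℂ E] [Fintype κ]
  {U R : E →ₗ[ℂ] E} {e : κ → E} {H : κ → κ → ℂ}

/-- With W = U R, W e = U e, while R U e = 2 Σ H e - U e. One more application of U, with U² = 1,
gives W² e = 2 Σ H W e - e. Only the action on the vectors e(u) is required, not a description of U
on the whole space, so the same lemma serves block-encodings and the circuit. -/
theorem pow_walk_apply_succ_succ (hU : ∀ ψ, U (U ψ) = ψ) (hR : ∀ u, R (e u) = e u)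
    (hUR : ∀ u, U (e u) + R (U (e u)) = (2 : ℂ) • ∑ v, H v u • e v) (z : ℕ) (u : κ) :
    ((U * R) ^ (z + 2)) (e u) =
      (2 : ℂ) • ∑ v, H v u • ((U * R) ^ (z + 1)) (e v) - ((U * R) ^ z) (e u) := by
  have h1 : ∀ u, (U * R) (e u) = U (e u) := fun u => by rw [Module.End.mul_apply, hR]
  have h2 : (U * R) ((U * R) (e u)) = (2 : ℂ) • ∑ v, H v u • (U * R) (e v) - e u := by
    rw [h1, Module.End.mul_apply, ← sub_eq_of_eq_add' (hUR u).symm, map_sub, hU, map_smul, map_sum]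
    simp only [map_smul, h1]
  rw [pow_add, pow_two, Module.End.mul_apply, Module.End.mul_apply, h2, map_sub, map_smul, map_sum]
  simp only [map_smul, ← Module.End.mul_apply, ← pow_succ]

/-- A functional invariant under R sees Chebyshev polynomials of the first kind: its value on W e is
half of its value on U e + R U e, which fixes the degree-one term. -/
theorem functional_pow_walk (hU : ∀ ψ, U (U ψ) = ψ) (hR : ∀ u, R (e u) = e u)
    (hUR : ∀ u, U (e u) + R (U (e u)) = (2 : ℂ) • ∑ v, H v u • e v)
    (ℓ : E →ₗ[ℂ] ℂ) (hℓ : ∀ ψ, ℓ (R ψ) = ℓ ψ) :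
    (∀ u, ℓ (((U * R) ^ 1) (e u)) = ∑ v, H v u * ℓ (((U * R) ^ 0) (e v))) ∧
    ∀ z u, ℓ (((U * R) ^ (z + 2)) (e u)) =
      2 * ∑ v, H v u * ℓ (((U * R) ^ (z + 1)) (e v)) - ℓ (((U * R) ^ z) (e u)) := by
  constructor
  · intro u
    have h := congrArg ℓ (hUR u)
    rw [map_add, hℓ, map_smul, map_sum] at h
    simp only [map_smul, smul_eq_mul] at h
    simp only [pow_one, pow_zero, Module.End.mul_apply, Module.End.one_apply, hR]
    linear_combination h / 2
  · intro z u
    rw [pow_walk_apply_succ_succ hU hR hUR, map_sub, map_smul, map_sum]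
    simp

end Qubitization

/-! ### Parseval's identity for the inverse quantum Fourier transform -/

theorem sum_exp_eq (m : ℕ) (z w : Fin (2 ^ m)) :
    ∑ x : Fin (2 ^ m), (starRingEnd ℂ) (Complex.exp (-(2 * Real.pi * Complex.I * z * x / 2 ^ m))) *
      Complex.exp (-(2 * Real.pi * Complex.I * w * x / 2 ^ m)) = if z = w then (2 : ℂ) ^ m else 0 := by
  have hM : (2 : ℂ) ^ m ≠ 0 := pow_ne_zero m two_ne_zero
  set ω := Complex.exp (2 * Real.pi * Complex.I * ((z : ℕ) - (w : ℕ) : ℂ) / 2 ^ m) with hω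
  have e : ∀ x : Fin (2 ^ m),
      (starRingEnd ℂ) (Complex.exp (-(2 * Real.pi * Complex.I * z * x / 2 ^ m))) *
      Complex.exp (-(2 * Real.pi * Complex.I * w * x / 2 ^ m)) = ω ^ (x : ℕ) := by
    intro x
    rw [← Complex.exp_conj, ← Complex.exp_add, hω, ← Complex.exp_nat_mul]
    congr 1
    have h2 : (starRingEnd ℂ) 2 = 2 := map_ofNat _ 2
    simp [h2]
    ring
  simp only [e]
  rw [Fin.sum_univ_eq_sum_range (fun x => ω ^ x) (2 ^ m)]
  split_ifs with h
  · subst h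
    simp [hω]
  · have hne : ω ≠ 1 := by
      rw [hω, Ne, Complex.exp_eq_one_iff]
      rintro ⟨k, hk⟩
      have hpi : (2 * Real.pi * Complex.I : ℂ) ≠ 0 := Complex.two_pi_I_ne_zero
      have h1 : ((z : ℕ) - (w : ℕ) : ℂ) = k * 2 ^ m := by
        field_simp at hk
        linear_combination hk
      have h2 : ((z : ℕ) : ℤ) - ((w : ℕ) : ℤ) = k * 2 ^ m := by exact_mod_cast h1
      have hz : ((z : ℕ) : ℤ) < 2 ^ m := by exact_mod_cast z.2
      have hw : ((w : ℕ) : ℤ) < 2 ^ m := by exact_mod_cast w.2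
      have hk0 : k = 0 := by
        by_contra hk0
        rcases lt_or_gt_of_ne hk0 with h' | h'
        · nlinarith
        · nlinarith
      rw [hk0, zero_mul] at h2
      exact h (Fin.ext (by omega))
    have hpow : ω ^ (2 ^ m) = 1 := by
      rw [hω, ← Complex.exp_nat_mul, Complex.exp_eq_one_iff]
      refine ⟨(z : ℕ) - (w : ℕ), ?_⟩
      push_cast
      field_simp
    rw [geom_sum_eq hne, hpow, sub_self, zero_div]

/-- The Fourier transform is unitary on the register that is summed over, so it does not affect the
distribution of the system. -/
theorem sum_norm_inverseQFT_sq {ι : Type*} [Fintype ι] [DecidableEq ι] (m : ℕ)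
    (φ : Fin (2 ^ m) → ι → ℂ) (i : ι) :
    ∑ x, ‖inverseQFT m φ x i‖ ^ 2 = ∑ z, ‖φ z i‖ ^ 2 := by
  have key : ∑ x, (starRingEnd ℂ) (inverseQFT m φ x i) * inverseQFT m φ x i =
      ∑ z, (starRingEnd ℂ) (φ z i) * φ z i := by
    have hs : ((1 / Real.sqrt (2 ^ m) : ℝ) : ℂ) * ((1 / Real.sqrt (2 ^ m) : ℝ) : ℂ) * 2 ^ m = 1 := by
      rw [← Complex.ofReal_mul, div_mul_div_comm, Real.mul_self_sqrt (by positivity)]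
      push_cast; field_simp
    set s := ((1 / Real.sqrt (2 ^ m) : ℝ) : ℂ) with hsd
    have hcs : (starRingEnd ℂ) s = s := Complex.conj_ofReal _
    unfold inverseQFT
    rw [← hsd]
    set F : Fin (2 ^ m) → Fin (2 ^ m) → ℂ :=
      fun z x => Complex.exp (-(2 * Real.pi * Complex.I * z * x / 2 ^ m)) with hF
    have e : ∀ x : Fin (2 ^ m), (starRingEnd ℂ) (s * ∑ z, F z x * φ z i) * (s * ∑ z, F z x * φ z i) =
        ∑ z, ∑ w, s * s * ((starRingEnd ℂ) (φ z i) * φ w i) * ((starRingEnd ℂ) (F z x) * F w x) := by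
      intro x
      rw [map_mul, map_sum, hcs]
      rw [show ∀ a b : ℂ, s * a * (s * b) = s * s * (a * b) from fun a b => by ring,
        Finset.sum_mul_sum, Finset.mul_sum]
      refine Finset.sum_congr rfl fun z _ => ?_
      rw [Finset.mul_sum]
      refine Finset.sum_congr rfl fun w _ => ?_
      rw [map_mul]; ring
    change ∑ x, (starRingEnd ℂ) (s * ∑ z, F z x * φ z i) * (s * ∑ z, F z x * φ z i) = _
    simp only [e]
    rw [Finset.sum_comm]
    refine Finset.sum_congr rfl fun z _ => ?_
    rw [Finset.sum_comm]
    simp only [← Finset.mul_sum]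
    have hsum : ∀ w, ∑ x, (starRingEnd ℂ) (F z x) * F w x = if z = w then (2 : ℂ) ^ m else 0 :=
      fun w => sum_exp_eq m z w
    simp only [hsum]
    simp only [mul_ite, mul_zero, Finset.sum_ite_eq, Finset.mem_univ, if_true]
    linear_combination ((starRingEnd ℂ) (φ z i) * φ z i) * hs
  have conv : ∀ a : ℂ, (starRingEnd ℂ) a * a = ((‖a‖ ^ 2 : ℝ) : ℂ) := fun a => by
    rw [mul_comm, Complex.mul_conj, Complex.normSq_eq_norm_sq]
  simp only [conv, ← Complex.ofReal_sum] at key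
  exact_mod_cast key

theorem jointProb_eq {a k : ℕ} (m : ℕ) (U : Matrix (Bits a × Bits k) (Bits a × Bits k) ℂ)
    (u v : Bits k) :
    jointProb m U u v =
      (∑ z ∈ Finset.range (2 ^ m), ‖((walkOperator U ^ z) *ᵥ ket (0, u)) (0, v)‖ ^ 2) / 2 ^ m := by
  unfold jointProb qpeState
  rw [sum_norm_inverseQFT_sq, ← Fin.sum_univ_eq_sum_range
    (fun z => ‖((walkOperator U ^ z) *ᵥ ket (0, u)) (0, v)‖ ^ 2), Finset.sum_div]
  refine Finset.sum_congr rfl fun z _ => ?_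
  rw [controlledPowers, norm_mul, mul_pow, Complex.norm_real, Real.norm_of_nonneg (by positivity),
    div_pow, Real.sq_sqrt (by positivity)]
  ring

/-! ### Walk operators of block-encodings -/

section BlockEncoding

variable {a k : ℕ}

/-- The reflection `2 Π - I`. -/
def zeroReflection (a k : ℕ) : Matrix (Bits a × Bits k) (Bits a × Bits k) ℂ :=
  (2 : ℂ) • Matrix.diagonal (fun x => if x.1 = 0 then 1 else 0) - 1

theorem zeroReflection_mulVec (ψ : Bits a × Bits k → ℂ) (x : Bits a × Bits k) :
    (zeroReflection a k *ᵥ ψ) x = if x.1 = 0 then ψ x else -ψ x := by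
  rw [zeroReflection, Matrix.sub_mulVec, Matrix.smul_mulVec, Matrix.one_mulVec, Pi.sub_apply,
    Pi.smul_apply, Matrix.mulVec_diagonal]
  split_ifs
  · simp; ring
  · simp

theorem zeroReflection_mem_unitary : zeroReflection a k ∈ Matrix.unitaryGroup (Bits a × Bits k) ℂ := by
  have h : zeroReflection a k = Matrix.diagonal (fun x => if x.1 = 0 then 1 else -1) := by
    unfold zeroReflection
    rw [← Matrix.diagonal_one, ← Matrix.diagonal_smul, Matrix.diagonal_sub]
    congr 1
    ext x
    by_cases h : x.1 = 0
    · simp [h]; norm_num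
    · simp [h]
  rw [Matrix.mem_unitaryGroup_iff, h, Matrix.star_eq_conjTranspose, Matrix.diagonal_conjTranspose,
    Matrix.diagonal_mul_diagonal, ← Matrix.diagonal_one]
  congr 1
  ext x
  by_cases h : x.1 = 0 <;> simp [h]

theorem walkOperator_mem_unitary {U : Matrix (Bits a × Bits k) (Bits a × Bits k) ℂ}
    (hU : U ∈ Matrix.unitaryGroup (Bits a × Bits k) ℂ) :
    walkOperator U ∈ Matrix.unitaryGroup (Bits a × Bits k) ℂ :=
  mul_mem hU zeroReflection_mem_unitary

theorem sum_norm_mulVec_sq {ι : Type*} [Fintype ι] [DecidableEq ι] {U : Matrix ι ι ℂ}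
    (hU : U ∈ Matrix.unitaryGroup ι ℂ) (ψ : ι → ℂ) : ∑ i, ‖(U *ᵥ ψ) i‖ ^ 2 = ∑ i, ‖ψ i‖ ^ 2 := by
  have conv : ∀ φ : ι → ℂ, star φ ⬝ᵥ φ = ((∑ i, ‖φ i‖ ^ 2 : ℝ) : ℂ) := fun φ => by
    rw [dotProduct, Complex.ofReal_sum]
    refine Finset.sum_congr rfl fun i _ => ?_
    rw [Pi.star_apply, Complex.star_def, mul_comm, Complex.mul_conj, Complex.normSq_eq_norm_sq]
  have h : star (U *ᵥ ψ) ⬝ᵥ (U *ᵥ ψ) = star ψ ⬝ᵥ ψ := by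
    rw [Matrix.star_mulVec, ← Matrix.dotProduct_mulVec, Matrix.mulVec_mulVec,
      ← Matrix.star_eq_conjTranspose, Matrix.mem_unitaryGroup_iff'.1 hU, Matrix.one_mulVec]
  rw [conv, conv] at h
  exact_mod_cast h

theorem sum_jointProb_le {U : Matrix (Bits a × Bits k) (Bits a × Bits k) ℂ}
    (hU : U ∈ Matrix.unitaryGroup (Bits a × Bits k) ℂ) (m : ℕ) (u : Bits k) :
    ∑ w, jointProb m U u w ≤ 1 := by
  simp only [jointProb_eq]
  rw [← Finset.sum_div, Finset.sum_comm, div_le_one (by positivity)]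
  have h : ∀ z ∈ Finset.range (2 ^ m),
      ∑ w, ‖((walkOperator U ^ z) *ᵥ ket (0, u)) (0, w)‖ ^ 2 ≤ 1 := by
    intro z _
    have h1 := sum_norm_mulVec_sq (pow_mem (walkOperator_mem_unitary hU) z) (ket ((0 : Bits a), u))
    have h2 : ∑ i, ‖ket ((0 : Bits a), u) i‖ ^ 2 = 1 := by
      rw [Finset.sum_eq_single (0, u)]
      · simp [ket]
      · intro i _ hi
        simp [ket, hi]
      · simp
    rw [h2, Fintype.sum_prod_type] at h1
    rw [← h1]
    exact Finset.single_le_sum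
      (f := fun c => ∑ w, ‖((walkOperator U ^ z) *ᵥ ket (0, u)) (c, w)‖ ^ 2)
      (fun c _ => Finset.sum_nonneg fun w _ => by positivity) (Finset.mem_univ 0)
  refine (Finset.sum_le_sum h).trans ?_
  simp

theorem jointProb_nonneg (m : ℕ) (U : Matrix (Bits a × Bits k) (Bits a × Bits k) ℂ) (u v : Bits k) :
    0 ≤ jointProb m U u v := Finset.sum_nonneg fun _ _ => by positivity

theorem jointProb_le_postselectedProb {U : Matrix (Bits a × Bits k) (Bits a × Bits k) ℂ}
    (hU : U ∈ Matrix.unitaryGroup (Bits a × Bits k) ℂ) (m : ℕ) (u v : Bits k) :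
    jointProb m U u v ≤ postselectedProb m U u v := by
  have h1 := sum_jointProb_le hU m u
  have h2 : jointProb m U u v ≤ ∑ w, jointProb m U u w :=
    Finset.single_le_sum (fun w _ => jointProb_nonneg m U u w) (Finset.mem_univ v)
  have h0 := jointProb_nonneg m U u v
  unfold postselectedProb
  rcases h0.eq_or_lt with h | h
  · rw [← h, zero_div]
  · rw [le_div_iff₀ (h.trans_le h2)]
    nlinarith

theorem ket_apply {ι : Type*} [DecidableEq ι] (i j : ι) : ket i j = if j = i then 1 else 0 := by
  rw [ket, Pi.single_apply]

/-- Any Hermitian block-encoding gives the same value, since qubitization uses only U² = 1 and the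
block itself. -/
theorem jointProb_eq_walkAverage {n : ℕ} (hn : 2 ≤ n) (G : GluedTrees n) (m : ℕ)
    {U : Matrix (Bits a × Bits (n + 1)) (Bits a × Bits (n + 1)) ℂ}
    (hU : IsHermitianBlockEncoding (1 / 3) G.adj U) :
    jointProb m U G.entrance G.exit = walkAverage n (2 ^ m) := by
  obtain ⟨hun, hherm, hblock⟩ := hU
  let Ul : (Bits a × Bits (n + 1) → ℂ) →ₗ[ℂ] (Bits a × Bits (n + 1) → ℂ) := Matrix.toLin' U
  let Rl : (Bits a × Bits (n + 1) → ℂ) →ₗ[ℂ] (Bits a × Bits (n + 1) → ℂ) :=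
    Matrix.toLin' (zeroReflection a (n + 1))
  have hpow : ∀ (z : ℕ) ψ, ((Ul * Rl) ^ z) ψ = (walkOperator U ^ z) *ᵥ ψ := by
    intro z ψ
    have : Ul * Rl = Matrix.toLin' (walkOperator U) := (Matrix.toLin'_mul _ _).symm
    rw [this, ← Matrix.toLin'_pow, Matrix.toLin'_apply]
  have h := functional_pow_walk (U := Ul) (R := Rl) (e := fun u => ket ((0 : Bits a), u))
    (H := fun v u => ((1 / 3 : ℝ) : ℂ) * G.adj v u) ?_ ?_ ?_ (LinearMap.proj ((0 : Bits a), G.exit)) ?_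
  · have h3 := G.chebyshevRow_entrance hn
      (fun z u => ((walkOperator U ^ z) *ᵥ ket ((0 : Bits a), u)) (0, G.exit)) ?_ ?_ ?_
    · rw [jointProb_eq, walkAverage]
      push_cast
      congr 1
      refine Finset.sum_congr rfl fun z _ => ?_
      rw [h3 z, Complex.norm_real, Real.norm_eq_abs, sq_abs]
    · intro u
      rw [pow_zero, Matrix.one_mulVec, ket_apply]
      simp [Prod.ext_iff, eq_comm]
    · intro u
      have := h.1 u
      simpa only [hpow, LinearMap.proj_apply] using this
    · intro z u
      have := h.2 z u
      simpa only [hpow, LinearMap.proj_apply] using this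
  · intro ψ
    change U *ᵥ (U *ᵥ ψ) = ψ
    have : U * U = 1 := by
      have := Matrix.mem_unitaryGroup_iff.1 hun
      rwa [Matrix.star_eq_conjTranspose, hherm.eq] at this
    rw [Matrix.mulVec_mulVec, this, Matrix.one_mulVec]
  · intro u
    ext x
    change (zeroReflection a (n + 1) *ᵥ ket (0, u)) x = _
    rw [zeroReflection_mulVec, ket_apply]
    by_cases hx : x = (0, u)
    · simp [hx]
    · simp [hx]
  · intro u
    ext x
    have hcol : ∀ y, (U *ᵥ ket (0, u)) y = U y (0, u) := fun y => by
      rw [ket, Matrix.mulVec_single_one]; rfl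
    change (U *ᵥ ket (0, u)) x + (zeroReflection a (n + 1) *ᵥ (U *ᵥ ket (0, u))) x = _
    rw [zeroReflection_mulVec, hcol]
    obtain ⟨c, w⟩ := x
    simp only [Pi.smul_apply, Finset.sum_apply, smul_eq_mul, ket_apply, Prod.mk.injEq]
    by_cases hc : c = 0
    · subst hc
      rw [if_pos rfl, hblock]
      simp
      ring
    · rw [if_neg hc]
      simp [hc]
  · intro ψ
    change (zeroReflection a (n + 1) *ᵥ ψ) (0, G.exit) = ψ (0, G.exit)
    rw [zeroReflection_mulVec, if_pos rfl]

end BlockEncoding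

/-! ### Circuits as linear maps -/

section CircuitGeneral

variable {W K : Type}

theorem extend_comp_self (e : K ↪ W) (y : K → Fin 2) (x : W → Fin 2) :
    Function.extend e y x ∘ e = y := by
  ext i; simp [e.injective.extend_apply]

theorem extend_extend (e : K ↪ W) (y y' : K → Fin 2) (x : W → Fin 2) :
    Function.extend e y' (Function.extend e y x) = Function.extend e y' x := by
  ext w
  by_cases h : ∃ i, e i = w
  · obtain ⟨i, rfl⟩ := h
    simp [e.injective.extend_apply]
  · rw [Function.extend_apply' _ _ _ h, Function.extend_apply' _ _ _ h,
      Function.extend_apply' _ _ _ h]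

theorem extend_comp_eq_self (e : K ↪ W) (x : W → Fin 2) : Function.extend e (x ∘ e) x = x := by
  ext w
  by_cases h : ∃ i, e i = w
  · obtain ⟨i, rfl⟩ := h
    simp [e.injective.extend_apply]
  · rw [Function.extend_apply' _ _ _ h]

/-- The control condition of a gate. -/
abbrev ctrlCond (pos neg : Finset W) (t : W) (x : W → Fin 2) : Prop :=
  (∀ w ∈ pos, w ≠ t → x w = 1) ∧ (∀ w ∈ neg, w ≠ t → x w = 0)

theorem ctrlCond_update [DecidableEq W] (pos neg : Finset W) (t : W) (x : W → Fin 2) (b : Fin 2) :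
    ctrlCond pos neg t (Function.update x t b) ↔ ctrlCond pos neg t x := by
  unfold ctrlCond
  refine and_congr (forall₂_congr fun w _ => forall_congr' fun h => ?_)
    (forall₂_congr fun w _ => forall_congr' fun h => ?_) <;>
  rw [Function.update_of_ne h]

variable [Fintype K] [DecidableEq K]

theorem applyOn_applyOn (M N : Matrix (K → Fin 2) (K → Fin 2) ℂ) (e : K ↪ W)
    (ψ : (W → Fin 2) → ℂ) : applyOn M e (applyOn N e ψ) = applyOn (M * N) e ψ := by
  ext x
  simp only [applyOn, extend_comp_self, extend_extend, Matrix.mul_apply, Finset.sum_mul,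
    Finset.mul_sum]
  rw [Finset.sum_comm]
  simp only [mul_assoc]

theorem applyOn_one (e : K ↪ W) (ψ : (W → Fin 2) → ℂ) : applyOn 1 e ψ = ψ := by
  ext x
  simp only [applyOn, Matrix.one_apply, ite_mul, one_mul, zero_mul, Finset.sum_ite_eq,
    Finset.mem_univ, if_true, extend_comp_eq_self]

theorem sum_norm_applyOn_sq {M : Matrix (K → Fin 2) (K → Fin 2) ℂ}
    (hM : M ∈ Matrix.unitaryGroup (K → Fin 2) ℂ) (e : K ↪ W) (ψ : (W → Fin 2) → ℂ) (x : W → Fin 2) :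
    ∑ y : K → Fin 2, ‖applyOn M e ψ (Function.extend e y x)‖ ^ 2 =
      ∑ y : K → Fin 2, ‖ψ (Function.extend e y x)‖ ^ 2 := by
  simp only [applyOn, extend_comp_self, extend_extend]
  exact sum_norm_mulVec_sq hM (fun y => ψ (Function.extend e y x))

variable [Fintype W]

theorem applyOn_ket (M : Matrix (K → Fin 2) (K → Fin 2) ℂ) (e : K ↪ W) (x : W → Fin 2) :
    applyOn M e (ket x) = ∑ w, (M *ᵥ ket (x ∘ e)) w • ket (Function.extend e w x) := by
  ext y
  have hcol : ∀ w, (M *ᵥ ket (x ∘ e)) w = M w (x ∘ e) := fun w => by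
    rw [ket, Matrix.mulVec_single_one]; rfl
  simp only [applyOn, hcol, Finset.sum_apply, Pi.smul_apply, smul_eq_mul, ket_apply, mul_ite,
    mul_one, mul_zero]
  by_cases h : Function.extend e (x ∘ e) y = x
  · have h' : y = Function.extend e (y ∘ e) x := by
      rw [← h, extend_extend, extend_comp_eq_self]
    rw [Finset.sum_eq_single (x ∘ e), if_pos h, Finset.sum_eq_single (y ∘ e), if_pos h']
    · intro w _ hw
      rw [if_neg]
      rintro rfl
      exact hw (extend_comp_self e w x).symm
    · simp
    · intro w _ hw
      rw [if_neg]
      intro hx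
      apply hw
      rw [← hx, extend_comp_self]
    · simp
  · rw [Finset.sum_eq_zero, Finset.sum_eq_zero]
    · intro w _
      rw [if_neg]
      rintro rfl
      exact h (by rw [extend_extend, extend_comp_eq_self])
    · intro w _
      rw [if_neg]
      rintro rfl
      exact h (by rw [extend_comp_self])

variable [DecidableEq W]

/-- Averaging over the qubits selected by `e`. -/
theorem sum_sum_extend (e : K ↪ W) (f : (W → Fin 2) → ℝ) :
    ∑ x, ∑ y : K → Fin 2, f (Function.extend e y x) = Fintype.card (K → Fin 2) * ∑ x, f x := by
  -- Exchanges the selected bits of x with the bits y, so the double sum turns into one where y is a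
  -- free index.
  have inv : Function.Involutive (fun p : (W → Fin 2) × (K → Fin 2) =>
      (Function.extend e p.2 p.1, p.1 ∘ e)) := by
    rintro ⟨x, y⟩
    simp only [extend_comp_self, extend_extend, extend_comp_eq_self]
  have h := Equiv.sum_comp inv.toPerm (fun p : (W → Fin 2) × (K → Fin 2) => f p.1)
  simp only [Function.Involutive.coe_toPerm] at h
  rw [Fintype.sum_prod_type, Fintype.sum_prod_type] at h
  rw [h, Finset.mul_sum]
  simp

/-- A transformation that preserves the norm of each slice along the qubits selected by `e`
preserves every marginal of the other qubits. -/
theorem sum_norm_sq_eq_of_slices (e : K ↪ W) (P : (W → Fin 2) → Prop) [DecidablePred P]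
    (hP : ∀ x y, P (Function.extend e y x) ↔ P x) (φ ψ : (W → Fin 2) → ℂ)
    (h : ∀ x, ∑ y : K → Fin 2, ‖φ (Function.extend e y x)‖ ^ 2 =
      ∑ y : K → Fin 2, ‖ψ (Function.extend e y x)‖ ^ 2) :
    (∑ x, if P x then ‖φ x‖ ^ 2 else 0) = ∑ x, if P x then ‖ψ x‖ ^ 2 else 0 := by
  have h1 := sum_sum_extend e (fun x => if P x then ‖φ x‖ ^ 2 else 0)
  have h2 := sum_sum_extend e (fun x => if P x then ‖ψ x‖ ^ 2 else 0)
  have h3 : ∀ x, (∑ y : K → Fin 2, if P (Function.extend e y x) then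
      ‖φ (Function.extend e y x)‖ ^ 2 else 0) = ∑ y : K → Fin 2,
      if P (Function.extend e y x) then ‖ψ (Function.extend e y x)‖ ^ 2 else 0 := by
    intro x
    simp only [hP]
    split_ifs
    · exact h x
    · rfl
  simp only [h3] at h1
  rw [h1] at h2
  exact mul_left_cancel₀ (by positivity) h2

variable {n : ℕ} {G : GluedTrees n} (O : MatrixOracles G)

theorem ctrl_apply (pos neg : Finset W) (t : W) (U : Matrix.unitaryGroup (Fin 2) ℂ)
    (ψ : (W → Fin 2) → ℂ) (x : W → Fin 2) :
    (Gate.ctrl pos neg t U : Gate W (n + 1)).apply O ψ x =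
      if ctrlCond pos neg t x then ∑ b : Fin 2, U.1 (x t) b * ψ (Function.update x t b) else ψ x :=
  rfl

theorem ctrl_ctrl (pos neg : Finset W) (t : W) (U V : Matrix.unitaryGroup (Fin 2) ℂ)
    (ψ : (W → Fin 2) → ℂ) :
    (Gate.ctrl pos neg t U : Gate W (n + 1)).apply O
      ((Gate.ctrl pos neg t V : Gate W (n + 1)).apply O ψ) =
      (Gate.ctrl pos neg t (U * V) : Gate W (n + 1)).apply O ψ := by
  ext x
  simp only [ctrl_apply, ctrlCond_update]
  split_ifs
  · simp only [Function.update_self, Function.update_idem]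
    have : (U * V).1 = U.1 * V.1 := rfl
    rw [this]
    simp only [Matrix.mul_apply, Finset.mul_sum, Finset.sum_mul]
    rw [Finset.sum_comm]
    simp only [mul_assoc]
  · rfl

theorem ctrl_one (pos neg : Finset W) (t : W) (ψ : (W → Fin 2) → ℂ) :
    (Gate.ctrl pos neg t 1 : Gate W (n + 1)).apply O ψ = ψ := by
  ext x
  rw [ctrl_apply]
  have h1 : ((1 : Matrix.unitaryGroup (Fin 2) ℂ)).1 = 1 := rfl
  simp only [h1, Matrix.one_apply, ite_mul, one_mul, zero_mul, Finset.sum_ite_eq, Finset.mem_univ,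
    if_true, Function.update_eq_self, ite_self]

theorem ctrl_ket (pos neg : Finset W) (t : W) (U : Matrix.unitaryGroup (Fin 2) ℂ) (z : W → Fin 2) :
    (Gate.ctrl pos neg t U : Gate W (n + 1)).apply O (ket z) =
      if ctrlCond pos neg t z then ∑ b : Fin 2, U.1 b (z t) • ket (Function.update z t b)
      else ket z := by
  ext x
  rw [ctrl_apply]
  by_cases h : Function.update x t (z t) = z
  · have hx : x = Function.update z t (x t) := by
      rw [← h, Function.update_idem, Function.update_eq_self]
    have hc : ctrlCond pos neg t x ↔ ctrlCond pos neg t z := by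
      conv_lhs => rw [hx]
      exact ctrlCond_update pos neg t z (x t)
    by_cases hz : ctrlCond pos neg t z
    · rw [if_pos hz, if_pos (hc.2 hz), Finset.sum_apply, Finset.sum_eq_single (z t),
        Finset.sum_eq_single (x t)]
      · simp only [Pi.smul_apply, smul_eq_mul, ket_apply]
        rw [if_pos h, if_pos hx]
      · intro b _ hb
        rw [Pi.smul_apply, ket_apply, if_neg, smul_zero]
        intro h'
        apply hb
        rw [h', Function.update_self]
      · simp
      · intro b _ hb
        rw [ket_apply, if_neg, mul_zero]
        intro h'
        apply hb
        rw [← h', Function.update_self]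
      · simp
    · rw [if_neg hz, if_neg (fun h => hz (hc.1 h))]
  · have h1 : ∀ b, Function.update x t b ≠ z := by
      rintro b rfl
      simp at h
    have h2 : ∀ b, x ≠ Function.update z t b := by
      rintro b rfl
      simp at h
    have h3 : x ≠ z := by
      rintro rfl
      simp at h
    have e1 : (∑ b : Fin 2, U.1 (x t) b * ket z (Function.update x t b)) = 0 :=
      Finset.sum_eq_zero fun b _ => by rw [ket_apply, if_neg (h1 b), mul_zero]
    have e2 : (∑ b : Fin 2, U.1 b (z t) • ket (Function.update z t b)) x = (0 : ℂ) := by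
      rw [Finset.sum_apply]
      exact Finset.sum_eq_zero fun b _ => by
        rw [Pi.smul_apply, ket_apply, if_neg (h2 b), smul_zero]
    have e3 : ket z x = 0 := by rw [ket_apply, if_neg h3]
    rw [e1, e3, ite_self]
    split_ifs
    · exact e2.symm
    · exact e3.symm

theorem ctrl_pauliX (pos neg : Finset W) (t : W) (ψ : (W → Fin 2) → ℂ) (x : W → Fin 2) :
    (Gate.ctrl pos neg t pauliX : Gate W (n + 1)).apply O ψ x =
      ψ (if ctrlCond pos neg t x then Function.update x t (x t + 1) else x) := by
  rw [ctrl_apply]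
  split_ifs
  · have h : x t = 0 ∨ x t = 1 := by omega
    rcases h with h | h <;> simp [pauliX, h, Fin.sum_univ_two]
  · rfl

/-- A controlled gate preserves every marginal that does not involve its target. -/
theorem sum_norm_ctrl_sq (pos neg : Finset W) (t : W) (U : Matrix.unitaryGroup (Fin 2) ℂ)
    (P : (W → Fin 2) → Prop) [DecidablePred P] (hP : ∀ x b, P (Function.update x t b) ↔ P x)
    (ψ : (W → Fin 2) → ℂ) :
    (∑ x, if P x then ‖(Gate.ctrl pos neg t U : Gate W (n + 1)).apply O ψ x‖ ^ 2 else 0) =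
      ∑ x, if P x then ‖ψ x‖ ^ 2 else 0 := by
  let e : Unit ↪ W := ⟨fun _ => t, fun _ _ _ => rfl⟩
  have he : ∀ (y : Unit → Fin 2) x, Function.extend e y x = Function.update x t (y ()) := by
    intro y x
    ext w
    by_cases hw : w = t
    · subst hw
      rw [Function.update_self]
      have := e.injective.extend_apply y x ()
      exact congrArg _ this
    · rw [Function.update_of_ne hw, Function.extend_apply']
      rintro ⟨i, hi⟩
      exact hw hi.symm
  refine sum_norm_sq_eq_of_slices e P (fun x y => by rw [he]; exact hP x _) _ _ fun x => ?_
  simp only [he, ctrl_apply, ctrlCond_update]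
  split_ifs
  · simp only [Function.update_self, Function.update_idem]
    have h := sum_norm_mulVec_sq U.2 (fun b => ψ (Function.update x t b))
    have c : ∀ f : Fin 2 → ℝ, ∑ y : Unit → Fin 2, f (y ()) = ∑ b, f b := fun f =>
      (Equiv.funUnique Unit (Fin 2)).sum_comp f
    rw [c (fun b => ‖∑ b', U.1 b b' * ψ (Function.update x t b')‖ ^ 2),
      c (fun b => ‖ψ (Function.update x t b)‖ ^ 2)]
    exact h
  · rfl

theorem sum_norm_gate_sq (g : Gate W (n + 1)) (ψ : (W → Fin 2) → ℂ) :
    ∑ x, ‖g.apply O ψ x‖ ^ 2 = ∑ x, ‖ψ x‖ ^ 2 := by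
  cases g with
  | ctrl pos neg t U =>
    have := sum_norm_ctrl_sq O pos neg t U (fun _ => True) (by simp) ψ
    simpa using this
  | position inv e =>
    have hM : (if inv then (O.position.1)ᴴ else O.position.1) ∈
        Matrix.unitaryGroup (Fin (n + 1) ⊕ Fin (n + 1) → Fin 2) ℂ := by
      split_ifs
      · exact Unitary.star_mem O.position.2
      · exact O.position.2
    have := sum_norm_sq_eq_of_slices e (fun _ => True) (by simp) _ ψ
      (sum_norm_applyOn_sq hM e ψ)
    simp only [if_true] at this
    exact this
  | angle inv e =>
    have hM : (if inv then (O.angle.1)ᴴ else O.angle.1) ∈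
        Matrix.unitaryGroup ((Fin (n + 1) ⊕ Fin (n + 1)) ⊕ Unit → Fin 2) ℂ := by
      split_ifs
      · exact Unitary.star_mem O.angle.2
      · exact O.angle.2
    have := sum_norm_sq_eq_of_slices e (fun _ => True) (by simp) _ ψ
      (sum_norm_applyOn_sq hM e ψ)
    simp only [if_true] at this
    exact this

theorem runCircuit_nil (ψ : (W → Fin 2) → ℂ) : runCircuit O [] ψ = ψ := rfl

theorem runCircuit_cons (g : Gate W (n + 1)) (c : List (Gate W (n + 1))) (ψ : (W → Fin 2) → ℂ) :
    runCircuit O (g :: c) ψ = runCircuit O c (g.apply O ψ) := rfl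

theorem runCircuit_append (c d : List (Gate W (n + 1))) (ψ : (W → Fin 2) → ℂ) :
    runCircuit O (c ++ d) ψ = runCircuit O d (runCircuit O c ψ) := List.foldl_append

theorem sum_norm_runCircuit_sq (c : List (Gate W (n + 1))) (ψ : (W → Fin 2) → ℂ) :
    ∑ x, ‖runCircuit O c ψ x‖ ^ 2 = ∑ x, ‖ψ x‖ ^ 2 := by
  induction c generalizing ψ with
  | nil => rfl
  | cons g c ih => rw [runCircuit_cons, ih, sum_norm_gate_sq]

/-- The linear map of a gate. -/
def gateLin (g : Gate W (n + 1)) : ((W → Fin 2) → ℂ) →ₗ[ℂ] ((W → Fin 2) → ℂ) where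
  toFun := g.apply O
  map_add' φ ψ := by
    ext x
    cases g with
    | ctrl pos neg t U =>
      simp only [Pi.add_apply, ctrl_apply]
      split_ifs
      · simp only [mul_add, Finset.sum_add_distrib]
      · rfl
    | position inv e => simp [Gate.apply, applyOn, mul_add, Finset.sum_add_distrib]
    | angle inv e => simp [Gate.apply, applyOn, mul_add, Finset.sum_add_distrib]
  map_smul' a ψ := by
    ext x
    cases g with
    | ctrl pos neg t U =>
      simp only [Pi.smul_apply, ctrl_apply, RingHom.id_apply, smul_eq_mul]
      split_ifs
      · rw [Finset.mul_sum]; exact Finset.sum_congr rfl fun b _ => by ring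
      · rfl
    | position inv e =>
      simp only [Gate.apply, applyOn, Pi.smul_apply, RingHom.id_apply, smul_eq_mul]
      rw [Finset.mul_sum]; exact Finset.sum_congr rfl fun b _ => by ring
    | angle inv e =>
      simp only [Gate.apply, applyOn, Pi.smul_apply, RingHom.id_apply, smul_eq_mul]
      rw [Finset.mul_sum]; exact Finset.sum_congr rfl fun b _ => by ring

/-- The linear map of a circuit. -/
def circuitLin : List (Gate W (n + 1)) → (((W → Fin 2) → ℂ) →ₗ[ℂ] ((W → Fin 2) → ℂ))
  | [] => 1
  | g :: c => circuitLin c * gateLin O g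

theorem circuitLin_apply (c : List (Gate W (n + 1))) (ψ : (W → Fin 2) → ℂ) :
    circuitLin O c ψ = runCircuit O c ψ := by
  induction c generalizing ψ with
  | nil => rfl
  | cons g c ih => rw [circuitLin, Module.End.mul_apply, ih, runCircuit_cons]; rfl

theorem position_inv (e : Fin (n + 1) ⊕ Fin (n + 1) ↪ W) (ψ : (W → Fin 2) → ℂ) :
    (Gate.position true e).apply O ((Gate.position false e).apply O ψ) = ψ ∧
      (Gate.position false e).apply O ((Gate.position true e).apply O ψ) = ψ := by
  simp only [Gate.apply, if_true, applyOn_applyOn, Bool.false_eq_true, if_false]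
  rw [← Matrix.star_eq_conjTranspose, Matrix.mem_unitaryGroup_iff'.1 O.position.2,
    Matrix.mem_unitaryGroup_iff.1 O.position.2, applyOn_one]
  exact ⟨rfl, rfl⟩

theorem angle_inv (e : (Fin (n + 1) ⊕ Fin (n + 1)) ⊕ Unit ↪ W) (ψ : (W → Fin 2) → ℂ) :
    (Gate.angle true e).apply O ((Gate.angle false e).apply O ψ) = ψ ∧
      (Gate.angle false e).apply O ((Gate.angle true e).apply O ψ) = ψ := by
  simp only [Gate.apply, if_true, applyOn_applyOn, Bool.false_eq_true, if_false]
  rw [← Matrix.star_eq_conjTranspose, Matrix.mem_unitaryGroup_iff'.1 O.angle.2,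
    Matrix.mem_unitaryGroup_iff.1 O.angle.2, applyOn_one]
  exact ⟨rfl, rfl⟩

end CircuitGeneral

/-! ### The walk circuit -/

namespace Wire

variable {k m : ℕ}

/-- The basis configuration with the given contents of the registers. -/
def cfg (b : Fin m → Fin 2) (f : Fin 2) (v : Bits k) (a : Fin 2) (u : Bits k) (t : Fin 2) :
    Wire k m → Fin 2
  | phase i => b i
  | flag => f
  | neighbour i => v i
  | ancilla => a
  | state i => u i
  | angle => t

theorem eq_cfg (x : Wire k m → Fin 2) :
    x = cfg (fun i => x (phase i)) (x flag) (fun i => x (neighbour i)) (x ancilla)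
      (fun i => x (state i)) (x angle) := by
  ext w; cases w <;> rfl

theorem cfg_inj {b b' : Fin m → Fin 2} {f f' : Fin 2} {v v' : Bits k} {a a' : Fin 2} {u u' : Bits k}
    {t t' : Fin 2} :
    cfg b f v a u t = cfg b' f' v' a' u' t' ↔
      b = b' ∧ f = f' ∧ v = v' ∧ a = a' ∧ u = u' ∧ t = t' := by
  constructor
  · intro h
    exact ⟨funext fun i => congrFun h (phase i), congrFun h flag,
      funext fun i => congrFun h (neighbour i), congrFun h ancilla,
      funext fun i => congrFun h (state i), congrFun h angle⟩
  · rintro ⟨rfl, rfl, rfl, rfl, rfl, rfl⟩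
    rfl

theorem update_flag (b : Fin m → Fin 2) (f : Fin 2) (v : Bits k) (a : Fin 2) (u : Bits k)
    (t c : Fin 2) : Function.update (cfg b f v a u t) flag c = cfg b c v a u t := by
  ext w; cases w <;> simp [cfg]

/-- The ancilla qubits are in the zero state. -/
abbrev AncZero (x : Wire k m → Fin 2) : Prop := ∀ w : Wire k m, w.isAncilla → x w = 0

theorem ancZero_cfg {b : Fin m → Fin 2} {f : Fin 2} {v : Bits k} {a : Fin 2} {u : Bits k}
    {t : Fin 2} : AncZero (cfg b f v a u t) ↔ f = 0 ∧ v = 0 ∧ a = 0 := by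
  constructor
  · intro h
    exact ⟨h flag rfl, funext fun i => h (neighbour i) rfl, h ancilla rfl⟩
  · rintro ⟨rfl, rfl, rfl⟩ w hw
    cases w <;> simp_all [cfg, isAncilla]

theorem comp_positionWires (b : Fin m → Fin 2) (f : Fin 2) (v : Bits k) (a : Fin 2) (u : Bits k)
    (t : Fin 2) : cfg b f v a u t ∘ positionWires = Sum.elim u v := by
  ext i; rcases i with i | i <;> rfl

theorem comp_angleWires (b : Fin m → Fin 2) (f : Fin 2) (v : Bits k) (a : Fin 2) (u : Bits k)
    (t : Fin 2) : cfg b f v a u t ∘ angleWires = Sum.elim (Sum.elim u v) (fun _ => t) := by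
  ext i; rcases i with (i | i) | i <;> rfl

theorem extend_positionWires (b : Fin m → Fin 2) (f : Fin 2) (v : Bits k) (a : Fin 2) (u : Bits k)
    (t : Fin 2) (v' u' : Bits k) :
    Function.extend positionWires (Sum.elim u' v') (cfg b f v a u t) = cfg b f v' a u' t := by
  have h := positionWires (k := k) (m := m) |>.injective.extend_apply (Sum.elim u' v')
    (cfg b f v a u t)
  ext w
  cases w with
  | state i => exact congrArg _ (h (Sum.inl i))
  | neighbour i => exact congrArg _ (h (Sum.inr i))
  | phase i => rw [Function.extend_apply']; rfl; rintro ⟨i | i, hi⟩ <;> cases hi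
  | flag => rw [Function.extend_apply']; rfl; rintro ⟨i | i, hi⟩ <;> cases hi
  | ancilla => rw [Function.extend_apply']; rfl; rintro ⟨i | i, hi⟩ <;> cases hi
  | angle => rw [Function.extend_apply']; rfl; rintro ⟨i | i, hi⟩ <;> cases hi

theorem extend_angleWires (b : Fin m → Fin 2) (f : Fin 2) (v : Bits k) (a : Fin 2) (u : Bits k)
    (t : Fin 2) (v' u' : Bits k) (t' : Fin 2) :
    Function.extend angleWires (Sum.elim (Sum.elim u' v') (fun _ => t')) (cfg b f v a u t) =
      cfg b f v' a u' t' := by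
  have h := angleWires (k := k) (m := m) |>.injective.extend_apply
    (Sum.elim (Sum.elim u' v') (fun _ => t')) (cfg b f v a u t)
  ext w
  cases w with
  | state i => exact congrArg _ (h (Sum.inl (Sum.inl i)))
  | neighbour i => exact congrArg _ (h (Sum.inl (Sum.inr i)))
  | angle => exact congrArg _ (h (Sum.inr ()))
  | phase i => rw [Function.extend_apply']; rfl; rintro ⟨(i | i) | i, hi⟩ <;> cases hi
  | flag => rw [Function.extend_apply']; rfl; rintro ⟨(i | i) | i, hi⟩ <;> cases hi
  | ancilla => rw [Function.extend_apply']; rfl; rintro ⟨(i | i) | i, hi⟩ <;> cases hi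

/-- The exchange of the two registers of the block-encoding. -/
def mirror : Wire k m → Wire k m
  | phase i => phase i
  | flag => ancilla
  | neighbour i => state i
  | ancilla => flag
  | state i => neighbour i
  | angle => angle

theorem mirror_mirror (w : Wire k m) : mirror (mirror w) = w := by cases w <;> rfl

theorem cfg_comp_mirror (b : Fin m → Fin 2) (f : Fin 2) (v : Bits k) (a : Fin 2) (u : Bits k)
    (t : Fin 2) : cfg b f v a u t ∘ mirror = cfg b a u f v t := by
  ext w; cases w <;> rfl

end Wire

open Wire

section WalkCircuit

variable {n m : ℕ} {G : GluedTrees n} (O : MatrixOracles G)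

/-- State vectors of the phase estimation circuit. -/
abbrev QState (n m : ℕ) : Type := (Wire (n + 1) m → Fin 2) → ℂ

theorem angle_ket (b : Fin m → Fin 2) (f : Fin 2) (v : Bits (n + 1)) (a : Fin 2) (u : Bits (n + 1)) :
    (Gate.angle false angleWires).apply O (ket (cfg b f v a u 0)) =
      ket (cfg b f v a u (G.angleBit u v)) := by
  simp only [Gate.apply, Bool.false_eq_true, if_false]
  rw [applyOn_ket, comp_angleWires]
  have h := O.angle_spec u v
  change O.angle.1 *ᵥ ket (Sum.elim (Sum.elim u v) (fun _ => 0)) = _ at h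
  rw [h, Finset.sum_eq_single (Sum.elim (Sum.elim u v) (fun _ => G.angleBit u v))]
  · rw [ket_apply, if_pos rfl, one_smul, extend_angleWires]
  · intro w _ hw
    rw [ket_apply, if_neg hw, zero_smul]
  · simp

theorem angle_inv_ket (b : Fin m → Fin 2) (f : Fin 2) (v : Bits (n + 1)) (a : Fin 2)
    (u : Bits (n + 1)) {t : Fin 2} (ht : t = G.angleBit u v) :
    (Gate.angle true angleWires).apply O (ket (cfg b f v a u t)) = ket (cfg b f v a u 0) := by
  rw [ht, ← angle_ket, (angle_inv O _ _).1]

theorem position_ket (b : Fin m → Fin 2) (f : Fin 2) (a : Fin 2) (u : Bits (n + 1)) (t : Fin 2) :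
    (Gate.position false positionWires).apply O (ket (cfg b f 0 a u t)) =
      ∑ w ∈ O.nbhd u, ((1 / Real.sqrt 3 : ℝ) : ℂ) • ket (cfg b f w a u t) := by
  simp only [Gate.apply, Bool.false_eq_true, if_false]
  rw [applyOn_ket, comp_positionWires, O.position_spec u]
  simp only [Finset.sum_apply, Finset.sum_smul]
  rw [Finset.sum_comm]
  refine Finset.sum_congr rfl fun w _ => ?_
  rw [Finset.sum_eq_single (Sum.elim u w)]
  · rw [Pi.smul_apply, ket_apply, if_pos rfl, smul_eq_mul, mul_one, extend_positionWires]
  · intro y _ hy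
    rw [Pi.smul_apply, ket_apply, if_neg hy, smul_zero, zero_smul]
  · simp

/-- The oracle is specified only on a zero second register. Its adjoint is therefore known only in
the corresponding rows, which suffices because the outcome is tested with the neighbour register in
zero. -/
theorem position_inv_apply (ψ : QState n m) (b : Fin m → Fin 2) (f : Fin 2) (a : Fin 2)
    (v : Bits (n + 1)) (t : Fin 2) :
    (Gate.position true positionWires).apply O ψ (cfg b f 0 a v t) =
      ∑ w ∈ O.nbhd v, ((1 / Real.sqrt 3 : ℝ) : ℂ) * ψ (cfg b f w a v t) := by
  simp only [Gate.apply, if_true, applyOn, comp_positionWires]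
  have hcol : ∀ y, (O.position.1)ᴴ (Sum.elim v 0) y =
      ∑ w ∈ O.nbhd v, if y = Sum.elim v w then ((1 / Real.sqrt 3 : ℝ) : ℂ) else 0 := by
    intro y
    have h := congrFun (O.position_spec v) y
    rw [ket, Matrix.mulVec_single_one] at h
    change O.position.1 y (Sum.elim v 0) = _ at h
    rw [Matrix.conjTranspose_apply, h, Finset.sum_apply, star_sum]
    refine Finset.sum_congr rfl fun w _ => ?_
    rw [Pi.smul_apply, ket_apply]
    split_ifs
    · simp
    · simp
  simp only [hcol, Finset.sum_mul, ite_mul, zero_mul]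
  rw [Finset.sum_comm]
  refine Finset.sum_congr rfl fun w _ => ?_
  rw [Finset.sum_ite_eq']
  simp [extend_positionWires]

theorem ctrlCond_angle (b : Fin m → Fin 2) (f : Fin 2) (v : Bits (n + 1)) (a : Fin 2)
    (u : Bits (n + 1)) (t : Fin 2) :
    ctrlCond {Wire.angle} ∅ flag (cfg b f v a u t) ↔ t = 1 := by
  simp [ctrlCond, cfg]

/-- The rotation of the flag by `s`, controlled by the angle qubit. -/
abbrev rotGate (n m : ℕ) (s : ℝ) : Gate (Wire (n + 1) m) (n + 1) :=
  .ctrl {Wire.angle} ∅ flag (rotationY s)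

theorem rotation_ket (s : ℝ) (b : Fin m → Fin 2) (v : Bits (n + 1)) (a : Fin 2) (u : Bits (n + 1))
    (t : Fin 2) (hs : Real.cos (s / 2) = 0) :
    (rotGate n m s).apply O (ket (cfg b 0 v a u t)) =
      if t = 1 then (Real.sin (s / 2) : ℂ) • ket (cfg b 1 v a u t) else ket (cfg b 0 v a u t) := by
  rw [ctrl_ket]
  simp only [ctrlCond_angle]
  split_ifs
  · have hs' : Complex.cos (s / 2) = 0 := by
      have := congrArg (fun r : ℝ => (r : ℂ)) hs
      push_cast at this
      exact this
    rw [Fin.sum_univ_two, update_flag, update_flag]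
    simp [rotationY, cfg, hs']
  · rfl

/-- The linear map of `stateTransformation`. -/
def transLin : QState n m →ₗ[ℂ] QState n m := circuitLin O stateTransformation

/-- The linear map of `stateTransformationInv`. -/
def transInvLin : QState n m →ₗ[ℂ] QState n m := circuitLin O stateTransformationInv

theorem transLin_apply (ψ : QState n m) :
    transLin O ψ = (Gate.angle true angleWires).apply O ((rotGate n m Real.pi).apply O
      ((Gate.angle false angleWires).apply O ((Gate.position false positionWires).apply O ψ))) := rfl

theorem transInvLin_apply (ψ : QState n m) :
    transInvLin O ψ = (Gate.position true positionWires).apply O ((Gate.angle true angleWires).apply O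
      ((rotGate n m (-Real.pi)).apply O ((Gate.angle false angleWires).apply O ψ))) := rfl

theorem rotationY_mul_neg (t : ℝ) : rotationY t * rotationY (-t) = 1 := by
  apply Subtype.ext
  have h := Complex.cos_sq_add_sin_sq ((t : ℂ) / 2)
  change (rotationY t).1 * (rotationY (-t)).1 = 1
  have e : (-(t : ℂ)) / 2 = -((t : ℂ) / 2) := by ring
  ext i j
  fin_cases i <;> fin_cases j <;>
    simp [rotationY, Matrix.mul_apply, Fin.sum_univ_two, e]
  · linear_combination h
  · ring
  · ring
  · linear_combination h

theorem rotGate_rotGate (s : ℝ) (ψ : QState n m) :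
    (rotGate n m s).apply O ((rotGate n m (-s)).apply O ψ) = ψ := by
  rw [ctrl_ctrl, rotationY_mul_neg, ctrl_one]

theorem transInvLin_transLin (ψ : QState n m) : transInvLin O (transLin O ψ) = ψ := by
  rw [transInvLin_apply, transLin_apply, (angle_inv O _ _).2]
  have := rotGate_rotGate O (-Real.pi) ((Gate.angle false angleWires).apply O
    ((Gate.position false positionWires).apply O ψ))
  rw [neg_neg] at this
  rw [this, (angle_inv O _ _).1, (position_inv O _ _).1]

theorem transLin_transInvLin (ψ : QState n m) : transLin O (transInvLin O ψ) = ψ := by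
  rw [transInvLin_apply, transLin_apply, (position_inv O _ _).2, (angle_inv O _ _).2,
    rotGate_rotGate, (angle_inv O _ _).1]

/-- The exchange of the two registers as a linear map. -/
def swapLin : QState n m →ₗ[ℂ] QState n m := LinearMap.funLeft ℂ ℂ (fun x => x ∘ mirror)

theorem swapLin_apply (ψ : QState n m) (x : Wire (n + 1) m → Fin 2) :
    swapLin ψ x = ψ (x ∘ mirror) := rfl

theorem comp_mirror_comp_mirror (x : Wire (n + 1) m → Fin 2) : (x ∘ mirror) ∘ mirror = x := by
  ext w; simp [mirror_mirror]

theorem swapLin_swapLin (ψ : QState n m) : swapLin (swapLin ψ) = ψ := by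
  ext x
  rw [swapLin_apply, swapLin_apply, comp_mirror_comp_mirror]

theorem swapLin_ket (x : Wire (n + 1) m → Fin 2) : swapLin (ket x) = ket (x ∘ mirror) := by
  ext y
  rw [swapLin_apply, ket_apply, ket_apply]
  have : y ∘ mirror = x ↔ y = x ∘ mirror :=
    ⟨fun h => by rw [← h, comp_mirror_comp_mirror], fun h => by rw [h, comp_mirror_comp_mirror]⟩
  simp only [this]

/-- The block-encoding `U_T† SWAP U_T`. -/
def encodingLin : QState n m →ₗ[ℂ] QState n m := transInvLin O * swapLin * transLin O

theorem encodingLin_encodingLin (ψ : QState n m) : encodingLin O (encodingLin O ψ) = ψ := by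
  simp only [encodingLin, Module.End.mul_apply, transLin_transInvLin, swapLin_swapLin,
    transInvLin_transLin]

/-- The reflection about the zero state of the ancillas. -/
def reflLin : QState n m →ₗ[ℂ] QState n m where
  toFun ψ x := if AncZero x then ψ x else -ψ x
  map_add' φ ψ := by
    ext x
    simp only [Pi.add_apply]
    split_ifs
    · rfl
    · ring
  map_smul' a ψ := by
    ext x
    simp only [Pi.smul_apply, RingHom.id_apply]
    split_ifs
    · rfl
    · simp

theorem reflLin_apply (ψ : QState n m) (x : Wire (n + 1) m → Fin 2) :
    reflLin ψ x = if AncZero x then ψ x else -ψ x := rfl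

/-- The basis state with the ancillas in the zero state and `u` in the state register. -/
def startKet (b : Fin m → Fin 2) (u : Bits (n + 1)) : QState n m := ket (cfg b 0 0 0 u 0)

theorem reflLin_startKet (b : Fin m → Fin 2) (u : Bits (n + 1)) :
    reflLin (startKet b u) = startKet b u := by
  ext x
  rw [reflLin_apply, startKet, ket_apply]
  by_cases h : x = cfg b 0 0 0 u 0
  · rw [if_pos h, if_pos (by rw [h]; exact ancZero_cfg.2 ⟨rfl, rfl, rfl⟩)]
  · simp [h]

/-- The second angle call uncomputes the angle qubit. What remains is a flag that is 0 exactly on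
true edges. -/
theorem transLin_startKet (b : Fin m → Fin 2) (u : Bits (n + 1)) :
    transLin O (startKet b u) = ∑ w ∈ O.nbhd u, ((1 / Real.sqrt 3 : ℝ) : ℂ) •
      ket (cfg b (G.angleBit u w) w 0 u 0) := by
  have hcos : Real.cos (Real.pi / 2) = 0 := Real.cos_pi_div_two
  rw [transLin_apply, startKet, position_ket]
  change gateLin O (Gate.angle true angleWires : Gate (Wire (n + 1) m) (n + 1))
    (gateLin O (rotGate n m Real.pi)
      (gateLin O (Gate.angle false angleWires : Gate (Wire (n + 1) m) (n + 1)) _)) = _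
  simp only [map_sum, map_smul]
  refine Finset.sum_congr rfl fun w _ => ?_
  congr 1
  change (Gate.angle true angleWires).apply O ((rotGate n m Real.pi).apply O
      ((Gate.angle false angleWires).apply O _)) = _
  rw [angle_ket, rotation_ket O _ _ _ _ _ _ hcos]
  have h : G.angleBit u w = 0 ∨ G.angleBit u w = 1 := by omega
  rcases h with h | h
  · rw [if_neg (by rw [h]; decide), angle_inv_ket O _ _ _ _ _ rfl, h]
  · rw [if_pos h, Real.sin_pi_div_two, Complex.ofReal_one, one_smul,
      angle_inv_ket O _ _ _ _ _ rfl, h]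

theorem angleBit_comm (u w : Bits (n + 1)) : G.angleBit u w = G.angleBit w u := by
  have h : G.labelled.Adj u w ↔ G.labelled.Adj w u := G.labelled.adj_comm u w
  unfold GluedTrees.angleBit
  by_cases hw : G.labelled.Adj u w
  · rw [if_pos hw, if_pos (h.1 hw)]
  · rw [if_neg hw, if_neg (fun h' => hw (h.2 h'))]

/-- The swap moves the flag into the ancilla and exchanges u and w. As the angle is symmetric, the
oracle computes the same bit again, and the rotation sets the fresh flag to 1 on every non-edge. -/
theorem rotated_swapped_ket (b : Fin m → Fin 2) (u w : Bits (n + 1)) :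
    (Gate.angle true angleWires).apply O ((rotGate n m (-Real.pi)).apply O
      ((Gate.angle false angleWires).apply O (ket (cfg b 0 u (G.angleBit u w) w 0)))) =
      if G.angleBit u w = 0 then ket (cfg b 0 u 0 w 0) else -ket (cfg b 1 u 1 w 0) := by
  have hcos : Real.cos (-Real.pi / 2) = 0 := by rw [neg_div, Real.cos_neg, Real.cos_pi_div_two]
  have hsin : Real.sin (-Real.pi / 2) = -1 := by rw [neg_div, Real.sin_neg, Real.sin_pi_div_two]
  rw [angle_ket, rotation_ket O _ _ _ _ _ _ hcos]
  have h : G.angleBit u w = 0 ∨ G.angleBit u w = 1 := by omega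
  rcases h with h | h
  · have h' : G.angleBit w u = 0 := by rw [angleBit_comm, h]
    rw [if_neg (by rw [h']; decide), angle_inv_ket O _ _ _ _ _ rfl, if_pos h, h]
  · have h' : G.angleBit w u = 1 := by rw [angleBit_comm, h]
    rw [if_pos h', if_neg (by rw [h]; decide), hsin]
    change gateLin O (Gate.angle true angleWires : Gate (Wire (n + 1) m) (n + 1)) _ = _
    rw [map_smul]
    change _ • (Gate.angle true angleWires).apply O _ = _
    rw [angle_inv_ket O _ _ _ _ _ rfl, h]
    simp

/-- The two factors 1/√3 come from the two superpositions over three elements. Elements of `nbhd`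
that are not neighbours carry a 1 in the flag and in the ancilla and are projected out, so the
choice of padding has no effect. -/
theorem encodingLin_startKet_apply (b b' : Fin m → Fin 2) (u v : Bits (n + 1)) (t : Fin 2) :
    encodingLin O (startKet b u) (cfg b' 0 0 0 v t) =
      if b' = b ∧ t = 0 then ((1 / 3 : ℝ) : ℂ) * G.adj v u else 0 := by
  classical
  have h1 : encodingLin O (startKet b u) = (Gate.position true positionWires).apply O
      (∑ w ∈ O.nbhd u, ((1 / Real.sqrt 3 : ℝ) : ℂ) •
        (if G.angleBit u w = 0 then ket (cfg b 0 u 0 w 0) else -ket (cfg b 1 u 1 w 0))) := by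
    simp only [encodingLin, Module.End.mul_apply, transLin_startKet, map_sum, map_smul, swapLin_ket,
      cfg_comp_mirror]
    change _ = gateLin O (Gate.position true positionWires : Gate (Wire (n + 1) m) (n + 1)) _
    simp only [map_sum, map_smul]
    refine Finset.sum_congr rfl fun w _ => ?_
    rw [transInvLin_apply, rotated_swapped_ket]
    rfl
  have hs : ((1 / Real.sqrt 3 : ℝ) : ℂ) * ((1 / Real.sqrt 3 : ℝ) : ℂ) = ((1 / 3 : ℝ) : ℂ) := by
    rw [← Complex.ofReal_mul, div_mul_div_comm, Real.mul_self_sqrt (by norm_num), one_mul]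
  rw [h1, position_inv_apply]
  set s := ((1 / Real.sqrt 3 : ℝ) : ℂ)
  have hterm : ∀ w' ∈ O.nbhd v, s * (∑ w ∈ O.nbhd u, s •
        (if G.angleBit u w = 0 then ket (cfg b 0 u 0 w 0) else -ket (cfg b 1 u 1 w 0)))
          (cfg b' 0 w' 0 v t) =
      if w' = u then (if b' = b ∧ t = 0 then ((1 / 3 : ℝ) : ℂ) * G.adj v u else 0) else 0 := by
    intro w' _
    rw [Finset.sum_apply]
    have hsum : ∀ w ∈ O.nbhd u, (s • (if G.angleBit u w = 0 then ket (cfg b 0 u 0 w 0)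
        else -ket (cfg b 1 u 1 w 0)) : QState n m) (cfg b' 0 w' 0 v t) =
        if w = v then (if w' = u ∧ b' = b ∧ t = 0 then s * G.adj v u else 0) else 0 := by
      intro w _
      by_cases hw : w = v
      · subst hw
        rw [if_pos rfl]
        by_cases ha : G.labelled.Adj u w
        · have hb : G.angleBit u w = 0 := by rw [GluedTrees.angleBit, if_pos ha]
          have hadj : G.adj w u = 1 := by
            rw [GluedTrees.adj, SimpleGraph.adjMatrix_apply, if_pos ha.symm]
          rw [if_pos hb, hadj, Pi.smul_apply, ket_apply]
          simp only [cfg_inj]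
          by_cases hc : w' = u ∧ b' = b ∧ t = 0
          · obtain ⟨rfl, rfl, rfl⟩ := hc
            simp
          · rw [if_neg hc, if_neg (by tauto), smul_zero]
        · have hb : ¬ G.angleBit u w = 0 := by rw [GluedTrees.angleBit, if_neg ha]; decide
          have hadj : G.adj w u = 0 := by
            rw [GluedTrees.adj, SimpleGraph.adjMatrix_apply, if_neg (fun h => ha h.symm)]
          rw [if_neg hb, hadj, Pi.smul_apply, Pi.neg_apply, ket_apply]
          simp [cfg_inj]
      · rw [if_neg hw]
        split_ifs
        · rw [Pi.smul_apply, ket_apply, if_neg (fun h => hw (cfg_inj.1 h).2.2.2.2.1.symm), smul_zero]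
        · rw [Pi.smul_apply, Pi.neg_apply, ket_apply,
            if_neg (fun h => hw (cfg_inj.1 h).2.2.2.2.1.symm), neg_zero, smul_zero]
    rw [Finset.sum_congr rfl hsum, Finset.sum_ite_eq']
    by_cases hc : w' = u ∧ b' = b ∧ t = 0
    · obtain ⟨rfl, rfl, rfl⟩ := hc
      simp only [and_self, if_true, ← hs]
      split_ifs with hv
      · ring
      · have hadj : G.adj v w' = 0 := by
          rw [GluedTrees.adj, SimpleGraph.adjMatrix_apply, if_neg]
          exact fun h => hv (O.mem_nbhd _ _ h.symm)
        rw [hadj]; ring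
    · rw [if_neg hc, ite_self, mul_zero]
      by_cases hw : w' = u
      · rw [if_pos hw, if_neg (fun h => hc ⟨hw, h⟩)]
      · rw [if_neg hw]
  rw [Finset.sum_congr rfl hterm, Finset.sum_ite_eq']
  split_ifs with hu hc
  · rfl
  · rfl
  · have hadj : G.adj v u = 0 := by
      rw [GluedTrees.adj, SimpleGraph.adjMatrix_apply, if_neg]
      exact fun h => hu (O.mem_nbhd _ _ h)
    rw [hadj, mul_zero]
  · rfl

/-- The block condition of qubitization for the circuit. Components with nonzero ancillas cancel,
and those with a 1 in the angle qubit vanish by `encodingLin_startKet_apply`. -/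
theorem encodingLin_add_reflLin (b : Fin m → Fin 2) (u : Bits (n + 1)) :
    encodingLin O (startKet b u) + reflLin (encodingLin O (startKet b u)) =
      (2 : ℂ) • ∑ v, (((1 / 3 : ℝ) : ℂ) * G.adj v u) • startKet b v := by
  ext x
  rw [Pi.add_apply, reflLin_apply, Pi.smul_apply, Finset.sum_apply]
  simp only [Pi.smul_apply, startKet, ket_apply, smul_eq_mul]
  by_cases h : AncZero x
  · rw [if_pos h]
    rw [eq_cfg x] at h ⊢
    obtain ⟨h1, h2, h3⟩ := ancZero_cfg.1 h
    rw [h1, h2, h3]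
    change encodingLin O (startKet b u) _ + encodingLin O (startKet b u) _ = _
    rw [encodingLin_startKet_apply]
    simp only [cfg_inj, true_and]
    set b' := fun i => x (phase i)
    set v := fun i => x (state i)
    rw [Finset.sum_eq_single v]
    · by_cases hc : b' = b ∧ x Wire.angle = 0
      · rw [if_pos hc, if_pos ⟨hc.1, rfl, hc.2⟩]; ring
      · rw [if_neg hc, if_neg (fun h => hc ⟨h.1, h.2.2⟩)]; ring
    · intro w _ hw
      rw [if_neg (fun h => hw h.2.1.symm), mul_zero]
    · simp
  · rw [if_neg h, add_neg_cancel, Finset.sum_eq_zero, mul_zero]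
    intro v _
    rw [if_neg, mul_zero]
    rintro rfl
    exact h (ancZero_cfg.2 ⟨rfl, rfl, rfl⟩)

end WalkCircuit

/-! ### Controlled powers of the walk operator -/

section ControlledWalk

variable {n m : ℕ} {G : GluedTrees n} (O : MatrixOracles G)

/-- The state `ψ` is supported where the phase register contains `b`. -/
def SuppPhase (b : Fin m → Fin 2) (ψ : QState n m) : Prop :=
  ∀ x, (fun i => x (phase i)) ≠ b → ψ x = 0

theorem SuppPhase.applyOn {K : Type} [Fintype K] [DecidableEq K] {b : Fin m → Fin 2}
    {ψ : QState n m} (h : SuppPhase b ψ) (M : Matrix (K → Fin 2) (K → Fin 2) ℂ)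
    (e : K ↪ Wire (n + 1) m) (he : ∀ i q, e i ≠ phase q) : SuppPhase b (applyOn M e ψ) := by
  intro x hx
  refine Finset.sum_eq_zero fun y _ => ?_
  rw [h, mul_zero]
  convert hx using 1
  ext q
  rw [Function.extend_apply']
  rintro ⟨i, hi⟩
  exact he i q hi

theorem SuppPhase.ctrl {b : Fin m → Fin 2} {ψ : QState n m} (h : SuppPhase b ψ)
    (pos neg : Finset (Wire (n + 1) m)) (t : Wire (n + 1) m) (U : Matrix.unitaryGroup (Fin 2) ℂ)
    (ht : ∀ q, t ≠ phase q) :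
    SuppPhase b ((Gate.ctrl pos neg t U : Gate (Wire (n + 1) m) (n + 1)).apply O ψ) := by
  intro x hx
  rw [ctrl_apply]
  split_ifs
  · refine Finset.sum_eq_zero fun y _ => ?_
    rw [h, mul_zero]
    convert hx using 1
    ext q
    rw [Function.update_of_ne (ht q).symm]
  · exact h x hx

theorem SuppPhase.position {b : Fin m → Fin 2} {ψ : QState n m} (h : SuppPhase b ψ) (inv : Bool) :
    SuppPhase b ((Gate.position inv positionWires).apply O ψ) :=
  h.applyOn _ _ (by rintro (i | i) q hq <;> cases hq)

theorem SuppPhase.angle {b : Fin m → Fin 2} {ψ : QState n m} (h : SuppPhase b ψ) (inv : Bool) :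
    SuppPhase b ((Gate.angle inv angleWires).apply O ψ) :=
  h.applyOn _ _ (by rintro ((i | i) | i) q hq <;> cases hq)

theorem SuppPhase.transLin {b : Fin m → Fin 2} {ψ : QState n m} (h : SuppPhase b ψ) :
    SuppPhase b (transLin O ψ) := by
  rw [transLin_apply]
  exact (((h.position O _).angle O _).ctrl O _ _ _ _ (by simp)).angle O _

theorem SuppPhase.transInvLin {b : Fin m → Fin 2} {ψ : QState n m} (h : SuppPhase b ψ) :
    SuppPhase b (transInvLin O ψ) := by
  rw [transInvLin_apply]
  exact (((h.angle O _).ctrl O _ _ _ _ (by simp)).angle O _).position O _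

theorem SuppPhase.swapLin {b : Fin m → Fin 2} {ψ : QState n m} (h : SuppPhase b ψ) :
    SuppPhase b (swapLin ψ) := fun x hx => h (x ∘ mirror) hx

theorem SuppPhase.reflLin {b : Fin m → Fin 2} {ψ : QState n m} (h : SuppPhase b ψ) :
    SuppPhase b (reflLin ψ) := fun x hx => by
  rw [reflLin_apply, h x hx]; simp

/-- The walk operator. -/
def walkLin : QState n m →ₗ[ℂ] QState n m := encodingLin O * reflLin

theorem SuppPhase.walkLin {b : Fin m → Fin 2} {ψ : QState n m} (h : SuppPhase b ψ) :
    SuppPhase b (walkLin O ψ) :=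
  (h.reflLin.transLin O).swapLin.transInvLin O

theorem SuppPhase.walkLin_pow {b : Fin m → Fin 2} {ψ : QState n m} (h : SuppPhase b ψ) (z : ℕ) :
    SuppPhase b ((_root_.walkLin O ^ z) ψ) := by
  induction z with
  | zero => exact h
  | succ z ih => rw [pow_succ', Module.End.mul_apply]; exact ih.walkLin O

theorem suppPhase_startKet (b : Fin m → Fin 2) (u : Bits (n + 1)) : SuppPhase b (startKet b u) := by
  intro x hx
  rw [startKet, ket_apply, if_neg]
  rintro rfl
  exact hx rfl

theorem ctrl_phaseGate_pi (pos neg : Finset (Wire (n + 1) m)) (t : Wire (n + 1) m)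
    (ψ : QState n m) (x : Wire (n + 1) m → Fin 2) :
    (Gate.ctrl pos neg t (phaseGate Real.pi) : Gate (Wire (n + 1) m) (n + 1)).apply O ψ x =
      if ctrlCond pos neg t x ∧ x t = 1 then -ψ x else ψ x := by
  rw [ctrl_apply]
  have h : x t = 0 ∨ x t = 1 := by omega
  by_cases hc : ctrlCond pos neg t x
  · rw [if_pos hc]
    rcases h with h | h
    · have : Function.update x t 0 = x := by rw [← h, Function.update_eq_self]
      simp [h, phaseGate, Fin.sum_univ_two, this]
    · have : Function.update x t 1 = x := by rw [← h, Function.update_eq_self]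
      rw [if_pos ⟨hc, h⟩]
      simp [h, phaseGate, Fin.sum_univ_two, this, Complex.exp_pi_mul_I]
  · rw [if_neg hc, if_neg (fun h => hc h.1)]

theorem run_swapGates {q : Fin m} {x y : Wire (n + 1) m} (hxy : x ≠ y) (hx : x ≠ phase q)
    (hy : y ≠ phase q) (ψ : QState n m) (z : Wire (n + 1) m → Fin 2) :
    runCircuit O (swapGates {phase q} x y) ψ z =
      ψ (if z (phase q) = 1 then z ∘ Equiv.swap x y else z) := by
  have hcond : ∀ (s t : Wire (n + 1) m), s ≠ t → t ≠ phase q → ∀ z : Wire (n + 1) m → Fin 2,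
      ctrlCond (insert s {phase q}) ∅ t z ↔ z s = 1 ∧ z (phase q) = 1 := by
    intro s t hst ht z
    simp [ctrlCond, hst, ht.symm]
  have step : ∀ (s t : Wire (n + 1) m), s ≠ t → t ≠ phase q → ∀ z : Wire (n + 1) m → Fin 2,
      (if ctrlCond (insert s {phase q}) ∅ t z then Function.update z t (z t + 1) else z) =
        if z (phase q) = 1 then Function.update z t (z t + z s) else z := by
    intro s t hst ht z
    rw [if_congr (hcond s t hst ht z) rfl rfl]
    have h : z s = 0 ∨ z s = 1 := by omega
    rcases h with h | h <;> simp [h]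
  simp only [swapGates, runCircuit_cons, runCircuit_nil, ctrl_pauliX, step x y hxy hy,
    step y x hxy.symm hx]
  congr 1
  by_cases hq : z (phase q) = 1
  · simp only [hq, if_true, Function.update_of_ne hy.symm, Function.update_of_ne hx.symm]
    ext w
    have two : ∀ a b : Fin 2, a + (b + a) = b := by decide
    have two' : ∀ a b : Fin 2, b + a + b = a := by decide
    by_cases hwx : w = x
    · subst hwx
      simp [Function.update_of_ne hxy, two]
    · by_cases hwy : w = y
      · subst hwy
        simp [Function.update_of_ne hxy, Function.update_of_ne hxy.symm, two, two']
      · simp [Function.update_of_ne hwx, Function.update_of_ne hwy, Equiv.swap_apply_of_ne_of_ne hwx hwy]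
  · simp [hq]

/-- The exchange of the qubits `neighbour i` and `state i` for the indices `i` in a list. -/
def partialMirror (l : List (Fin (n + 1))) : Wire (n + 1) m → Wire (n + 1) m
  | neighbour i => if i ∈ l then state i else neighbour i
  | state i => if i ∈ l then neighbour i else state i
  | w => w

theorem run_swapList (q : Fin m) (l : List (Fin (n + 1))) (hl : l.Nodup) (ψ : QState n m)
    (z : Wire (n + 1) m → Fin 2) :
    runCircuit O (l.flatMap fun i => swapGates {phase q} (neighbour i) (state i)) ψ z =
      ψ (if z (phase q) = 1 then z ∘ partialMirror l else z) := by
  induction l generalizing ψ with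
  | nil =>
    have : (partialMirror [] : Wire (n + 1) m → Wire (n + 1) m) = id := by
      ext w; cases w <;> simp [partialMirror]
    simp [runCircuit_nil, this]
  | cons a l ih =>
    rw [List.nodup_cons] at hl
    rw [List.flatMap_cons, runCircuit_append, ih hl.2, run_swapGates O (by simp) (by simp) (by simp)]
    congr 1
    by_cases hq : z (phase q) = 1
    · have h1 : (z ∘ partialMirror l) (phase q) = 1 := hq
      rw [if_pos hq, if_pos h1, if_pos hq]
      ext w
      have hw : partialMirror l (Equiv.swap (neighbour a) (state a) w) = partialMirror (a :: l) w := by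
        cases w with
        | neighbour i =>
          by_cases hi : i = a
          · subst hi
            simp [partialMirror, hl.1]
          · rw [Equiv.swap_apply_of_ne_of_ne (by simp [hi]) (by simp)]
            simp [partialMirror, hi]
        | state i =>
          by_cases hi : i = a
          · subst hi
            simp [partialMirror, hl.1]
          · rw [Equiv.swap_apply_of_ne_of_ne (by simp) (by simp [hi])]
            simp [partialMirror, hi]
        | phase i => rw [Equiv.swap_apply_of_ne_of_ne (by simp) (by simp)]; rfl
        | flag => rw [Equiv.swap_apply_of_ne_of_ne (by simp) (by simp)]; rfl
        | ancilla => rw [Equiv.swap_apply_of_ne_of_ne (by simp) (by simp)]; rfl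
        | angle => rw [Equiv.swap_apply_of_ne_of_ne (by simp) (by simp)]; rfl
      simp only [Function.comp_apply, hw]
    · simp [hq]

theorem run_controlledSwap (q : Fin m) (ψ : QState n m) (z : Wire (n + 1) m → Fin 2) :
    runCircuit O (swapGates {phase q} flag ancilla) (runCircuit O
      ((List.finRange (n + 1)).flatMap fun i => swapGates {phase q} (neighbour i) (state i)) ψ) z =
      ψ (if z (phase q) = 1 then z ∘ mirror else z) := by
  rw [run_swapGates O (by simp) (by simp) (by simp), run_swapList O q _ (List.nodup_finRange _)]
  congr 1
  by_cases hq : z (phase q) = 1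
  · have h1 : (z ∘ Equiv.swap flag ancilla) (phase q) = 1 := by
      rw [Function.comp_apply, Equiv.swap_apply_of_ne_of_ne (by simp) (by simp), hq]
    rw [if_pos hq, if_pos h1, if_pos hq]
    ext w
    have hw : Equiv.swap flag ancilla (partialMirror (List.finRange (n + 1)) w) = mirror w := by
      cases w with
      | flag => simp [partialMirror, mirror]
      | ancilla => simp [partialMirror, mirror]
      | neighbour i =>
        rw [Equiv.swap_apply_of_ne_of_ne] <;> simp [partialMirror, mirror]
      | state i => rw [Equiv.swap_apply_of_ne_of_ne] <;> simp [partialMirror, mirror]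
      | phase i => rw [Equiv.swap_apply_of_ne_of_ne] <;> simp [partialMirror, mirror]
      | angle => rw [Equiv.swap_apply_of_ne_of_ne] <;> simp [partialMirror, mirror]
    simp only [Function.comp_apply, hw]
  · simp [hq]

/-- The second gate negates everything with control 1 and the first negates the zero state of the
ancillas once more, which together is 2Π - I and not its negative. -/
theorem run_controlledReflection (q : Fin m) (ψ : QState n m) (x : Wire (n + 1) m → Fin 2) :
    runCircuit O [.ctrl ∅ (Finset.univ.filter fun w => w.isAncilla) (phase q) (phaseGate Real.pi),
      .ctrl ∅ ∅ (phase q) (phaseGate Real.pi)] ψ x =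
      if x (phase q) = 1 then reflLin ψ x else ψ x := by
  have hc : ctrlCond ∅ (Finset.univ.filter fun w : Wire (n + 1) m => w.isAncilla) (phase q) x ↔
      AncZero x := by
    constructor
    · intro h w hw
      exact h.2 w (by simp [hw]) (by rintro rfl; simp [isAncilla] at hw)
    · intro h
      exact ⟨by simp, fun w hw _ => h w (by simpa using hw)⟩
  have hc' : ctrlCond ∅ ∅ (phase q) x := by simp [ctrlCond]
  simp only [runCircuit_cons, runCircuit_nil, ctrl_phaseGate_pi, reflLin_apply]
  by_cases h1 : x (phase q) = 1
  · by_cases h2 : AncZero x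
    · rw [if_pos ⟨hc', h1⟩, if_pos ⟨hc.2 h2, h1⟩, if_pos h1, if_pos h2, neg_neg]
    · rw [if_pos ⟨hc', h1⟩, if_neg (fun h => h2 (hc.1 h.1)), if_pos h1, if_neg h2]
  · rw [if_neg (fun h => h1 h.2), if_neg (fun h => h1 h.2), if_neg h1]

/-- Only the reflection and the swap need a control. When they are switched off, U_T and its inverse
cancel. -/
theorem run_controlledWalk (q : Fin m) {b : Fin m → Fin 2} {ψ : QState n m} (h : SuppPhase b ψ) :
    runCircuit O (controlledWalk q) ψ = if b q = 1 then walkLin O ψ else ψ := by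
  have sel : ∀ (φ χ : QState n m), SuppPhase b φ → SuppPhase b χ →
      (fun x => if x (phase q) = 1 then φ x else χ x) = if b q = 1 then φ else χ := by
    intro φ χ hφ hχ
    ext x
    by_cases hx : (fun i => x (phase i)) = b
    · have : x (phase q) = b q := congrFun hx q
      rw [this]
      split_ifs <;> rfl
    · rw [hφ x hx, hχ x hx, ite_self]
      split_ifs
      · rw [hφ x hx]
      · rw [hχ x hx]
  unfold controlledWalk
  simp only [runCircuit_append]
  have e1 : runCircuit O [.ctrl ∅ (Finset.univ.filter fun w => w.isAncilla) (phase q)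
      (phaseGate Real.pi), .ctrl ∅ ∅ (phase q) (phaseGate Real.pi)] ψ =
      if b q = 1 then reflLin ψ else ψ := by
    rw [← sel _ _ h.reflLin h]
    ext x
    exact run_controlledReflection O q ψ x
  rw [e1]
  have e2 : ∀ φ : QState n m, runCircuit O stateTransformation φ = transLin O φ := fun φ =>
    (circuitLin_apply O _ φ).symm
  have e3 : ∀ φ : QState n m, runCircuit O stateTransformationInv φ = transInvLin O φ := fun φ =>
    (circuitLin_apply O _ φ).symm
  rw [e2, e3]
  have e4 : ∀ φ : QState n m, SuppPhase b φ → runCircuit O (swapGates {phase q} flag ancilla)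
      (runCircuit O ((List.finRange (n + 1)).flatMap fun i =>
        swapGates {phase q} (neighbour i) (state i)) φ) = if b q = 1 then swapLin φ else φ := by
    intro φ hφ
    rw [← sel _ _ hφ.swapLin hφ]
    ext x
    rw [run_controlledSwap]
    split_ifs <;> rfl
  by_cases hb : b q = 1
  · rw [if_pos hb, if_pos hb, e4 _ (h.reflLin.transLin O), if_pos hb]
    rfl
  · rw [if_neg hb, if_neg hb, e4 _ (h.transLin O), if_neg hb, transInvLin_transLin]

theorem run_replicate_controlledWalk (q : Fin m) (r : ℕ) {b : Fin m → Fin 2} {ψ : QState n m}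
    (h : SuppPhase b ψ) : runCircuit O (List.replicate r (controlledWalk q)).flatten ψ =
      (walkLin O ^ ((b q : ℕ) * r)) ψ := by
  induction r generalizing ψ with
  | zero => simp [runCircuit_nil]
  | succ r ih =>
    rw [List.replicate_succ, List.flatten_cons, runCircuit_append, run_controlledWalk O q h]
    have hb : b q = 0 ∨ b q = 1 := by omega
    rcases hb with hb | hb
    · rw [if_neg (by rw [hb]; decide), ih h, hb]; simp
    · rw [if_pos hb, ih (h.walkLin O), hb]
      simp [pow_succ]

theorem run_controlledPowers (l : List (Fin m)) {b : Fin m → Fin 2} {ψ : QState n m}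
    (h : SuppPhase b ψ) :
    runCircuit O (l.flatMap fun i : Fin m => (List.replicate (2 ^ (i : ℕ)) (controlledWalk i)).flatten) ψ =
      (walkLin O ^ (l.map fun i : Fin m => (b i : ℕ) * 2 ^ (i : ℕ)).sum) ψ := by
  induction l generalizing ψ with
  | nil => simp [runCircuit_nil]
  | cons a l ih =>
    rw [List.flatMap_cons, runCircuit_append, run_replicate_controlledWalk O a _ h,
      ih (h.walkLin_pow O _), List.map_cons, List.sum_cons,
      add_comm ((b a : ℕ) * _), pow_add, Module.End.mul_apply]

/-! ### Preparation of the initial state -/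

theorem run_hadamards (l : List (Fin m)) (hl : l.Nodup) (x : Wire (n + 1) m → Fin 2) :
    runCircuit O (l.map fun i => .ctrl ∅ ∅ (phase i) hadamard) (ket 0) x =
      if ∀ w : Wire (n + 1) m, (∀ i ∈ l, w ≠ phase i) → x w = 0 then
        ((1 / Real.sqrt 2 : ℝ) : ℂ) ^ l.length else 0 := by
  induction l using List.reverseRecOn generalizing x with
  | nil =>
    simp only [List.map_nil, runCircuit_nil, ket_apply, List.not_mem_nil, false_imp_iff,
      implies_true, true_imp_iff, List.length_nil, pow_zero]
    congr 1
    exact propext ⟨fun h w => by rw [h]; rfl, fun h => funext h⟩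
  | append_singleton l a ih =>
    rw [List.nodup_append] at hl
    have hal : a ∉ l := fun h => hl.2.2 a h a (by simp) rfl
    rw [List.map_append, runCircuit_append, List.map_singleton, runCircuit_cons, runCircuit_nil,
      ctrl_apply, if_pos (by simp [ctrlCond]), Fin.sum_univ_two, ih hl.1, ih hl.1]
    have h1 : ¬ ∀ w : Wire (n + 1) m, (∀ i ∈ l, w ≠ phase i) →
        Function.update x (phase a) 1 w = 0 := by
      intro h
      have := h (phase a) (by intro i hi h'; cases h'; exact hal hi)
      simp at this
    have h2 : (∀ w : Wire (n + 1) m, (∀ i ∈ l, w ≠ phase i) →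
        Function.update x (phase a) 0 w = 0) ↔
        ∀ w : Wire (n + 1) m, (∀ i ∈ l ++ [a], w ≠ phase i) → x w = 0 := by
      constructor
      · intro h w hw
        have := h w (fun i hi => hw i (by simp [hi]))
        rwa [Function.update_of_ne (hw a (by simp))] at this
      · intro h w hw
        by_cases hwa : w = phase a
        · rw [hwa, Function.update_self]
        · rw [Function.update_of_ne hwa]
          apply h w
          intro i hi
          rcases List.mem_append.1 hi with hi | hi
          · exact hw i hi
          · rw [List.mem_singleton.1 hi]; exact hwa
    have hH : ∀ c : Fin 2, _root_.hadamard.1 c 0 = ((1 / Real.sqrt 2 : ℝ) : ℂ) := by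
      intro c
      fin_cases c <;> simp [_root_.hadamard]
    rw [if_neg h1, mul_zero, add_zero, hH]
    by_cases h : ∀ w : Wire (n + 1) m, (∀ i ∈ l ++ [a], w ≠ phase i) → x w = 0
    · rw [if_pos (h2.2 h), if_pos h, List.length_append, List.length_singleton, pow_succ']
    · rw [if_neg (fun h' => h (h2.1 h')), if_neg h, mul_zero]

theorem run_pauliXs (l : List (Fin (n + 1))) (hl : l.Nodup) (ψ : QState n m)
    (x : Wire (n + 1) m → Fin 2) :
    runCircuit O (l.map fun i => .ctrl ∅ ∅ (state i) pauliX) ψ x =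
      ψ (fun w => if w ∈ l.map state then x w + 1 else x w) := by
  induction l using List.reverseRecOn generalizing x with
  | nil => simp [runCircuit_nil]
  | append_singleton l a ih =>
    rw [List.nodup_append] at hl
    have hal : a ∉ l := fun h => hl.2.2 a h a (by simp) rfl
    rw [List.map_append, runCircuit_append, List.map_singleton, runCircuit_cons, runCircuit_nil,
      ctrl_pauliX, if_pos (by simp [ctrlCond]), ih hl.1]
    congr 1
    ext w
    by_cases hw : w = state a
    · subst hw
      simp [hal]
    · simp [hw]

theorem run_preparation (u : Bits (n + 1)) :
    runCircuit O (((List.finRange (n + 1)).filter (fun i => u i = 1)).map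
      (fun i => .ctrl ∅ ∅ (state i) pauliX)) (runCircuit O ((List.finRange m).map
        (fun i => .ctrl ∅ ∅ (phase i) hadamard)) (ket 0)) =
      ∑ b : Fin m → Fin 2, ((1 / Real.sqrt 2 : ℝ) : ℂ) ^ m • startKet b u := by
  ext x
  rw [run_pauliXs O _ ((List.nodup_finRange _).filter _), run_hadamards O _ (List.nodup_finRange _),
    List.length_finRange, Finset.sum_apply]
  have hiff : (∀ w : Wire (n + 1) m, (∀ i ∈ List.finRange m, w ≠ phase i) →
      (if w ∈ ((List.finRange (n + 1)).filter (fun i => u i = 1)).map state then x w + 1 else x w) =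
        0) ↔ x = cfg (fun i => x (phase i)) 0 0 0 u 0 := by
    constructor
    · intro h
      ext w
      have key : ∀ w : Wire (n + 1) m, (∀ i, w ≠ phase i) → (∀ i, w ≠ state i) → x w = 0 := by
        intro w h1 h2
        have := h w (fun i _ => h1 i)
        rwa [if_neg] at this
        simp only [List.mem_map, not_exists, not_and]
        exact fun i _ hi => h2 i hi.symm
      cases w with
      | phase i => rfl
      | flag => exact congrArg _ (key flag (by simp) (by simp))
      | neighbour i => exact congrArg _ (key (neighbour i) (by simp) (by simp))
      | ancilla => exact congrArg _ (key ancilla (by simp) (by simp))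
      | angle => exact congrArg _ (key Wire.angle (by simp) (by simp))
      | state i =>
        have := h (state i) (by simp)
        have hu : u i = 0 ∨ u i = 1 := by omega
        have hx : ∀ c : Fin 2, c + 1 = 0 → c = 1 := by decide
        rcases hu with hu | hu
        · simp [hu] at this
          simp [cfg, hu, this]
        · simp [hu] at this
          simp [cfg, hu, hx _ this]
    · intro h w hw
      rw [h]
      cases w with
      | phase i => exact absurd rfl (hw i (by simp))
      | flag => simp [cfg]
      | neighbour i => simp [cfg]
      | ancilla => simp [cfg]
      | angle => simp [cfg]
      | state i =>
        have hu : u i = 0 ∨ u i = 1 := by omega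
        rcases hu with hu | hu <;> simp [cfg, hu]
  simp only [Pi.smul_apply, startKet, ket_apply, smul_eq_mul]
  by_cases h : x = cfg (fun i => x (phase i)) 0 0 0 u 0
  · rw [if_pos (hiff.2 h), Finset.sum_eq_single (fun i => x (phase i)), if_pos h, mul_one]
    · intro b _ hb
      rw [if_neg, mul_zero]
      intro h'
      apply hb
      rw [h']
      rfl
    · simp
  · rw [if_neg (fun h' => h (hiff.1 h')), Finset.sum_eq_zero]
    intro b _
    rw [if_neg, mul_zero]
    intro h'
    apply h
    rw [h']
    rfl

end ControlledWalk

/-! ### The output of a run -/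

section RunProbability

variable {n m : ℕ} {G : GluedTrees n} (O : MatrixOracles G)

theorem sum_norm_runCircuit_sq_of_ctrl {W : Type} [Fintype W] [DecidableEq W]
    (P : (W → Fin 2) → Prop) [DecidablePred P] (c : List (Gate W (n + 1)))
    (hc : ∀ g ∈ c, ∃ pos neg t U, g = .ctrl pos neg t U ∧ ∀ x b, P (Function.update x t b) ↔ P x)
    (ψ : (W → Fin 2) → ℂ) :
    (∑ x, if P x then ‖runCircuit O c ψ x‖ ^ 2 else 0) = ∑ x, if P x then ‖ψ x‖ ^ 2 else 0 := by
  induction c generalizing ψ with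
  | nil => rfl
  | cons g c ih =>
    obtain ⟨pos, neg, t, U, rfl, hP⟩ := hc g (by simp)
    rw [runCircuit_cons, ih (fun g hg => hc g (by simp [hg])), sum_norm_ctrl_sq O pos neg t U P hP]

theorem runOutput_update_phase {k : ℕ} (x : Wire k m → Fin 2) (q : Fin m) (b : Fin 2) :
    runOutput (Function.update x (phase q) b) = runOutput x := by
  unfold runOutput
  have h : (∀ w : Wire k m, w.isAncilla → Function.update x (phase q) b w = 0) ↔
      ∀ w : Wire k m, w.isAncilla → x w = 0 := by
    refine forall₂_congr fun w hw => ?_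
    rw [Function.update_of_ne]
    rintro rfl
    simp [isAncilla] at hw
  have hs : ∀ i, Function.update x (phase q) b (state i) = x (state i) := fun i =>
    Function.update_of_ne (by simp) _ _
  simp only [h, hs]

theorem exists_phase_of_mem_inverseQFTCircuit {k : ℕ} {g : Gate (Wire k m) k}
    (hg : g ∈ inverseQFTCircuit) : ∃ pos neg q U, g = .ctrl pos neg (phase q) U := by
  simp only [inverseQFTCircuit, swapGates, List.mem_append, List.mem_flatMap, List.mem_map,
    List.mem_cons, List.not_mem_nil, or_false] at hg
  rcases hg with ⟨i, _, rfl | rfl | rfl⟩ | ⟨i, _, ⟨j, _, rfl⟩ | rfl⟩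
  all_goals exact ⟨_, _, _, _, rfl⟩

/-- Every gate here targets a phase qubit and so preserves the marginal of the output. That the
circuit implements a Fourier transform is not needed. -/
theorem sum_norm_inverseQFTCircuit_sq (v : Bits (n + 1)) (ψ : QState n m) :
    (∑ x, if runOutput x = some v then ‖runCircuit O inverseQFTCircuit ψ x‖ ^ 2 else 0) =
      ∑ x, if runOutput x = some v then ‖ψ x‖ ^ 2 else 0 := by
  refine sum_norm_runCircuit_sq_of_ctrl O (fun x => runOutput x = some v) _ (fun g hg => ?_) ψ
  obtain ⟨pos, neg, q, U, rfl⟩ := exists_phase_of_mem_inverseQFTCircuit hg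
  exact ⟨pos, neg, phase q, U, rfl, fun x b => by rw [runOutput_update_phase]⟩

theorem sum_norm_finalState_sq : ∑ x, ‖finalState O m x‖ ^ 2 = 1 := by
  rw [finalState, sum_norm_runCircuit_sq]
  simp [ket_apply, apply_ite]

/-- The state before the inverse Fourier transform. -/
def preFourier (m : ℕ) (u : Bits (n + 1)) : QState n m :=
  ∑ b : Fin m → Fin 2, ((1 / Real.sqrt 2 : ℝ) : ℂ) ^ m •
    (walkLin O ^ (finFunctionFinEquiv b : ℕ)) (startKet b u)

theorem run_beforeFourier (u : Bits (n + 1)) :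
    runCircuit O ((List.finRange m).map (fun i => .ctrl ∅ ∅ (phase i) _root_.hadamard) ++
      ((List.finRange (n + 1)).filter (fun i => u i = 1)).map
        (fun i => .ctrl ∅ ∅ (state i) pauliX) ++
      (List.finRange m).flatMap (fun i : Fin m =>
        (List.replicate (2 ^ (i : ℕ)) (controlledWalk i)).flatten)) (ket 0) = preFourier O m u := by
  rw [runCircuit_append, runCircuit_append, run_preparation, ← circuitLin_apply, map_sum, preFourier]
  refine Finset.sum_congr rfl fun b _ => ?_
  rw [map_smul, circuitLin_apply, run_controlledPowers O _ (suppPhase_startKet b u)]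
  congr 3

theorem finalState_eq : finalState O m = runCircuit O inverseQFTCircuit (preFourier O m G.entrance) := by
  rw [finalState, qpeCircuit, runCircuit_append, run_beforeFourier]

/-- Qubitization applied to the coordinate functional at the EXIT. For t = 1 the Chebyshev recursion
starts from zero and stays zero, so the angle qubit is clean in the relevant component. -/
theorem walkLin_pow_startKet_apply (hn : 2 ≤ n) (b : Fin m → Fin 2) (t : Fin 2) (z : ℕ) :
    (walkLin O ^ z) (startKet b G.entrance) (cfg b 0 0 0 G.exit t) =
      if t = 0 then (colAmp n z 0 : ℂ) else 0 := by
  have h := functional_pow_walk (U := encodingLin O) (R := reflLin) (e := fun u => startKet b u)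
    (H := fun v u => ((1 / 3 : ℝ) : ℂ) * G.adj v u) (encodingLin_encodingLin O)
    (reflLin_startKet b) (encodingLin_add_reflLin O b) (LinearMap.proj (cfg b 0 0 0 G.exit t))
    (fun ψ => by
      rw [LinearMap.proj_apply, LinearMap.proj_apply, reflLin_apply,
        if_pos (ancZero_cfg.2 ⟨rfl, rfl, rfl⟩)])
  change (∀ u, (walkLin O ^ 1) (startKet b u) (cfg b 0 0 0 G.exit t) = ∑ v, _ * (walkLin O ^ 0)
    (startKet b v) (cfg b 0 0 0 G.exit t)) ∧ ∀ z u, (walkLin O ^ (z + 2)) (startKet b u)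
    (cfg b 0 0 0 G.exit t) = 2 * ∑ v, _ * (walkLin O ^ (z + 1)) (startKet b v)
    (cfg b 0 0 0 G.exit t) - (walkLin O ^ z) (startKet b u) (cfg b 0 0 0 G.exit t) at h
  by_cases ht : t = 0
  · subst ht
    rw [if_pos rfl]
    refine G.chebyshevRow_entrance hn
      (fun z u => (walkLin O ^ z) (startKet b u) (cfg b 0 0 0 G.exit 0)) ?_ h.1 h.2 z
    intro u
    simp only [pow_zero, Module.End.one_apply, startKet, ket_apply, cfg_inj]
    simp [eq_comm]
  · rw [if_neg ht]
    have key : ∀ z, (∀ u, (walkLin O ^ z) (startKet b u) (cfg b 0 0 0 G.exit t) = 0) ∧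
        ∀ u, (walkLin O ^ (z + 1)) (startKet b u) (cfg b 0 0 0 G.exit t) = 0 := by
      intro z
      induction z with
      | zero =>
        have h0 : ∀ u, (walkLin O ^ 0) (startKet b u) (cfg b 0 0 0 G.exit t) = 0 := by
          intro u
          simp only [pow_zero, Module.End.one_apply, startKet, ket_apply, cfg_inj]
          simp [ht]
        refine ⟨h0, fun u => ?_⟩
        rw [zero_add, h.1]
        simp only [h0, mul_zero, Finset.sum_const_zero]
      | succ z ih =>
        refine ⟨ih.2, fun u => ?_⟩
        rw [h.2]
        simp [ih.1, ih.2]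
    exact (key z).1 _

theorem preFourier_apply (hn : 2 ≤ n) (b : Fin m → Fin 2) (t : Fin 2) :
    preFourier O m G.entrance (cfg b 0 0 0 G.exit t) =
      if t = 0 then
        ((1 / Real.sqrt 2 : ℝ) : ℂ) ^ m * (colAmp n (finFunctionFinEquiv b : ℕ) 0 : ℂ) else 0 := by
  rw [preFourier, Finset.sum_apply, Finset.sum_eq_single b]
  · rw [Pi.smul_apply, walkLin_pow_startKet_apply O hn]
    split_ifs <;> simp
  · intro b' _ hb'
    rw [Pi.smul_apply, (suppPhase_startKet b' _).walkLin_pow O _ _ (fun h => hb' h.symm), smul_zero]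
  · simp

theorem runOutput_eq_some_iff {k : ℕ} (x : Wire k m → Fin 2) (v : Bits k) :
    runOutput x = some v ↔ ∃ p : (Fin m → Fin 2) × Fin 2, cfg p.1 0 0 0 v p.2 = x := by
  constructor
  · intro h
    unfold runOutput at h
    split_ifs at h with hx
    have hv : (fun i => x (state i)) = v := Option.some.inj h
    refine ⟨(fun i => x (phase i), x Wire.angle), ?_⟩
    have hx' := hx
    rw [eq_cfg x] at hx'
    obtain ⟨h1, h2, h3⟩ := ancZero_cfg.1 hx'
    conv_rhs => rw [eq_cfg x, h1, h2, h3, hv]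
  · rintro ⟨p, rfl⟩
    rw [runOutput, if_pos (ancZero_cfg.2 ⟨rfl, rfl, rfl⟩)]
    rfl

theorem sum_runOutput {k : ℕ} (v : Bits k) (f : (Wire k m → Fin 2) → ℝ) :
    (∑ x, if runOutput x = some v then f x else 0) =
      ∑ b : Fin m → Fin 2, ∑ t : Fin 2, f (cfg b 0 0 0 v t) := by
  rw [← Fintype.sum_prod_type' (f := fun (b : Fin m → Fin 2) t => f (cfg b 0 0 0 v t))]
  symm
  refine Fintype.sum_of_injective (fun p : (Fin m → Fin 2) × Fin 2 => cfg p.1 0 0 0 v p.2) ?_ _ _ ?_ ?_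
  · intro p q h
    have := cfg_inj.1 h
    exact Prod.ext this.1 this.2.2.2.2.2
  · intro x hx
    rw [if_neg]
    exact fun h => hx ((runOutput_eq_some_iff x v).1 h)
  · intro p
    rw [if_pos ((runOutput_eq_some_iff _ v).2 ⟨p, rfl⟩)]

/-- The phase register in state b selects the power of the walk with binary expansion b. The squared
amplitude 2^(-m) turns the sum over b into the time average. -/
theorem runProb_eq_walkAverage (hn : 2 ≤ n) (m : ℕ) :
    runProb O m G.exit = walkAverage n (2 ^ m) := by
  unfold runProb
  rw [finalState_eq, sum_norm_inverseQFTCircuit_sq, sum_runOutput]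
  simp only [preFourier_apply O hn, Fin.sum_univ_two, if_true, Fin.isValue, one_ne_zero, if_false,
    norm_zero, norm_mul, norm_pow, Complex.norm_real, Real.norm_eq_abs]
  have h2 : (|1 / Real.sqrt 2| ^ m) ^ 2 = 1 / 2 ^ m := by
    rw [← pow_mul, mul_comm, pow_mul, sq_abs, div_pow, Real.sq_sqrt (by norm_num)]
    simp
  simp only [mul_pow, h2, sq_abs, ne_eq, OfNat.ofNat_ne_zero, not_false_eq_true, zero_pow, add_zero]
  rw [← Finset.mul_sum, Equiv.sum_comp finFunctionFinEquiv
    (fun z : Fin (2 ^ m) => colAmp n (z : ℕ) 0 ^ 2), walkAverage,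
    Fin.sum_univ_eq_sum_range (fun z => colAmp n z 0 ^ 2)]
  push_cast
  ring

end RunProbability

/-! ### Query count and running time -/

section Resources

variable {k m : ℕ}

theorem sum_two_pow_finRange (L : ℕ) :
    ((List.finRange m).map fun i : Fin m => 2 ^ (i : ℕ) * L).sum = (2 ^ m - 1) * L := by
  rw [← List.ofFn_eq_map, List.sum_ofFn, ← Finset.sum_mul, Fin.sum_univ_eq_sum_range (fun i => 2 ^ i),
    Nat.geomSum_eq le_rfl]
  simp

theorem queryCount_append {W : Type} (c d : List (Gate W k)) :
    queryCount (c ++ d) = queryCount c + queryCount d := List.countP_append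

theorem queryCount_eq_zero {W : Type} {c : List (Gate W k)}
    (h : ∀ g ∈ c, ∃ pos neg t U, g = .ctrl pos neg t U) : queryCount c = 0 := by
  refine List.countP_eq_zero.2 fun g hg => ?_
  obtain ⟨pos, neg, t, U, rfl⟩ := h g hg
  simp [Gate.isQuery]

theorem queryCount_controlledWalk (q : Fin m) :
    queryCount (controlledWalk q : List (Gate (Wire k m) k)) = 6 := by
  unfold controlledWalk
  have h : queryCount ((List.finRange k).flatMap
      (fun i => swapGates {phase q} (neighbour i) (state i)) : List (Gate (Wire k m) k)) = 0 := by
    refine queryCount_eq_zero fun g hg => ?_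
    simp only [swapGates, List.mem_flatMap, List.mem_cons, List.not_mem_nil, or_false] at hg
    obtain ⟨i, _, rfl | rfl | rfl⟩ := hg <;> exact ⟨_, _, _, _, rfl⟩
  simp only [queryCount_append, h]
  rfl

theorem queryCount_qpeCircuit (u : Bits k) : queryCount (qpeCircuit k m u) = 6 * (2 ^ m - 1) := by
  unfold qpeCircuit
  have h1 : queryCount ((List.finRange m).map fun i => Gate.ctrl ∅ ∅ (phase i) _root_.hadamard :
      List (Gate (Wire k m) k)) = 0 := by
    refine queryCount_eq_zero fun g hg => ?_
    obtain ⟨i, _, rfl⟩ := List.mem_map.1 hg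
    exact ⟨_, _, _, _, rfl⟩
  have h2 : queryCount (((List.finRange k).filter (fun i => u i = 1)).map
      fun i => Gate.ctrl ∅ ∅ (state i) pauliX : List (Gate (Wire k m) k)) = 0 := by
    refine queryCount_eq_zero fun g hg => ?_
    obtain ⟨i, _, rfl⟩ := List.mem_map.1 hg
    exact ⟨_, _, _, _, rfl⟩
  have h3 : queryCount (inverseQFTCircuit : List (Gate (Wire k m) k)) = 0 := by
    refine queryCount_eq_zero fun g hg => ?_
    obtain ⟨pos, neg, q, U, rfl⟩ := exists_phase_of_mem_inverseQFTCircuit hg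
    exact ⟨_, _, _, _, rfl⟩
  have hrep : ∀ (r : ℕ) (q : Fin m), queryCount (List.replicate r
      (controlledWalk q : List (Gate (Wire k m) k))).flatten = r * 6 := by
    intro r q
    induction r with
    | zero => rfl
    | succ r ih =>
      rw [List.replicate_succ, List.flatten_cons, queryCount_append, ih, queryCount_controlledWalk]
      ring
  have h4 : ∀ l : List (Fin m), queryCount (l.flatMap fun i : Fin m =>
      (List.replicate (2 ^ (i : ℕ)) (controlledWalk i : List (Gate (Wire k m) k))).flatten) =
      (l.map fun i : Fin m => 2 ^ (i : ℕ) * 6).sum := by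
    intro l
    induction l with
    | nil => rfl
    | cons a l ih =>
      rw [List.flatMap_cons, queryCount_append, ih, hrep, List.map_cons, List.sum_cons]
  rw [queryCount_append, queryCount_append, queryCount_append, h1, h2, h3, h4, sum_two_pow_finRange]
  ring

theorem circuitTime_le {W : Type} {c : List (Gate W k)} {B : ℕ} (h : ∀ g ∈ c, g.time ≤ B) :
    circuitTime c ≤ c.length * B := by
  unfold circuitTime
  have := List.sum_le_card_nsmul (c.map Gate.time) B (by
    intro t ht
    obtain ⟨g, hg, rfl⟩ := List.mem_map.1 ht
    exact h g hg)
  simpa using this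

theorem card_isAncilla_le :
    (Finset.univ.filter fun w : Wire k m => w.isAncilla).card ≤ k + 2 := by
  have hsub : (Finset.univ.filter fun w : Wire k m => w.isAncilla) ⊆
      Finset.univ.image (Sum.elim neighbour (fun c : Fin 2 => if c = 0 then flag else ancilla) :
        Fin k ⊕ Fin 2 → Wire k m) := by
    intro w hw
    have hw : w.isAncilla = true := by simpa using hw
    rw [Finset.mem_image]
    cases w with
    | neighbour i => exact ⟨Sum.inl i, Finset.mem_univ _, rfl⟩
    | flag => exact ⟨Sum.inr 0, Finset.mem_univ _, rfl⟩
    | ancilla => exact ⟨Sum.inr 1, Finset.mem_univ _, rfl⟩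
    | phase i => simp [isAncilla] at hw
    | state i => simp [isAncilla] at hw
    | angle => simp [isAncilla] at hw
  refine (Finset.card_le_card hsub).trans (Finset.card_image_le.trans ?_)
  simp

theorem card_wire_le : Fintype.card (Wire k m) ≤ m + 2 * k + 3 := by
  let f : Wire k m → Fin m ⊕ Fin k ⊕ Fin k ⊕ Fin 3 := fun w => match w with
    | phase i => .inl i
    | neighbour i => .inr (.inl i)
    | state i => .inr (.inr (.inl i))
    | flag => .inr (.inr (.inr 0))
    | ancilla => .inr (.inr (.inr 1))
    | Wire.angle => .inr (.inr (.inr 2))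
  have hf : Function.Injective f := by
    intro w w' h
    cases w <;> cases w' <;> simp_all [f]
  have := Fintype.card_le_of_injective f hf
  simp at this
  omega

theorem time_swapGates_le {c : Finset (Wire k m)} (hc : c.card ≤ 1) {x y : Wire k m}
    {g : Gate (Wire k m) k} (hg : g ∈ swapGates c x y) : g.time ≤ 9 := by
  have key : ∀ (w t : Wire k m), (Gate.ctrl (insert w c) ∅ t pauliX : Gate (Wire k m) k).time ≤ 9 := by
    intro w t
    have h := Finset.card_insert_le w c
    simp only [Gate.time, Finset.card_empty]
    calc _ ≤ 3 ^ 2 := Nat.pow_le_pow_left (by omega) 2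
      _ = 9 := by norm_num
  simp only [swapGates, List.mem_cons, List.not_mem_nil, or_false] at hg
  rcases hg with rfl | rfl | rfl <;> exact key _ _

theorem time_le_of_mem_controlledWalk {q : Fin m} {g : Gate (Wire k m) k}
    (hg : g ∈ controlledWalk q) : g.time ≤ (k + 3) ^ 2 := by
  have h9 : 9 ≤ (k + 3) ^ 2 := Nat.pow_le_pow_left (show 3 ≤ k + 3 by omega) 2
  simp only [controlledWalk, stateTransformation, stateTransformationInv, List.mem_append,
    List.mem_flatMap, List.mem_cons, List.not_mem_nil, or_false] at hg
  rcases hg with (((((rfl | rfl) | (rfl | rfl | rfl | rfl)) | ⟨i, _, hi⟩) | hs) |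
    (rfl | rfl | rfl | rfl))
  · have := card_isAncilla_le (k := k) (m := m)
    simp only [Gate.time, Finset.card_empty]
    exact Nat.pow_le_pow_left (by omega) 2
  all_goals first
    | exact (time_swapGates_le (by simp) hi).trans h9
    | exact (time_swapGates_le (by simp) hs).trans h9
    | (simp only [Gate.time, Finset.card_empty, Finset.card_singleton]; omega)

theorem time_le_of_mem_qpeCircuit {u : Bits k} {g : Gate (Wire k m) k}
    (hg : g ∈ qpeCircuit k m u) : g.time ≤ (k + 3) ^ 2 := by
  have h9 : 9 ≤ (k + 3) ^ 2 := Nat.pow_le_pow_left (show 3 ≤ k + 3 by omega) 2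
  simp only [qpeCircuit, inverseQFTCircuit, List.mem_append, List.mem_flatMap, List.mem_map,
    List.mem_flatten, List.mem_replicate, List.mem_cons, List.not_mem_nil, or_false] at hg
  rcases hg with ((⟨i, _, rfl⟩ | ⟨i, _, rfl⟩) | ⟨i, _, l, ⟨_, rfl⟩, hl⟩) |
    (⟨i, _, hi⟩ | ⟨i, _, ⟨j, _, rfl⟩ | rfl⟩)
  · simp only [Gate.time, Finset.card_empty]; omega
  · simp only [Gate.time, Finset.card_empty]; omega
  · exact time_le_of_mem_controlledWalk hl
  · exact (time_swapGates_le (by simp) hi).trans h9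
  · simp only [Gate.time, Finset.card_empty, Finset.card_singleton]; omega
  · simp only [Gate.time, Finset.card_empty]; omega

theorem length_flatMap_le {α β : Type*} (l : List α) (f : α → List β) {B : ℕ}
    (h : ∀ a ∈ l, (f a).length ≤ B) : (l.flatMap f).length ≤ l.length * B := by
  rw [List.length_flatMap]
  have := List.sum_le_card_nsmul (l.map fun a => (f a).length) B (by
    intro t ht
    obtain ⟨a, ha, rfl⟩ := List.mem_map.1 ht
    exact h a ha)
  simpa using this

theorem length_controlledWalk (q : Fin m) :
    (controlledWalk q : List (Gate (Wire k m) k)).length = 3 * k + 13 := by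
  simp [controlledWalk, stateTransformation, stateTransformationInv, swapGates, List.length_flatMap]
  ring

theorem length_inverseQFTCircuit_le :
    (inverseQFTCircuit : List (Gate (Wire k m) k)).length ≤ m * (m + 4) := by
  unfold inverseQFTCircuit
  rw [List.length_append]
  have h1 := length_flatMap_le ((List.finRange m).filter (fun i => i < i.rev))
    (fun i => (swapGates ∅ (phase i) (phase i.rev) : List (Gate (Wire k m) k))) (B := 3)
    (fun _ _ => le_rfl)
  have h2 := length_flatMap_le (List.finRange m) (fun i => ((List.finRange m).filter (fun j => j < i)).map
      (fun j => (.ctrl {phase j} ∅ (phase i) (phaseGate (-(Real.pi / 2 ^ ((i : ℕ) - (j : ℕ))))) :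
        Gate (Wire k m) k)) ++ [.ctrl ∅ ∅ (phase i) _root_.hadamard]) (B := m + 1) (by
      intro i _
      have := List.length_filter_le (fun j => decide (j < i)) (List.finRange m)
      rw [List.length_finRange] at this
      simpa using this)
  have h3 := List.length_filter_le (fun i => decide (i < i.rev)) (List.finRange m)
  rw [List.length_finRange] at h2 h3
  refine (add_le_add h1 h2).trans ?_
  nlinarith

theorem length_qpeCircuit_le (u : Bits k) :
    (qpeCircuit k m u).length ≤ m + k + 2 ^ m * (3 * k + 13) + m * (m + 4) := by
  unfold qpeCircuit
  rw [List.length_append, List.length_append, List.length_append, List.length_map, List.length_map,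
    List.length_finRange]
  have h1 := List.length_filter_le (fun i => decide (u i = 1)) (List.finRange k)
  rw [List.length_finRange] at h1
  have h2 : ((List.finRange m).flatMap fun i : Fin m => (List.replicate (2 ^ (i : ℕ))
      (controlledWalk i : List (Gate (Wire k m) k))).flatten).length = (2 ^ m - 1) * (3 * k + 13) := by
    rw [List.length_flatMap, ← sum_two_pow_finRange]
    simp [List.length_flatten, length_controlledWalk]
  have h3 := length_inverseQFTCircuit_le (k := k) (m := m)
  rw [h2]
  have h4 : (2 ^ m - 1) * (3 * k + 13) ≤ 2 ^ m * (3 * k + 13) :=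
    Nat.mul_le_mul_right _ (Nat.sub_le _ _)
  omega

/-- The number of gates times the cost (k + 3)² of the most expensive one, the reflection with its k
+ 2 controls. Crude, but polynomial in k and 2^m. -/
theorem totalTime_le (u : Bits k) (R : ℕ) :
    totalTime k m u R ≤ R * (8 * (k + 3) ^ 3 * (2 ^ m) ^ 2) := by
  unfold totalTime
  refine Nat.mul_le_mul_left _ ?_
  have h1 := circuitTime_le (c := qpeCircuit k m u) (fun g hg => time_le_of_mem_qpeCircuit hg)
  have h2 := length_qpeCircuit_le (m := m) u
  have h3 := card_wire_le (k := k) (m := m)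
  have hm : m + 1 ≤ 2 ^ m := Nat.lt_two_pow_self
  set M := 2 ^ m
  have hM : M ≤ M ^ 2 := Nat.le_self_pow two_ne_zero M
  have hmM : m * m ≤ M ^ 2 := by nlinarith
  have h4 : (qpeCircuit k m u).length ≤ M ^ 2 * (4 * k + 19) := by
    nlinarith [Nat.zero_le k, Nat.mul_le_mul_right k hM, Nat.mul_le_mul_right k (show 1 ≤ M ^ 2 by nlinarith)]
  have h5 : circuitTime (qpeCircuit k m u) ≤ M ^ 2 * (4 * k + 19) * (k + 3) ^ 2 :=
    h1.trans (Nat.mul_le_mul_right _ h4)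
  have h6 : Fintype.card (Wire k m) + 1 ≤ M ^ 2 * (2 * k + 5) := by
    nlinarith [Nat.mul_le_mul_right k (show 1 ≤ M ^ 2 by nlinarith)]
  calc circuitTime (qpeCircuit k m u) + Fintype.card (Wire k m) + 1
      ≤ M ^ 2 * (4 * k + 19) * (k + 3) ^ 2 + M ^ 2 * (2 * k + 5) := by omega
    _ = M ^ 2 * ((4 * k + 19) * (k + 3) ^ 2 + (2 * k + 5)) := by ring
    _ ≤ M ^ 2 * (8 * (k + 3) ^ 3) := Nat.mul_le_mul_left _ (by nlinarith [Nat.zero_le (k ^ 2), Nat.zero_le (k ^ 3)])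
    _ = _ := by ring

end Resources

/-! ### Repeated runs -/

section Repetition

variable {n m : ℕ} {G : GluedTrees n} (O : MatrixOracles G)

/-- Whatever passes the degree filter is the EXIT, so an earlier output cannot mislead and a single
good run suffices. -/
theorem answer_eq_exit (hn : 1 ≤ n) {R : ℕ} {ω : Fin R → Wire (n + 1) m → Fin 2} {i : Fin R}
    (h : runOutput (ω i) = some G.exit) : answer G ω = some G.exit := by
  unfold answer
  cases hf : (List.ofFn ω).findSome? fun x =>
      (runOutput x).filter fun v => G.deg v = 2 ∧ v ≠ G.entrance with
  | none =>
    have := List.findSome?_eq_none_iff.1 hf (ω i) (List.mem_ofFn.2 ⟨i, rfl⟩)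
    rw [h, Option.filter_some, if_pos] at this
    · cases this
    · simp [(G.deg_eq_two_iff hn G.exit).2 (Or.inr rfl), G.exit_ne_entrance hn]
  | some v =>
    obtain ⟨x, _, hx⟩ := List.exists_of_findSome?_eq_some hf
    obtain ⟨_, hv⟩ := Option.filter_eq_some_iff.1 hx
    have hv : G.deg v = 2 ∧ v ≠ G.entrance := by simpa using hv
    rw [((G.deg_eq_two_iff hn v).1 hv.1).resolve_left hv.2]

/-- Expand both R-th powers over sequences of outcomes. The weight `q` vanishes on good outcomes, so
a sequence whose answer is not the EXIT has equal products and contributes nothing. -/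
theorem one_sub_pow_le_successProb (hn : 1 ≤ n) (R : ℕ) :
    1 - (1 - runProb O m G.exit) ^ R ≤ successProb O m R := by
  let p : (Wire (n + 1) m → Fin 2) → ℝ := fun x => ‖finalState O m x‖ ^ 2
  let q : (Wire (n + 1) m → Fin 2) → ℝ := fun x => if runOutput x = some G.exit then 0 else p x
  have hp : ∑ x, p x = 1 := sum_norm_finalState_sq O
  have hq : ∑ x, q x = 1 - runProb O m G.exit := by
    rw [← hp, runProb, ← Finset.sum_sub_distrib]
    refine Finset.sum_congr rfl fun x _ => ?_
    simp only [q, p]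
    split_ifs <;> simp
  have hq0 : ∀ x, 0 ≤ q x := fun x => by
    simp only [q, p]
    split_ifs <;> positivity
  have hR : (1 : ℝ) - (1 - runProb O m G.exit) ^ R = (∑ x, p x) ^ R - (∑ x, q x) ^ R := by
    rw [hp, hq, one_pow]
  rw [hR, Fintype.sum_pow, Fintype.sum_pow, ← Finset.sum_sub_distrib, successProb]
  refine Finset.sum_le_sum fun ω _ => ?_
  split_ifs with ha
  · have : 0 ≤ ∏ i, q (ω i) := Finset.prod_nonneg fun i _ => hq0 _
    linarith
  · have : ∀ i, q (ω i) = p (ω i) := fun i => if_neg fun h => ha (answer_eq_exit hn h)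
    simp [this]

theorem runProb_le_one (v : Bits (n + 1)) : runProb O m v ≤ 1 := by
  rw [← sum_norm_finalState_sq O (m := m), runProb]
  refine Finset.sum_le_sum fun x _ => ?_
  split_ifs
  · exact le_rfl
  · positivity

end Repetition

/-! ### The size of the phase register and the main theorem -/

/-- The size of the phase register that resolves the gap. -/
def phaseSize (n : ℕ) : ℕ := ⌈Real.logb 2 (3 * Real.pi / hopGap n)⌉₊

theorem two_mul_le_div_hopGap {n : ℕ} (hn : 2 ≤ n) : 2 * (n : ℝ) ≤ 3 * Real.pi / hopGap n := by
  have hn0 : (0 : ℝ) < n := by exact_mod_cast (by omega : 0 < n)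
  have h := (hopGap_le hn).2
  rw [le_div_iff₀ (hopGap_pos hn), mul_comm]
  rwa [le_div_iff₀ (by positivity)] at h

theorem div_hopGap_le_two_pow {n m : ℕ} (hn : 2 ≤ n) (hm : phaseSize n ≤ m) :
    3 * Real.pi / hopGap n ≤ ((2 ^ m : ℕ) : ℝ) := by
  have h0 : 0 < 3 * Real.pi / hopGap n := div_pos (by positivity) (hopGap_pos hn)
  have h1 : Real.logb 2 (3 * Real.pi / hopGap n) ≤ m := (Nat.le_ceil _).trans (by exact_mod_cast hm)
  rw [Real.logb_le_iff_le_rpow one_lt_two h0, Real.rpow_natCast] at h1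
  exact_mod_cast h1

theorem two_mul_le_two_pow {n m : ℕ} (hn : 2 ≤ n) (hm : phaseSize n ≤ m) : 2 * n ≤ 2 ^ m := by
  exact_mod_cast (two_mul_le_div_hopGap hn).trans (div_hopGap_le_two_pow hn hm)

theorem two_pow_phaseSize_le {n : ℕ} (hn : 2 ≤ n) : (2 : ℝ) ^ phaseSize n ≤ 100 * (n : ℝ) ^ 3 := by
  have hn2 : (2 : ℝ) ≤ n := by exact_mod_cast hn
  have h0 : 0 < 3 * Real.pi / hopGap n := div_pos (by positivity) (hopGap_pos hn)
  have h1 : 0 ≤ Real.logb 2 (3 * Real.pi / hopGap n) :=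
    Real.logb_nonneg one_lt_two (by linarith [two_mul_le_div_hopGap hn])
  have h2 : (phaseSize n : ℝ) ≤ Real.logb 2 (3 * Real.pi / hopGap n) + 1 := (Nat.ceil_lt_add_one h1).le
  -- From the gap bound 1/(5n³), as 15π < 50. The ceiling costs another factor 2.
  have h3 : 3 * Real.pi / hopGap n ≤ 50 * (n : ℝ) ^ 3 := by
    have hg := hopGap_ge hn
    rw [div_le_iff₀ (by positivity)] at hg
    rw [div_le_iff₀ (hopGap_pos hn)]
    nlinarith [Real.pi_lt_d2]
  calc (2 : ℝ) ^ phaseSize n = (2 : ℝ) ^ (phaseSize n : ℝ) := (Real.rpow_natCast _ _).symm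
    _ ≤ (2 : ℝ) ^ (Real.logb 2 (3 * Real.pi / hopGap n) + 1) :=
        Real.rpow_le_rpow_of_exponent_le one_le_two h2
    _ = 3 * Real.pi / hopGap n * 2 := by
        rw [Real.rpow_add two_pos, Real.rpow_logb two_pos (by norm_num) h0, Real.rpow_one]
    _ ≤ 100 * (n : ℝ) ^ 3 := by linarith

theorem phaseSize_le {n : ℕ} (hn : 2 ≤ n) : (phaseSize n : ℝ) ≤ 20 * Real.log n := by
  have hn2 : (2 : ℝ) ≤ n := by exact_mod_cast hn
  have h1 : Real.log 2 ≤ Real.log n := Real.log_le_log two_pos hn2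
  have h2 : (2 : ℝ) ^ phaseSize n ≤ (n : ℝ) ^ 10 := by
    refine (two_pow_phaseSize_le hn).trans ?_
    have : (2 : ℝ) ^ 7 ≤ (n : ℝ) ^ 7 := pow_le_pow_left₀ (by norm_num) hn2 7
    calc 100 * (n : ℝ) ^ 3 ≤ (n : ℝ) ^ 7 * (n : ℝ) ^ 3 := by
          gcongr
          linarith
      _ = _ := by ring
  have h3 := Real.log_le_log (by positivity) h2
  rw [Real.log_pow, Real.log_pow] at h3
  have h4 := Real.log_two_gt_d9
  push_cast at h3
  nlinarith [Nat.cast_nonneg (α := ℝ) (phaseSize n)]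

theorem exists_pos_le_of_finset {ι : Type*} (s : Finset ι) (f : ι → ℝ) (hf : ∀ i ∈ s, 0 < f i) :
    ∃ c : ℝ, 0 < c ∧ ∀ i ∈ s, c ≤ f i := by
  rcases s.eq_empty_or_nonempty with rfl | hs
  · exact ⟨1, one_pos, by simp⟩
  · obtain ⟨j, hj, hmin⟩ := s.exists_min_image f hs
    exact ⟨f j, hf j hj, hmin⟩

/-- For large n this is the asymptotic bound; for the finitely many remaining n a minimum of
positive numbers. -/
theorem exists_le_walkAverage {γ : ℕ} (hγ : 1 ≤ γ) : ∃ c : ℝ, 0 < c ∧ ∀ n : ℕ, 2 ≤ n →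
    c / n ≤ walkAverage n (2 ^ (γ * phaseSize n)) := by
  obtain ⟨C, hC, hbound⟩ := exists_walkAverage_bounds
  have hm : ∀ n, phaseSize n ≤ γ * phaseSize n := fun n => Nat.le_mul_of_pos_left _ hγ
  -- Beyond this N the error C/n is at most 1/32, which leaves 3/32 - 1/32 = 1/16.
  obtain ⟨N, hN⟩ := exists_nat_ge (32 * C)
  obtain ⟨c, hc, hmin⟩ := exists_pos_le_of_finset (Finset.Icc 2 N)
    (fun n => n * walkAverage n (2 ^ (γ * phaseSize n))) (fun n hn => by
      have hn2 := (Finset.mem_Icc.1 hn).1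
      have : (0 : ℝ) < n := by exact_mod_cast (by omega : 0 < n)
      exact mul_pos this (walkAverage_pos hn2 (two_mul_le_two_pow hn2 (hm n))))
  refine ⟨min c (1 / 16), by positivity, fun n hn => ?_⟩
  have hn0 : (0 : ℝ) < n := by exact_mod_cast (by omega : 0 < n)
  rw [div_le_iff₀ hn0, mul_comm]
  by_cases hnN : n ≤ N
  · exact (min_le_left _ _).trans (hmin n (Finset.mem_Icc.2 ⟨hn, hnN⟩))
  · have hNn : (N : ℝ) ≤ n := by exact_mod_cast (by omega : N ≤ n)
    have h := (hbound n hn _ (div_hopGap_le_two_pow hn (hm n))).1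
    refine (min_le_right _ _).trans ?_
    have h1 : n * (3 / (32 * (n : ℝ)) - C / (n : ℝ) ^ 2) = 3 / 32 - C / n := by
      field_simp
    have h2 : C / n ≤ 1 / 32 := by
      rw [div_le_div_iff₀ hn0 (by norm_num)]
      linarith
    have h3 := mul_le_mul_of_nonneg_left h hn0.le
    linarith

theorem one_sub_pow_ceil_le {p q ζ : ℝ} (hp : 0 < p) (hpq : p ≤ q) (hq : q ≤ 1) (hζ : 0 < ζ) :
    (1 - q) ^ ⌈Real.log (1 / ζ) / p⌉₊ ≤ ζ := by
  set R := ⌈Real.log (1 / ζ) / p⌉₊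
  have hR : Real.log (1 / ζ) ≤ R * p := (div_le_iff₀ hp).1 (Nat.le_ceil _)
  calc (1 - q) ^ R ≤ Real.exp (-p) ^ R :=
        pow_le_pow_left₀ (by linarith) (by linarith [Real.add_one_le_exp (-p)]) _
    _ = Real.exp (-(R * p)) := by rw [← Real.exp_nat_mul]; ring_nf
    _ ≤ Real.exp (-Real.log (1 / ζ)) := Real.exp_le_exp.2 (by linarith)
    _ = ζ := by rw [one_div, Real.log_inv, neg_neg, Real.exp_log hζ]

theorem le_logb_card_vertex {n : ℕ} (hn : 1 ≤ n) :
    (n : ℝ) ≤ Real.logb 2 (Fintype.card (Vertex n)) := by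
  have hcard : Fintype.card (Vertex n) = 2 * (2 ^ n - 1) := by simp
  have h2 : 2 ^ n ≤ Fintype.card (Vertex n) := by
    have : 2 ^ 1 ≤ 2 ^ n := Nat.pow_le_pow_right (by norm_num) hn
    omega
  have h3 : (2 : ℝ) ^ (n : ℝ) ≤ Fintype.card (Vertex n) := by
    rw [Real.rpow_natCast]
    exact_mod_cast h2
  rw [Real.le_logb_iff_rpow_le one_lt_two (lt_of_lt_of_le (by positivity) h3)]
  exact h3

theorem totalTime_phaseSize_le {n γ R : ℕ} (hn : 2 ≤ n) {B : ℝ} (hR : (R : ℝ) ≤ B * n)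
    (u : Bits (n + 1)) : (totalTime (n + 1) (γ * phaseSize n) u R : ℝ) ≤
      B * (216 * 100 ^ (2 * γ)) * (n : ℝ) ^ (4 + 6 * γ) := by
  have hn2 : (2 : ℝ) ≤ n := by exact_mod_cast hn
  have h1 : (totalTime (n + 1) (γ * phaseSize n) u R : ℝ) ≤
      R * (8 * ((n : ℝ) + 1 + 3) ^ 3 * (2 ^ (γ * phaseSize n)) ^ 2) := by
    exact_mod_cast totalTime_le u R
  have h2 : ((2 : ℝ) ^ (γ * phaseSize n)) ^ 2 ≤ (100 * (n : ℝ) ^ 3) ^ (2 * γ) := by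
    rw [← pow_mul, show γ * phaseSize n * 2 = phaseSize n * (2 * γ) by ring, pow_mul]
    exact pow_le_pow_left₀ (by positivity) (two_pow_phaseSize_le hn) _
  calc (totalTime (n + 1) (γ * phaseSize n) u R : ℝ)
      ≤ R * (8 * ((n : ℝ) + 1 + 3) ^ 3 * (2 ^ (γ * phaseSize n)) ^ 2) := h1
    _ ≤ (B * n) * (8 * (3 * (n : ℝ)) ^ 3 * (100 * (n : ℝ) ^ 3) ^ (2 * γ)) := by
        gcongr
        · exact (Nat.cast_nonneg R).trans hR
        · linarith
    _ = B * (216 * 100 ^ (2 * γ)) * (n : ℝ) ^ (4 + 6 * γ) := by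
        rw [mul_pow 100, ← pow_mul, pow_add, show 3 * (2 * γ) = 6 * γ by ring]
        ring

theorem mainTheorem2 :
    ∃ m₀ : ℕ → ℕ,
      -- the size of the phase register is determined by the gap, which depends on `n` only
      (∀ n : ℕ, 2 ≤ n → ∀ G : GluedTrees n,
        0 < G.colGap ∧ m₀ n = ⌈Real.logb 2 (3 * Real.pi / G.colGap)⌉₊) ∧
      -- a single run
      (∃ C : ℝ, 0 < C ∧ ∀ n : ℕ, 2 ≤ n →
        (m₀ n : ℝ) ≤ C * Real.log n ∧
        (∀ m, ∀ u : Bits (n + 1), queryCount (qpeCircuit (n + 1) m u) = 6 * (2 ^ m - 1)) ∧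
        (∀ u : Bits (n + 1),
          (queryCount (qpeCircuit (n + 1) (m₀ n) u) : ℝ) ≤ C * (n : ℝ) ^ 3) ∧
        ∀ G : GluedTrees n, ∀ m ≥ m₀ n,
          (∀ (a : ℕ) (U : Matrix (Bits a × Bits (n + 1)) (Bits a × Bits (n + 1)) ℂ),
            IsHermitianBlockEncoding (1 / 3) G.adj U →
              3 / (32 * (n : ℝ)) - C / (n : ℝ) ^ 2 ≤ jointProb m U G.entrance G.exit ∧
              jointProb m U G.entrance G.exit ≤ C / n ∧
              jointProb m U G.entrance G.exit ≤ postselectedProb m U G.entrance G.exit) ∧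
          (∀ O : MatrixOracles G,
            3 / (32 * (n : ℝ)) - C / (n : ℝ) ^ 2 ≤ runProb O m G.exit ∧
            runProb O m G.exit ≤ C / n)) ∧
      -- repeated runs find the EXIT in polynomial time
      (∀ γ : ℕ, 1 ≤ γ → ∃ C : ℝ, 0 < C ∧ ∃ d : ℕ, ∀ n : ℕ, 2 ≤ n → ∀ ζ : ℝ, 0 < ζ → ζ < 1 →
        ∃ R : ℕ, (R : ℝ) ≤ C * n * (1 + Real.log (1 / ζ)) ∧
          ∀ G : GluedTrees n,
            (∀ O : MatrixOracles G, 1 - ζ ≤ successProb O (γ * m₀ n) R) ∧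
            (totalTime (n + 1) (γ * m₀ n) G.entrance R : ℝ) ≤
              C * (n : ℝ) ^ d * (1 + Real.log (1 / ζ)) ∧
            (totalTime (n + 1) (γ * m₀ n) G.entrance R : ℝ) ≤
              C * Real.logb 2 (Fintype.card (Vertex n)) ^ d * (1 + Real.log (1 / ζ))) := by
  refine ⟨phaseSize, fun n hn G => ?_, ?_, fun γ hγ => ?_⟩
  · rw [G.colGap_eq]
    exact ⟨hopGap_pos hn, rfl⟩
  · obtain ⟨C, hC, hbound⟩ := exists_walkAverage_bounds
    -- The summand 600 covers the queries, 6 · 100 n³, and also the constant 20 of the register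
    -- size.
    refine ⟨C + 600, by positivity, fun n hn => ?_⟩
    have hn2 : (2 : ℝ) ≤ n := by exact_mod_cast hn
    have hlog : 0 ≤ Real.log n := Real.log_nonneg (by linarith)
    have hb : ∀ m ≥ phaseSize n, 3 / (32 * (n : ℝ)) - (C + 600) / (n : ℝ) ^ 2 ≤ walkAverage n (2 ^ m) ∧
        walkAverage n (2 ^ m) ≤ (C + 600) / n := by
      intro m hm
      obtain ⟨h1, h2⟩ := hbound n hn _ (div_hopGap_le_two_pow hn hm)
      have h3 : C / (n : ℝ) ^ 2 ≤ (C + 600) / (n : ℝ) ^ 2 := by gcongr; linarith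
      have h4 : C / (n : ℝ) ≤ (C + 600) / n := by gcongr; linarith
      exact ⟨by linarith, h2.trans h4⟩
    refine ⟨?_, fun m u => queryCount_qpeCircuit u, fun u => ?_, fun G m hm => ⟨?_, fun O => ?_⟩⟩
    · nlinarith [phaseSize_le hn]
    · have h1 : ((6 * (2 ^ phaseSize n - 1) : ℕ) : ℝ) ≤ 6 * 2 ^ phaseSize n := by
        exact_mod_cast Nat.mul_le_mul_left 6 (Nat.sub_le (2 ^ phaseSize n) 1)
      rw [queryCount_qpeCircuit]
      have h2 := two_pow_phaseSize_le hn
      have h3 : 0 ≤ C * (n : ℝ) ^ 3 := by positivity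
      linarith
    · intro a U hU
      rw [jointProb_eq_walkAverage hn G m hU]
      refine ⟨(hb m hm).1, (hb m hm).2, ?_⟩
      rw [← jointProb_eq_walkAverage hn G m hU]
      exact jointProb_le_postselectedProb hU.1 m _ _
    · rw [runProb_eq_walkAverage O hn]
      exact hb m hm
  · obtain ⟨c, hc, hlow⟩ := exists_le_walkAverage hγ
    -- In the exponent, one factor n comes from the number of runs, n³ from the gate count and cost
    -- per walk step, and n^(6γ) from (2^m)².
    refine ⟨(1 / c + 1) * (216 * 100 ^ (2 * γ)), by positivity, 4 + 6 * γ, fun n hn ζ hζ hζ1 => ?_⟩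
    have hn2 : (2 : ℝ) ≤ n := by exact_mod_cast hn
    have hcn : 0 < c / n := by positivity
    have hL : 0 < Real.log (1 / ζ) := Real.log_pos (by rw [lt_div_iff₀ hζ]; linarith)
    set L := Real.log (1 / ζ)
    have hR : (⌈L / (c / n)⌉₊ : ℝ) ≤ (1 / c + 1) * (1 + L) * n := by
      refine (Nat.ceil_lt_add_one (by positivity)).le.trans ?_
      have h1 : L / (c / n) = 1 / c * L * n := by field_simp
      have h2 : 0 ≤ 1 / c * n := by positivity
      have h3 : 0 ≤ L * n := by positivity
      rw [h1]
      nlinarith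
    have htime : ∀ u, (totalTime (n + 1) (γ * phaseSize n) u ⌈L / (c / n)⌉₊ : ℝ) ≤
        (1 / c + 1) * (216 * 100 ^ (2 * γ)) * (n : ℝ) ^ (4 + 6 * γ) * (1 + L) := fun u =>
      (totalTime_phaseSize_le hn hR u).trans_eq (by ring)
    refine ⟨⌈L / (c / n)⌉₊, hR.trans ?_, fun G => ⟨fun O => ?_, htime _, (htime _).trans ?_⟩⟩
    · have h1 : (1 : ℝ) ≤ 216 * 100 ^ (2 * γ) := by
        have : (1 : ℝ) ≤ 100 ^ (2 * γ) := one_le_pow₀ (by norm_num)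
        linarith
      have h2 : 0 ≤ (1 / c + 1) * (1 + L) * n := by positivity
      calc (1 / c + 1) * (1 + L) * n ≤ (1 / c + 1) * (1 + L) * n * (216 * 100 ^ (2 * γ)) :=
            le_mul_of_one_le_right h2 h1
        _ = _ := by ring
    · have hp := runProb_eq_walkAverage O hn (γ * phaseSize n)
      have h1 := one_sub_pow_ceil_le hcn (hp ▸ hlow n hn) (runProb_le_one O G.exit) hζ
      have h2 := one_sub_pow_le_successProb O (m := γ * phaseSize n) (by omega) ⌈L / (c / n)⌉₊
      linarith
    · have h1 := le_logb_card_vertex (n := n) (by omega)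
      gcongr

end
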